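/- Let $W=\{x+iy\in\mathbb{C}^3=\mathbb{R}^3+i\mathbb{R}^3:|x|\le 1\}$, let $Z=W/i\mathbb{Z}^3=B^3\times T^3$, a compact complex manifold with boundary $M=S^2\times T^3$, and let $I$ be its complex structure. Write $\Omega^k(\cdot)$ for smooth real $k$-forms (on $Z$: smooth up to the boundary) and $\rho|_M$ for the restriction of $\rho$ to $TM$. Let $\Psi+i\hat\Psi=i\,dz_1dz_2dz_3$. *Deformation spaces.* Let $J$ be the operator on real $3$-forms whose complexification is multiplication by $-i$ on types $(3,0),(2,1)$ and by $i$ on types $(1,2),(0,3)$. Put $$\hat{\mathcal K}=\frac{\{\rho\in\Omega^3(Z):d\rho=0,\ dJ\rho=0,\ \rho|_M=0\}}{\{\mathcal L_w\Psi: w|_M=0\}},\qquad \mathcal K=\frac{\{d\alpha:\alpha\in\Omega^2(Z),\ \alpha|_M=0,\ dJd\alpha=0\}}{\{\mathcal L_w\Psi:w|_M=0\}},$$ where $w$ runs over smooth vector fields on $Z$ vanishing on $M$; $\Psi$ is called rigid if $\mathcal K=0$. *Boundary data.* Let $\theta=\sum_i x_i\,dy_i|_M$, with contact planes $H=\ker\theta=TM\cap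 I\,TM$, Reeb field $v=\sum_i x_i\,\partial/\partial y_i$ and $\omega=d\theta$. Let $\mathcal H_M$ be the space of real $\gamma\in\Omega^2(M)$ with $\iota_v\gamma=0$, $\gamma|_H$ of type $(1,1)$, $\omega\wedge\gamma=0$ and $d\gamma|_H=0$. *Maps.* $H^3(M)$ is de Rham cohomology, and $H^3(Z,M)$ is the space of closed $\rho\in\Omega^3(Z)$ with $\rho|_M=0$ modulo $\{d\alpha:\alpha|_M=0\}$. For $\gamma\in\mathcal H_M$ the form $\gamma\wedge\theta$ is closed; put $\Pi_M(\gamma)=[\gamma\wedge\theta]\in H^3(M)$. For $[\rho]\in\hat{\mathcal K}$ one has $(J\rho)|_M=\gamma\wedge\theta$ for a unique $\gamma\in\mathcal H_M$; put $b([\rho])=\gamma$. This gives a well-defined linear map $b:\hat{\mathcal K}\to\mathcal H_M$. **Proposition.** 1. $\Pi_M:\mathcal H_M\to H^3(M)$ is injective. 2. $b:\hat{\mathcal K}\to\mathcal H_M$ is an isomorphism, and the map $\Pi_Z:\mathcal H_M\to H^3(Z,M)$, $\Pi_Z(b([\rho]))=[\rho]$, is injective. 3. The form $\gamma=\sum_{\mathrm{cyclic}}x_i(dx_jdx_k+dy_jdy_k)|_M$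 lies in $\mathcal H_M$ and $[\gamma\wedge\theta]\neq0$ in $H^3(M)$. For every $x\in S^2$, integration over $\{x\}\times T^3$ vanishes on all exact $3$-forms on $M$, and it is nonzero on $\gamma\wedge\theta$. 4. The form $2\,dx_1dx_2dx_3$ defines a class in $\hat{\mathcal K}$ with $b([2\,dx_1dx_2dx_3])=\gamma$. For every $y$, integration over $B^3\times\{y\}$ vanishes on all $d\alpha$ with $\alpha\in\Omega^2(Z)$, $\alpha|_M=0$, and it is nonzero on $2\,dx_1dx_2dx_3$. 5. The pair $(Z,\Psi)$ satisfies the hypotheses of the deformation theorem for Calabi-Yau threefolds with boundary: $\Psi+i\hat\Psi$ is closed, nowhere zero and of type $(3,0)$; the boundary $M$ is strongly pseudoconvex; and $\Psi$ is rigid, that is, $\mathcal K=0$. -/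

import Mathlib

namespace CYTube

open Set
open scoped ContDiff Pointwise

noncomputable section

/-- `ℝ³` with its Euclidean structure. -/
abbrev V3 : Type := EuclideanSpace ℝ (Fin 3)
/-- `ℂ³ = ℝ³ + iℝ³`: the point `x + iy` is the pair `(x, y)`. -/
abbrev C3 : Type := V3 × V3

/-- Real alternating `k`-forms on the real vector space `ℂ³`. -/
abbrev Alt (k : ℕ) : Type := C3 [⋀^Fin k]→L[ℝ] ℝ

theorem contDiffOn_alt {k : ℕ} {s : Set C3} {f : C3 → Alt k}
    (h : ∀ v : Fin k → C3, ContDiffOn ℝ ∞ (fun p => f p v) s) : ContDiffOn ℝ ∞ f s := by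
  let b := Module.finBasis ℝ C3
  let L : Alt k →ₗ[ℝ] ((Fin k → Fin (Module.finrank ℝ C3)) → ℝ) :=
    { toFun := fun f t => f (fun i => b (t i))
      map_add' := fun _ _ => rfl
      map_smul' := fun _ _ => rfl }
  have hL : Function.Injective L := by
    intro f g hfg
    apply ContinuousAlternatingMap.toContinuousMultilinearMap_injective
    apply ContinuousMultilinearMap.toMultilinearMap_injective
    exact Module.Basis.ext_multilinear (fun _ => b) (fun t => congrFun hfg t)
  obtain ⟨G, hG⟩ := L.exists_leftInverse_of_injective (LinearMap.ker_eq_bot.2 hL)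
  let G' : ((Fin k → Fin (Module.finrank ℝ C3)) → ℝ) →L[ℝ] Alt k :=
    ⟨G, LinearMap.continuous_of_finiteDimensional G⟩
  have : f = fun p => G' (L (f p)) := by
    funext p
    exact (LinearMap.congr_fun hG (f p)).symm
  rw [this]
  apply G'.contDiff.comp_contDiffOn
  exact contDiffOn_pi.2 fun t => h _

theorem contDiffOn_alt_apply {k : ℕ} {s : Set C3} {f : C3 → Alt k} {v : Fin k → C3 → C3}
    (hf : ContDiffOn ℝ ∞ f s) (hv : ∀ i, ContDiffOn ℝ ∞ (v i) s) :
    ContDiffOn ℝ ∞ (fun p => f p (fun i => v i p)) s := by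
  have h1 : ContDiff ℝ ∞ (fun q : Alt k × (Fin k → C3) => q.1 q.2) := by
    have := (ContinuousLinearMap.analyticOnNhd_uncurry_of_multilinear
      (ContinuousAlternatingMap.toContinuousMultilinearMapCLM (ι := Fin k) (E := C3) (F := ℝ) (𝕜 := ℝ) ℝ) (s := univ))
    exact this.contDiff
  exact h1.comp_contDiffOn (hf.prodMk (contDiffOn_pi.2 hv))

/-- The closed tube `W = {x + iy : |x| ≤ 1}`.  The manifold with boundary `Z = B³ × T³` is `W / iℤ³`. -/
def tube : Set C3 := Metric.closedBall 0 1 ×ˢ univ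
/-- The boundary `∂W = {x + iy : |x| = 1}`, so `M = ∂Z = ∂W / iℤ³ = S² × T³`. -/
def tubeBdry : Set C3 := Metric.sphere 0 1 ×ˢ univ
/-- The open set `(ℝ³ ∖ 0) × iℝ³`, which retracts radially onto `∂W`. -/
def cone : Set C3 := {p | p.1 ≠ 0}
/-- The element `i n` of the lattice `iℤ³`. -/
def latt (n : Fin 3 → ℤ) : C3 := (0, WithLp.toLp 2 fun i => (n i : ℝ))
/-- The radial retraction `x + iy ↦ x/|x| + iy` of `(ℝ³ ∖ 0) × iℝ³` onto `∂W`. -/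
def retr (p : C3) : C3 := (‖p.1‖⁻¹ • p.1, p.2)

theorem tubeBdry_subset : tubeBdry ⊆ tube := by
  rintro p ⟨h1, h2⟩
  exact ⟨Metric.sphere_subset_closedBall h1, h2⟩

theorem convex_tube : Convex ℝ tube := (convex_closedBall 0 1).prod convex_univ

theorem zero_mem_interior_tube : (0 : C3) ∈ interior tube := by
  rw [tube, interior_prod_eq]
  refine ⟨Metric.ball_subset_interior_closedBall ?_, by simp⟩
  simp

theorem uniqueDiffOn_tube : UniqueDiffOn ℝ tube :=
  uniqueDiffOn_convex convex_tube ⟨0, zero_mem_interior_tube⟩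

theorem isOpen_cone : IsOpen cone := isOpen_ne_fun continuous_fst continuous_const

theorem contDiffOn_retr : ContDiffOn ℝ ∞ retr cone := by
  have h1 : ContDiffOn ℝ ∞ (fun p : C3 => p.1) cone := contDiff_fst.contDiffOn
  have h2 : ContDiffOn ℝ ∞ (fun p : C3 => ‖p.1‖) cone := h1.norm ℝ (fun p hp => hp)
  exact ((h2.inv (fun p hp => norm_ne_zero_iff.2 hp)).smul h1).prodMk contDiff_snd.contDiffOn

theorem retr_mem_tubeBdry {p : C3} (hp : p ∈ cone) : retr p ∈ tubeBdry := by
  have : ‖p.1‖ ≠ 0 := norm_ne_zero_iff.2 hp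
  refine ⟨?_, mem_univ _⟩
  simp [retr, norm_smul, this]

theorem tubeBdry_subset_cone : tubeBdry ⊆ cone := by
  rintro p ⟨h1, -⟩ h0
  rw [mem_sphere_zero_iff_norm, h0] at h1
  simp at h1

theorem retr_of_mem {p : C3} (hp : p ∈ tubeBdry) : retr p = p := by
  have : ‖p.1‖ = 1 := by simpa using hp.1
  simp [retr, this]

theorem add_latt_mem_tube {p : C3} {n : Fin 3 → ℤ} : p + latt n ∈ tube ↔ p ∈ tube := by
  simp [tube, latt]

theorem add_latt_mem_cone {p : C3} {n : Fin 3 → ℤ} : p + latt n ∈ cone ↔ p ∈ cone := by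
  simp [cone, latt]

theorem retr_add_latt (p : C3) (n : Fin 3 → ℤ) : retr (p + latt n) = retr p + latt n := by
  simp [retr, latt]

theorem fderiv_retr_add_latt (p : C3) (n : Fin 3 → ℤ) :
    fderiv ℝ retr (p + latt n) = fderiv ℝ retr p := by
  rw [← fderiv_comp_add_right]
  simp only [retr_add_latt]
  exact fderiv_add_const _

theorem hasFDerivAt_retr {p : C3} (hp : p ∈ cone) : HasFDerivAt retr (fderiv ℝ retr p) p :=
  ((contDiffOn_retr.contDiffAt (isOpen_cone.mem_nhds hp)).differentiableAt (by simp)).hasFDerivAt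

theorem fderiv_retr_comp {p : C3} (hp : p ∈ cone) :
    (fderiv ℝ retr (retr p)).comp (fderiv ℝ retr p) = fderiv ℝ retr p := by
  have h1 := (hasFDerivAt_retr (tubeBdry_subset_cone (retr_mem_tubeBdry hp))).comp p
    (hasFDerivAt_retr hp)
  have h2 : retr ∘ retr =ᶠ[nhds p] retr := by
    filter_upwards [isOpen_cone.mem_nhds hp] with q hq
    exact retr_of_mem (retr_mem_tubeBdry hq)
  exact (h2.hasFDerivAt_iff.1 h1).fderiv.symm

/-- The space `Ω^k(Z)` of smooth real `k`-forms on `Z = W / iℤ³`: the `iℤ³`-invariant `k`-forms on `W`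
that are smooth up to the boundary.  (A form is recorded as a function on `ℂ³` that is `0` off `W`.) -/
def FormZ (k : ℕ) : Submodule ℝ (C3 → Alt k) where
  carrier := {ρ | ContDiffOn ℝ ∞ ρ tube ∧ (∀ p n, ρ (p + latt n) = ρ p) ∧ ∀ p ∉ tube, ρ p = 0}
  add_mem' := by
    rintro ρ σ ⟨h1, h2, h3⟩ ⟨k1, k2, k3⟩
    exact ⟨h1.add k1, fun p n => by simp [h2, k2], fun p hp => by simp [h3 p hp, k3 p hp]⟩
  zero_mem' := ⟨contDiffOn_const, fun _ _ => rfl, fun _ _ => rfl⟩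
  smul_mem' := by
    rintro c ρ ⟨h1, h2, h3⟩
    exact ⟨h1.const_smul c, fun p n => by simp [h2], fun p hp => by simp [h3 p hp]⟩

instance (k : ℕ) : AddCommMonoid (FormZ k) := AddCommGroup.toAddCommMonoid

instance (k : ℕ) : Module ℝ (FormZ k) := (FormZ k).module

theorem FormZ_diff {k : ℕ} (ρ : FormZ k) {p : C3} (hp : p ∈ tube) :
    DifferentiableWithinAt ℝ ρ.1 tube p :=
  (ρ.2.1.differentiableOn (by simp)) p hp

theorem vadd_latt_tube (n : Fin 3 → ℤ) : latt n +ᵥ tube = tube := by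
  ext p
  rw [mem_vadd_set_iff_neg_vadd_mem, vadd_eq_add, ← add_latt_mem_tube (n := n)]
  simp

theorem fderivWithin_periodic {F : Type*} [NormedAddCommGroup F] [NormedSpace ℝ F] {f : C3 → F}
    (h : ∀ p n, f (p + latt n) = f p) (p : C3) (n : Fin 3 → ℤ) :
    fderivWithin ℝ f tube (p + latt n) = fderivWithin ℝ f tube p := by
  conv_rhs => rw [show f = fun q => f (q + latt n) from funext fun q => (h q n).symm]
  rw [fderivWithin_comp_add_right, vadd_latt_tube]

theorem fderiv_periodic {F : Type*} [NormedAddCommGroup F] [NormedSpace ℝ F] {f : C3 → F}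
    (h : ∀ p n, f (p + latt n) = f p) (p : C3) (n : Fin 3 → ℤ) :
    fderiv ℝ f (p + latt n) = fderiv ℝ f p := by
  rw [← fderiv_comp_add_right]
  simp only [h]

theorem mem_FormZ_indicator {k : ℕ} {f : C3 → Alt k} (h1 : ContDiffOn ℝ ∞ f tube)
    (h2 : ∀ p n, f (p + latt n) = f p) : tube.indicator f ∈ FormZ k := by
  refine ⟨h1.congr fun p hp => indicator_of_mem hp _, fun p n => ?_,
    fun p hp => indicator_of_notMem hp _⟩
  by_cases hp : p ∈ tube
  · rw [indicator_of_mem hp, indicator_of_mem (add_latt_mem_tube.2 hp), h2]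
  · rw [indicator_of_notMem hp, indicator_of_notMem (mt add_latt_mem_tube.1 hp)]

/-- The exterior derivative `d : Ω^k(Z) → Ω^{k+1}(Z)`. -/
def dZ (k : ℕ) : FormZ k →ₗ[ℝ] FormZ (k + 1) where
  toFun ρ := ⟨tube.indicator (extDerivWithin ρ.1 tube), by
    refine mem_FormZ_indicator ?_ fun p n => ?_
    · exact (ContinuousAlternatingMap.alternatizeUncurryFinCLM ℝ C3 ℝ).contDiff.comp_contDiffOn
        (ρ.2.1.fderivWithin (m := ∞) uniqueDiffOn_tube (by simp))
    · simp only [extDerivWithin]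
      rw [fderivWithin_periodic ρ.2.2.1]⟩
  map_add' ρ σ := by
    apply Subtype.ext
    funext p
    by_cases hp : p ∈ tube
    · simp [hp, extDerivWithin_add (uniqueDiffOn_tube p hp) (FormZ_diff ρ hp) (FormZ_diff σ hp)]
    · simp [hp]
  map_smul' c ρ := by
    apply Subtype.ext
    funext p
    by_cases hp : p ∈ tube
    · simp [hp, extDerivWithin_smul c ρ.1 (uniqueDiffOn_tube p hp)]
    · simp [hp]

/-- The pull-back `r^* τ` of a form under the retraction `r = retr`. -/
def pull {k : ℕ} (τ : C3 → Alt k) (p : C3) : Alt k :=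
  (τ (retr p)).compContinuousLinearMap (fderiv ℝ retr p)

/-- The space `Ω^k(M)` of smooth real `k`-forms on `M = ∂W / iℤ³`.  A form on `M` is recorded through its
pull-back under the retraction `r : (ℝ³ ∖ 0) × iℝ³ → ∂W`.  This identifies the forms on `∂W` with the
smooth forms `τ` on `(ℝ³ ∖ 0) × iℝ³` such that `r^* τ = τ`; the inverse is the restriction to the
tangent vectors of `∂W` at points of `∂W`, and `d` commutes with the identification.  (As before, the
function is `0` off the domain.) -/
def FormM (k : ℕ) : Submodule ℝ (C3 → Alt k) where
  carrier := {τ | ContDiffOn ℝ ∞ τ cone ∧ (∀ p n, τ (p + latt n) = τ p) ∧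
    (∀ p ∈ cone, pull τ p = τ p) ∧ ∀ p ∉ cone, τ p = 0}
  add_mem' := by
    rintro ρ σ ⟨h1, h2, h3, h4⟩ ⟨k1, k2, k3, k4⟩
    refine ⟨h1.add k1, fun p n => by simp [h2, k2], fun p hp => ?_,
      fun p hp => by simp [h4 p hp, k4 p hp]⟩
    rw [Pi.add_apply, ← h3 p hp, ← k3 p hp]
    rfl
  zero_mem' := ⟨contDiffOn_const, fun _ _ => rfl, fun _ _ => rfl, fun _ _ => rfl⟩
  smul_mem' := by
    rintro c ρ ⟨h1, h2, h3, h4⟩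
    refine ⟨h1.const_smul c, fun p n => by simp [h2], fun p hp => ?_, fun p hp => by simp [h4 p hp]⟩
    rw [Pi.smul_apply, ← h3 p hp]
    rfl

instance (k : ℕ) : AddCommMonoid (FormM k) := AddCommGroup.toAddCommMonoid

instance (k : ℕ) : Module ℝ (FormM k) := (FormM k).module

theorem mem_FormM_indicator {k : ℕ} {f : C3 → Alt k} (h1 : ContDiffOn ℝ ∞ f cone)
    (h2 : ∀ p n, f (p + latt n) = f p) (h3 : ∀ p ∈ cone, pull f p = f p) :
    cone.indicator f ∈ FormM k := by
  refine ⟨h1.congr fun p hp => indicator_of_mem hp _, fun p n => ?_, fun p hp => ?_,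
    fun p hp => indicator_of_notMem hp _⟩
  · by_cases hp : p ∈ cone
    · rw [indicator_of_mem hp, indicator_of_mem (add_latt_mem_cone.2 hp), h2]
    · rw [indicator_of_notMem hp, indicator_of_notMem (mt add_latt_mem_cone.1 hp)]
  · rw [indicator_of_mem hp, ← h3 p hp, pull, pull,
      indicator_of_mem (tubeBdry_subset_cone (retr_mem_tubeBdry hp))]

theorem FormM_diff {k : ℕ} (τ : FormM k) {p : C3} (hp : p ∈ cone) :
    DifferentiableAt ℝ τ.1 p :=
  (τ.2.1.contDiffAt (isOpen_cone.mem_nhds hp)).differentiableAt (by simp)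

theorem retr_mem_cone {p : C3} (hp : p ∈ cone) : retr p ∈ cone :=
  tubeBdry_subset_cone (retr_mem_tubeBdry hp)

theorem two_le_inf : (2 : WithTop ℕ∞) ≤ ∞ := 
  WithTop.coe_le_coe.2 (le_top : (2 : ℕ∞) ≤ ⊤)

/-- The exterior derivative `d : Ω^k(M) → Ω^{k+1}(M)`. -/
def dM (k : ℕ) : FormM k →ₗ[ℝ] FormM (k + 1) where
  toFun τ := ⟨cone.indicator (extDeriv τ.1), by
    refine mem_FormM_indicator ?_ (fun p n => ?_) fun p hp => ?_
    · exact (ContinuousAlternatingMap.alternatizeUncurryFinCLM ℝ C3 ℝ).contDiff.comp_contDiffOn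
        (τ.2.1.fderiv_of_isOpen (m := ∞) isOpen_cone (by simp))
    · simp only [extDeriv]
      rw [fderiv_periodic τ.2.2.1]
    · have h1 : pull τ.1 =ᶠ[nhds p] τ.1 := by
        filter_upwards [isOpen_cone.mem_nhds hp] with q hq using τ.2.2.2.1 q hq
      rw [← h1.extDeriv_eq]
      exact (extDeriv_pullback (r := ∞) (FormM_diff τ (retr_mem_cone hp))
        (contDiffOn_retr.contDiffAt (isOpen_cone.mem_nhds hp)) (by simpa using two_le_inf)).symm⟩
  map_add' ρ σ := by
    apply Subtype.ext
    funext p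
    by_cases hp : p ∈ cone
    · simp [hp, extDeriv_add (FormM_diff ρ hp) (FormM_diff σ hp)]
    · simp [hp]
  map_smul' c ρ := by
    apply Subtype.ext
    funext p
    by_cases hp : p ∈ cone
    · simp [hp, extDeriv_smul c ρ.1]
    · simp [hp]

theorem contDiffOn_fderiv_retr (v : C3) : ContDiffOn ℝ ∞ (fun p => fderiv ℝ retr p v) cone :=
  (contDiffOn_retr.fderiv_of_isOpen isOpen_cone (m := ∞) (by simp)).clm_apply contDiffOn_const

/-- The restriction `ρ ↦ ρ|_M`, `Ω^k(Z) → Ω^k(M)` (see also `restr_apply_bdry`). -/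
def restr (k : ℕ) : FormZ k →ₗ[ℝ] FormM k where
  toFun ρ := ⟨cone.indicator (pull ρ.1), by
    refine mem_FormM_indicator ?_ (fun p n => ?_) fun p hp => ?_
    · refine contDiffOn_alt fun v => ?_
      refine contDiffOn_alt_apply (f := fun p => ρ.1 (retr p))
        (v := fun i p => fderiv ℝ retr p (v i)) ?_ fun i => contDiffOn_fderiv_retr _
      exact ρ.2.1.comp contDiffOn_retr fun p hp => tubeBdry_subset (retr_mem_tubeBdry hp)
    · rw [pull, pull, fderiv_retr_add_latt, retr_add_latt, ρ.2.2.1]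
    · simp only [pull]
      rw [retr_of_mem (retr_mem_tubeBdry hp)]
      ext v
      simp only [ContinuousAlternatingMap.compContinuousLinearMap_apply]
      congr 1
      funext i
      exact DFunLike.congr_fun (fderiv_retr_comp hp) (v i)⟩
  map_add' ρ σ := by
    apply Subtype.ext
    funext p
    by_cases hp : p ∈ cone
    · simp [hp, pull]
      rfl
    · simp [hp]
  map_smul' c ρ := by
    apply Subtype.ext
    funext p
    by_cases hp : p ∈ cone
    · simp [hp, pull]
      rfl
    · simp [hp]

/-- The wedge product `η ∧ σ` of a `1`-form `η` and a `k`-form `σ` (see `wedgeOne_apply`). -/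
def wedgeOne {𝔸 : Type*} [NormedField 𝔸] [NormedAlgebra ℝ 𝔸] {k : ℕ}
    (η : C3 [⋀^Fin 1]→L[ℝ] 𝔸) (σ : C3 [⋀^Fin k]→L[ℝ] 𝔸) : C3 [⋀^Fin (k + 1)]→L[ℝ] 𝔸 :=
  ContinuousAlternatingMap.alternatizeUncurryFin ((ContinuousLinearMap.lsmul ℝ 𝔸).flip σ ∘L
    (ContinuousAlternatingMap.ofSubsingleton ℝ C3 𝔸 (0 : Fin 1)).symm η)

infixr:70 " ⋏ " => wedgeOne

theorem wedgeOne_apply {𝔸 : Type*} [NormedField 𝔸] [NormedAlgebra ℝ 𝔸] {k : ℕ}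
    (η : C3 [⋀^Fin 1]→L[ℝ] 𝔸) (σ : C3 [⋀^Fin k]→L[ℝ] 𝔸) (v : Fin (k + 1) → C3) :
    (η ⋏ σ) v = ∑ i, (-1) ^ i.val • (η (fun _ => v i) * σ (i.removeNth v)) := by
  simp only [wedgeOne, ContinuousAlternatingMap.alternatizeUncurryFin_apply]
  rfl

/-- The value on four vectors of the wedge product `σ ∧ τ` of two `2`-forms. -/
def wedgeTwoTwo (σ τ : Alt 2) (v : Fin 4 → C3) : ℝ :=
  σ ![v 0, v 1] * τ ![v 2, v 3] - σ ![v 0, v 2] * τ ![v 1, v 3] + σ ![v 0, v 3] * τ ![v 1, v 2]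
    + σ ![v 1, v 2] * τ ![v 0, v 3] - σ ![v 1, v 3] * τ ![v 0, v 2] + σ ![v 2, v 3] * τ ![v 0, v 1]

/-- The complex structure `I (x, y) = (-y, x)`, that is, multiplication by `i`. -/
def cplx : C3 →L[ℝ] C3 :=
  (-ContinuousLinearMap.snd ℝ V3 V3).prod (ContinuousLinearMap.fst ℝ V3 V3)

/-- The operator `J` on real `3`-forms whose complexification is multiplication by `-i` on forms of type
`(3,0)` and `(2,1)`, and by `i` on forms of type `(1,2)` and `(0,3)`: explicitly
`(Jρ)(a,b,c) = -½ (ρ(Ia,b,c) + ρ(a,Ib,c) + ρ(a,b,Ic) + ρ(Ia,Ib,Ic))` (see `opJ_apply`).  On type `(p,q)`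
the sum of the first three terms is multiplication by `i(p-q)` and the last one by `i^(p-q)`. -/
def opJ (ρ : Alt 3) : Alt 3 :=
  (-(1 / 2 : ℝ)) • (ContinuousAlternatingMap.alternatizeUncurryFin (ρ.curryLeft ∘L cplx) +
    ρ.compContinuousLinearMap cplx)

theorem removeNth_three {α : Type*} (v : Fin 3 → α) :
    ((0 : Fin 3).removeNth v = ![v 1, v 2]) ∧ ((1 : Fin 3).removeNth v = ![v 0, v 2]) ∧
      ((2 : Fin 3).removeNth v = ![v 0, v 1]) := by
  refine ⟨?_, ?_, ?_⟩ <;> · funext i; fin_cases i <;> rfl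

theorem removeNth_four {α : Type*} (v : Fin 4 → α) :
    ((0 : Fin 4).removeNth v = ![v 1, v 2, v 3]) ∧ ((1 : Fin 4).removeNth v = ![v 0, v 2, v 3]) ∧
      ((2 : Fin 4).removeNth v = ![v 0, v 1, v 3]) ∧
      ((3 : Fin 4).removeNth v = ![v 0, v 1, v 2]) := by
  refine ⟨?_, ?_, ?_, ?_⟩ <;> · funext i; fin_cases i <;> rfl

theorem alt3_swap01 (ρ : Alt 3) (a b c : C3) : ρ ![a, b, c] = -ρ ![b, a, c] := by
  rw [show -ρ ![b, a, c] = ρ (![b, a, c] ∘ Equiv.swap (0 : Fin 3) 1) from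
    (ρ.toAlternatingMap.map_swap ![b, a, c] (i := 0) (j := 1) (by decide)).symm]
  congr 1; funext i; fin_cases i <;> rfl

theorem alt3_swap12 (ρ : Alt 3) (a b c : C3) : ρ ![a, b, c] = -ρ ![a, c, b] := by
  rw [show -ρ ![a, c, b] = ρ (![a, c, b] ∘ Equiv.swap (1 : Fin 3) 2) from
    (ρ.toAlternatingMap.map_swap ![a, c, b] (i := 1) (j := 2) (by decide)).symm]
  congr 1; funext i; fin_cases i <;> rfl

theorem alt2_swap (ρ : Alt 2) (a b : C3) : ρ ![a, b] = -ρ ![b, a] := by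
  rw [show -ρ ![b, a] = ρ (![b, a] ∘ Equiv.swap (0 : Fin 2) 1) from
    (ρ.toAlternatingMap.map_swap ![b, a] (i := 0) (j := 1) (by decide)).symm]
  congr 1; funext i; fin_cases i <;> rfl

theorem deriv_action_apply (ρ : Alt 3) (A : C3 →L[ℝ] C3) (a b c : C3) :
    ContinuousAlternatingMap.alternatizeUncurryFin (ρ.curryLeft ∘L A) ![a, b, c] =
      ρ ![A a, b, c] + ρ ![a, A b, c] + ρ ![a, b, A c] := by
  rw [ContinuousAlternatingMap.alternatizeUncurryFin_apply, Fin.sum_univ_three,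
    (removeNth_three _).1, (removeNth_three _).2.1, (removeNth_three _).2.2]
  simp only [ContinuousLinearMap.comp_apply, ContinuousAlternatingMap.curryLeft_apply_apply]
  have h1 := alt3_swap01 ρ (A b) a c
  have h2 := alt3_swap01 ρ (A c) a b
  have h3 := alt3_swap12 ρ a (A c) b
  change (-1 : ℤ) ^ 0 • ρ ![A a, b, c] + (-1 : ℤ) ^ 1 • ρ ![A b, a, c] +
    (-1 : ℤ) ^ 2 • ρ ![A c, a, b] = _
  rw [h1, h2, h3]
  simp

theorem opJ_apply (ρ : Alt 3) (a b c : C3) :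
    opJ ρ ![a, b, c] = -(1 / 2) * (ρ ![cplx a, b, c] + ρ ![a, cplx b, c] + ρ ![a, b, cplx c] +
      ρ ![cplx a, cplx b, cplx c]) := by
  have : cplx ∘ ![a, b, c] = ![cplx a, cplx b, cplx c] := by
    funext i; fin_cases i <;> rfl
  simp only [opJ, ContinuousAlternatingMap.smul_apply, ContinuousAlternatingMap.add_apply,
    deriv_action_apply, ContinuousAlternatingMap.compContinuousLinearMap_apply, this, smul_eq_mul]

theorem vec3_eta {α : Type*} (v : Fin 3 → α) : v = ![v 0, v 1, v 2] := by
  funext i; fin_cases i <;> rfl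

theorem contDiffOn_alt3 {s : Set C3} {ρ : C3 → Alt 3} (h : ContDiffOn ℝ ∞ ρ s) (a b c : C3) :
    ContDiffOn ℝ ∞ (fun p => ρ p ![a, b, c]) s := 
  contDiffOn_alt_apply (v := fun i _ => ![a, b, c] i) h fun i => contDiffOn_const

/-- The operator `J` on `Ω³(Z)`. -/
def JZ : FormZ 3 →ₗ[ℝ] FormZ 3 where
  toFun ρ := ⟨fun p => opJ (ρ.1 p), by
    refine ⟨contDiffOn_alt fun v => ?_, fun p n => by simp only [ρ.2.2.1], fun p hp => ?_⟩
    · rw [vec3_eta v]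
      simp only [opJ_apply]
      exact contDiffOn_const.mul ((((contDiffOn_alt3 ρ.2.1 _ _ _).add
        (contDiffOn_alt3 ρ.2.1 _ _ _)).add (contDiffOn_alt3 ρ.2.1 _ _ _)).add
        (contDiffOn_alt3 ρ.2.1 _ _ _))
    · beta_reduce
      rw [ρ.2.2.2 p hp]
      ext v
      rw [vec3_eta v, opJ_apply]
      simp⟩
  map_add' ρ σ := by
    apply Subtype.ext
    funext p
    ext v
    rw [vec3_eta v]
    simp only [Submodule.coe_add, Pi.add_apply, ContinuousAlternatingMap.add_apply, opJ_apply]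
    ring
  map_smul' c ρ := by
    apply Subtype.ext
    funext p
    ext v
    rw [vec3_eta v]
    simp only [Submodule.coe_smul, Pi.smul_apply, ContinuousAlternatingMap.smul_apply, opJ_apply,
      RingHom.id_apply, smul_eq_mul]
    ring

/-- The smooth vector fields `w` on `Z` with `w|_M = 0`. -/
def VField : Submodule ℝ (C3 → C3) where
  carrier := {w | ContDiffOn ℝ ∞ w tube ∧ (∀ p n, w (p + latt n) = w p) ∧
    (∀ p ∉ tube, w p = 0) ∧ ∀ p ∈ tubeBdry, w p = 0}
  add_mem' := by
    rintro ρ σ ⟨h1, h2, h3, h4⟩ ⟨k1, k2, k3, k4⟩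
    exact ⟨h1.add k1, fun p n => by simp [h2, k2], fun p hp => by simp [h3 p hp, k3 p hp],
      fun p hp => by simp [h4 p hp, k4 p hp]⟩
  zero_mem' := ⟨contDiffOn_const, fun _ _ => rfl, fun _ _ => rfl, fun _ _ => rfl⟩
  smul_mem' := by
    rintro c ρ ⟨h1, h2, h3, h4⟩
    exact ⟨h1.const_smul c, fun p n => by simp [h2], fun p hp => by simp [h3 p hp],
      fun p hp => by simp [h4 p hp]⟩

/-- The interior product `i_w ρ`. -/
def interiorProd {k : ℕ} (ρ : FormZ (k + 1)) : VField →ₗ[ℝ] FormZ k where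
  toFun w := ⟨fun p => (ρ.1 p).curryLeft (w.1 p), by
    refine ⟨contDiffOn_alt fun v => ?_, fun p n => by beta_reduce; rw [ρ.2.2.1, w.2.2.1],
      fun p hp => by beta_reduce; rw [w.2.2.2.1 p hp, map_zero]⟩
    simp only [ContinuousAlternatingMap.curryLeft_apply_apply]
    refine contDiffOn_alt_apply (v := fun i p => Matrix.vecCons (w.1 p) v i) ρ.2.1 fun i => ?_
    exact Fin.cases w.2.1 (fun j => contDiffOn_const) i⟩
  map_add' w u := by
    apply Subtype.ext
    funext p
    simp
  map_smul' c w := by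
    apply Subtype.ext
    funext p
    simp

/-- The Lie derivative `L_w ρ = d(i_w ρ) + i_w(dρ)`. -/
def lieZ {k : ℕ} (ρ : FormZ (k + 1)) : VField →ₗ[ℝ] FormZ (k + 1) :=
  dZ k ∘ₗ interiorProd ρ + interiorProd (dZ (k + 1) ρ)

/-- The Reeb field `v = ∑ xᵢ ∂/∂yᵢ` of the contact form `θ` on `M`. -/
def reeb (p : C3) : C3 := (0, (retr p).1)

theorem fderiv_retr_apply_snd {p : C3} (hp : p ∈ cone) (a : V3) :
    fderiv ℝ retr p (0, a) = (0, a) := by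
  have h1 : HasFDerivAt (fun t : ℝ => p + t • ((0, a) : C3))
      ((ContinuousLinearMap.id ℝ ℝ).smulRight ((0, a) : C3)) 0 := by
    exact ((hasFDerivAt_id (0 : ℝ)).smul_const ((0, a) : C3)).const_add p
  have h2 : HasFDerivAt retr (fderiv ℝ retr p) (p + (0 : ℝ) • ((0, a) : C3)) := by
    simpa using hasFDerivAt_retr hp
  have h3 := h2.comp (0 : ℝ) h1
  have h4 : (retr ∘ fun t : ℝ => p + t • ((0, a) : C3)) = fun t => retr p + t • ((0, a) : C3) := by
    funext t
    simp [retr]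
  rw [h4] at h3
  have h5 : HasFDerivAt (fun t : ℝ => retr p + t • ((0, a) : C3))
      ((ContinuousLinearMap.id ℝ ℝ).smulRight ((0, a) : C3)) 0 := by
    exact ((hasFDerivAt_id (0 : ℝ)).smul_const ((0, a) : C3)).const_add _
  have := DFunLike.congr_fun (h3.unique h5) 1
  simpa using this

theorem reeb_retr {p : C3} (hp : p ∈ cone) : reeb (retr p) = reeb p := by
  simp [reeb, retr_of_mem (retr_mem_tubeBdry hp)]

/-- The interior product `i_v τ` of a form on `M` with the Reeb field. -/
def contrReeb (k : ℕ) : FormM (k + 1) →ₗ[ℝ] FormM k where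
  toFun τ := ⟨cone.indicator fun p => (τ.1 p).curryLeft (reeb p), by
    refine mem_FormM_indicator (contDiffOn_alt fun v => ?_) (fun p n => ?_) fun p hp => ?_
    · simp only [ContinuousAlternatingMap.curryLeft_apply_apply]
      refine contDiffOn_alt_apply (v := fun i p => Matrix.vecCons (reeb p) v i) τ.2.1 fun i => ?_
      refine Fin.cases ?_ (fun j => contDiffOn_const) i
      exact contDiffOn_const.prodMk contDiffOn_retr.fst
    · rw [τ.2.2.1, reeb, reeb, retr_add_latt]
      simp [latt]
    · conv_rhs => rw [← τ.2.2.2.1 p hp]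
      ext v
      simp only [pull, ContinuousAlternatingMap.compContinuousLinearMap_apply,
        ContinuousAlternatingMap.curryLeft_apply_apply, reeb_retr hp]
      congr 1
      funext i
      refine Fin.cases ?_ (fun j => rfl) i
      exact (fderiv_retr_apply_snd hp _).symm⟩
  map_add' τ σ := by
    apply Subtype.ext
    funext p
    by_cases hp : p ∈ cone
    · simp [hp]
    · simp [hp]
  map_smul' c τ := by
    apply Subtype.ext
    funext p
    by_cases hp : p ∈ cone
    · simp [hp]
    · simp [hp]

/-- The wedge product `η ∧ σ` of a `1`-form and a `k`-form on `M`. -/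
def wedgeM {k : ℕ} (η : FormM 1) : FormM k →ₗ[ℝ] FormM (k + 1) where
  toFun σ := ⟨fun p => η.1 p ⋏ σ.1 p, by
    refine ⟨contDiffOn_alt fun v => ?_, fun p n => by beta_reduce; rw [η.2.2.1, σ.2.2.1], fun p hp => ?_,
      fun p hp => ?_⟩
    · simp only [wedgeOne_apply]
      refine ContDiffOn.sum fun i _ => ContDiffOn.const_smul _ (ContDiffOn.mul ?_ ?_)
      · exact contDiffOn_alt_apply (v := fun _ _ => v i) η.2.1 fun i => contDiffOn_const
      · exact contDiffOn_alt_apply (v := fun j _ => i.removeNth v j) σ.2.1 fun i => contDiffOn_const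
    · conv_rhs => beta_reduce; rw [← η.2.2.2.1 p hp, ← σ.2.2.2.1 p hp]
      ext v
      simp only [pull, ContinuousAlternatingMap.compContinuousLinearMap_apply, wedgeOne_apply]
      rfl
    · ext v
      beta_reduce
      rw [η.2.2.2.2 p hp, wedgeOne_apply]
      simp⟩
  map_add' σ τ := by
    apply Subtype.ext
    funext p
    ext v
    simp [wedgeOne_apply, mul_add, Finset.sum_add_distrib]
  map_smul' c σ := by
    apply Subtype.ext
    funext p
    ext v
    simp only [Submodule.coe_smul, Pi.smul_apply, ContinuousAlternatingMap.smul_apply,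
      wedgeOne_apply, RingHom.id_apply, smul_eq_mul, Finset.mul_sum]
    refine Finset.sum_congr rfl fun i _ => ?_
    simp; ring

/-- The `1`-form `dxᵢ`. -/
def dx (i : Fin 3) : Alt 1 :=
  ContinuousAlternatingMap.ofSubsingleton ℝ C3 ℝ (0 : Fin 1)
    (EuclideanSpace.proj i ∘L ContinuousLinearMap.fst ℝ V3 V3)

/-- The `1`-form `dyᵢ`. -/
def dy (i : Fin 3) : Alt 1 :=
  ContinuousAlternatingMap.ofSubsingleton ℝ C3 ℝ (0 : Fin 1)
    (EuclideanSpace.proj i ∘L ContinuousLinearMap.snd ℝ V3 V3)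

/-- The complex `1`-form `dzᵢ = dxᵢ + i dyᵢ`. -/
def dz (i : Fin 3) : C3 [⋀^Fin 1]→L[ℝ] ℂ :=
  Complex.ofRealCLM.compContinuousAlternatingMap (dx i) +
    Complex.I • Complex.ofRealCLM.compContinuousAlternatingMap (dy i)

/-- The complex `3`-form `i dz₁dz₂dz₃`. -/
def Theta : C3 [⋀^Fin 3]→L[ℝ] ℂ := Complex.I • (dz 0 ⋏ dz 1 ⋏ dz 2)

/-- The form on `Z` with constant coefficients `a`. -/
def constZ {k : ℕ} (a : Alt k) : FormZ k :=
  ⟨tube.indicator fun _ => a, mem_FormZ_indicator contDiffOn_const fun _ _ => rfl⟩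

/-- `Ψ = Re (i dz₁dz₂dz₃)`. -/
def PsiZ : FormZ 3 := constZ (Complex.reCLM.compContinuousAlternatingMap Theta)

/-- `Ψ̂ = Im (i dz₁dz₂dz₃)`. -/
def PsiHatZ : FormZ 3 := constZ (Complex.imCLM.compContinuousAlternatingMap Theta)

theorem contDiffOn_coord (i : Fin 3) : ContDiffOn ℝ ∞ (fun p : C3 => p.1 i) tube :=
  ((EuclideanSpace.proj (𝕜 := ℝ) i).contDiff.comp contDiff_fst).contDiffOn

/-- The `1`-form `∑ xᵢ dyᵢ` on `Z`. -/
def contactZ : FormZ 1 :=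
  ⟨tube.indicator fun p => ∑ i, p.1 i • dy i, by
    refine mem_FormZ_indicator (ContDiffOn.sum fun i _ => ?_) fun p n => ?_
    · exact (contDiffOn_coord i).smul contDiffOn_const
    · simp [latt]⟩

/-- The contact form `θ = ∑ xᵢ dyᵢ` on `M`. -/
def contactM : FormM 1 := restr 1 contactZ

/-- `ω = dθ`. -/
def omegaM : FormM 2 := dM 1 contactM

/-- The `2`-form `∑_cyclic xᵢ (dxⱼdxₖ + dyⱼdyₖ)` on `Z` (indices modulo `3`). -/
def gammaZ : FormZ 2 :=
  ⟨tube.indicator fun p =>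
      ∑ i, p.1 i • (dx (i + 1) ⋏ dx (i + 2) + dy (i + 1) ⋏ dy (i + 2)), by
    refine mem_FormZ_indicator (ContDiffOn.sum fun i _ => ?_) fun p n => ?_
    · exact (contDiffOn_coord i).smul contDiffOn_const
    · simp [latt]⟩

/-- `γ = ∑_cyclic xᵢ (dxⱼdxₖ + dyⱼdyₖ)` on `M`. -/
def gammaM : FormM 2 := restr 2 gammaZ

/-- `χ = dx₁dx₂dx₃`. -/
def chiZ : FormZ 3 := constZ (dx 0 ⋏ dx 1 ⋏ dx 2)

/-- The tangent space `T_pM` at `p ∈ ∂W`. -/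
def tangentM (p : C3) : Submodule ℝ C3 where
  carrier := {w | inner ℝ p.1 w.1 = 0}
  add_mem' := by
    intro a b ha hb
    simp only [mem_ofPred_eq, Prod.fst_add, inner_add_right] at *
    rw [ha, hb, add_zero]
  zero_mem' := by simp
  smul_mem' := by
    intro c a ha
    simp only [mem_ofPred_eq, Prod.smul_fst, inner_smul_right] at *
    rw [ha, mul_zero]

/-- The contact plane `H_p = ker θ_p ⊆ T_pM`; it is also `T_pM ∩ I T_pM`. -/
def contactPlane (p : C3) : Submodule ℝ C3 where
  carrier := {w | w ∈ tangentM p ∧ contactM.1 p (fun _ => w) = 0}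
  add_mem' := by
    rintro a b ⟨ha, ha'⟩ ⟨hb, hb'⟩
    refine ⟨add_mem ha hb, ?_⟩
    have := (contactM.1 p).map_update_add (fun _ => (0 : C3)) 0 a b
    have e : ∀ w : C3, Function.update (fun _ : Fin 1 => (0 : C3)) 0 w = fun _ => w := fun w => by
      funext i; fin_cases i; rfl
    rw [e, e, e, ha', hb', add_zero] at this
    exact this
  zero_mem' := ⟨zero_mem _, (contactM.1 p).map_coord_zero 0 rfl⟩
  smul_mem' := by
    rintro c a ⟨ha, ha'⟩
    refine ⟨(tangentM p).smul_mem c ha, ?_⟩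
    have := (contactM.1 p).map_update_smul (fun _ => (0 : C3)) 0 c a
    have e : ∀ w : C3, Function.update (fun _ : Fin 1 => (0 : C3)) 0 w = fun _ => w := fun w => by
      funext i; fin_cases i; rfl
    rw [e, e, ha', smul_zero] at this
    exact this

theorem wedgeTwoTwo_add (η σ τ : Alt 2) (v : Fin 4 → C3) :
    wedgeTwoTwo η (σ + τ) v = wedgeTwoTwo η σ v + wedgeTwoTwo η τ v := by
  simp only [wedgeTwoTwo, ContinuousAlternatingMap.add_apply]
  ring

theorem wedgeTwoTwo_smul (η σ : Alt 2) (c : ℝ) (v : Fin 4 → C3) :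
    wedgeTwoTwo η (c • σ) v = c * wedgeTwoTwo η σ v := by
  simp only [wedgeTwoTwo, ContinuousAlternatingMap.smul_apply, smul_eq_mul]
  ring

/-- The space `ℋ_M` of all `γ ∈ Ω^{1,1}_H` (real) with `ω ∧ γ = 0` and `d_H γ = 0`.  The four conditions are:
`i_v γ = 0`, so that `γ` is a section of `Λ²_H`; `γ` has type `(1,1)` on `H`; `ω ∧ γ = 0`;
the restriction `d_H γ` of `dγ` to `H` vanishes. -/
def HM : Submodule ℝ (FormM 2) where
  carrier := {γ | ∀ p ∈ tubeBdry,
    (∀ a ∈ tangentM p, γ.1 p ![reeb p, a] = 0) ∧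
    (∀ a ∈ contactPlane p, ∀ b ∈ contactPlane p, γ.1 p ![cplx a, cplx b] = γ.1 p ![a, b]) ∧
    (∀ v : Fin 4 → C3, (∀ i, v i ∈ tangentM p) → wedgeTwoTwo (omegaM.1 p) (γ.1 p) v = 0) ∧
    (∀ v : Fin 3 → C3, (∀ i, v i ∈ contactPlane p) → (dM 2 γ).1 p v = 0)}
  add_mem' := by
    intro σ τ hσ hτ p hp
    obtain ⟨h1, h2, h3, h4⟩ := hσ p hp
    obtain ⟨k1, k2, k3, k4⟩ := hτ p hp
    refine ⟨fun a ha => ?_, fun a ha b hb => ?_, fun v hv => ?_, fun v hv => ?_⟩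
    · simp [h1 a ha, k1 a ha]
    · simp [h2 a ha b hb, k2 a ha b hb]
    · simp [wedgeTwoTwo_add, h3 v hv, k3 v hv]
    · simp [h4 v hv, k4 v hv]
  zero_mem' := by
    intro p hp
    refine ⟨fun a ha => rfl, fun a ha b hb => rfl, fun v hv => by simp [wedgeTwoTwo], fun v hv => ?_⟩
    rw [map_zero]
    rfl
  smul_mem' := by
    intro c σ hσ p hp
    obtain ⟨h1, h2, h3, h4⟩ := hσ p hp
    refine ⟨fun a ha => ?_, fun a ha b hb => ?_, fun v hv => ?_, fun v hv => ?_⟩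
    · simp [h1 a ha]
    · simp [h2 a ha b hb]
    · simp [wedgeTwoTwo_smul, h3 v hv]
    · simp [h4 v hv]

theorem fderiv_retr_snd {p : C3} (hp : p ∈ cone) (w : C3) : (fderiv ℝ retr p w).2 = w.2 := by
  have h1 := (hasFDerivAt_retr hp).snd
  have h2 : HasFDerivAt (fun q : C3 => (retr q).2) (ContinuousLinearMap.snd ℝ V3 V3) p :=
    hasFDerivAt_snd
  exact DFunLike.congr_fun (h1.unique h2) w

theorem fderiv_retr_mem {p : C3} (hp : p ∈ cone) (w : C3) :
    fderiv ℝ retr p w ∈ tangentM (retr p) := by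
  have h1 := (hasFDerivAt_retr hp).fst
  have h2 := h1.norm_sq
  have h3 : (fun q : C3 => ‖(retr q).1‖ ^ 2) =ᶠ[nhds p] fun _ => (1 : ℝ) := by
    filter_upwards [isOpen_cone.mem_nhds hp] with q hq
    have : ‖(retr q).1‖ = 1 := by simpa using (retr_mem_tubeBdry hq).1
    rw [this]; norm_num
  have h4 := h2.unique (h3.hasFDerivAt_iff.2 (hasFDerivAt_const (1 : ℝ) p))
  have h5 := DFunLike.congr_fun h4 w
  simp only [tangentM, Submodule.mem_mk]
  simpa using h5

theorem fderiv_retr_tangent {p : C3} (hp : p ∈ tubeBdry) {w : C3} (hw : w ∈ tangentM p) :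
    fderiv ℝ retr p w = w := by
  have hpc := tubeBdry_subset_cone hp
  have hn : ‖p.1‖ = 1 := by simpa using hp.1
  have hw' : inner ℝ p.1 w.1 = 0 := hw
  have hf : HasFDerivAt (fun q : C3 => q.1) (ContinuousLinearMap.fst ℝ V3 V3) p := hasFDerivAt_fst
  have hd : DifferentiableAt ℝ (fun q : C3 => ‖q.1‖) p := hf.differentiableAt.norm ℝ hpc
  have hL : fderiv ℝ (fun q : C3 => ‖q.1‖) p w = 0 := by
    have h1 := hd.hasFDerivAt.pow 2
    have h2 := hf.norm_sq
    have h3 := DFunLike.congr_fun (h1.unique h2) w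
    simpa [hn, hw'] using h3
  have h5 := ((hasDerivAt_inv (norm_ne_zero_iff.2 hpc)).comp_hasFDerivAt p hd.hasFDerivAt).smul hf
  have h6 := DFunLike.congr_fun ((hasFDerivAt_retr hpc).fst.unique h5) w
  refine Prod.ext ?_ (fderiv_retr_snd hpc w)
  simpa [hn, hL] using h6

theorem restr_apply_bdry {k : ℕ} (ρ : FormZ k) {p : C3} (hp : p ∈ tubeBdry) {v : Fin k → C3}
    (hv : ∀ i, v i ∈ tangentM p) : (restr k ρ).1 p v = ρ.1 p v := by
  change cone.indicator (pull ρ.1) p v = _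
  rw [indicator_of_mem (tubeBdry_subset_cone hp), pull, retr_of_mem hp]
  simp only [ContinuousAlternatingMap.compContinuousLinearMap_apply]
  congr 1
  funext i
  exact fderiv_retr_tangent hp (hv i)

theorem FormM_apply {k : ℕ} (τ : FormM k) {p : C3} (hp : p ∈ cone) (v : Fin k → C3) :
    τ.1 p v = τ.1 (retr p) (fun i => fderiv ℝ retr p (v i)) := by
  conv_lhs => rw [← τ.2.2.2.1 p hp]
  rfl

theorem FormM_ext {k : ℕ} {σ τ : FormM k}
    (h : ∀ p ∈ tubeBdry, ∀ v : Fin k → C3, (∀ i, v i ∈ tangentM p) → σ.1 p v = τ.1 p v) :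
    σ = τ := by
  apply Subtype.ext
  funext p
  by_cases hp : p ∈ cone
  · ext v
    rw [FormM_apply σ hp, FormM_apply τ hp]
    exact h _ (retr_mem_tubeBdry hp) _ fun i => fderiv_retr_mem hp _
  · rw [σ.2.2.2.2 p hp, τ.2.2.2.2 p hp]

theorem restr_dZ {k : ℕ} (ρ : FormZ k) : restr (k + 1) (dZ k ρ) = dM k (restr k ρ) := by
  apply Subtype.ext
  funext p
  by_cases hp : p ∈ cone
  · change cone.indicator (pull (tube.indicator (extDerivWithin ρ.1 tube))) p =
      cone.indicator (extDeriv (cone.indicator (pull ρ.1))) p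
    have ht := tubeBdry_subset (retr_mem_tubeBdry hp)
    have hs : ∀ q ∈ cone, fderivWithin ℝ retr cone q = fderiv ℝ retr q := fun q hq =>
      fderivWithin_of_isOpen isOpen_cone hq
    rw [indicator_of_mem hp, indicator_of_mem hp, pull, indicator_of_mem ht]
    have h1 := extDerivWithin_pullback (r := ∞) (FormZ_diff ρ ht)
      (contDiffOn_retr p hp) (by simpa using two_le_inf) isOpen_cone.uniqueDiffOn
      (subset_closure (by rwa [isOpen_cone.interior_eq])) hp
      (fun q hq => tubeBdry_subset (retr_mem_tubeBdry hq))
    rw [hs p hp] at h1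
    rw [← h1]
    have h2 : extDerivWithin (fun x => (ρ.1 (retr x)).compContinuousLinearMap
        (fderivWithin ℝ retr cone x)) cone p = extDerivWithin (cone.indicator (pull ρ.1)) cone p := by
      apply extDerivWithin_congr' _ hp
      intro q hq
      rw [indicator_of_mem hq, pull, ← hs q hq]
    rw [h2]
    simp only [extDerivWithin, extDeriv, fderivWithin_of_isOpen isOpen_cone hp]
  · rw [(restr (k + 1) (dZ k ρ)).2.2.2.2 p hp, (dM k (restr k ρ)).2.2.2.2 p hp]

theorem contactZ_apply {p : C3} (hp : p ∈ tube) (w : C3) :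
    contactZ.1 p (fun _ => w) = inner ℝ p.1 w.2 := by
  change tube.indicator (fun p => ∑ i, p.1 i • dy i) p (fun _ => w) = _
  rw [indicator_of_mem hp]
  simp [dy, PiLp.inner_apply, mul_comm]

theorem contactM_apply {p : C3} (hp : p ∈ tubeBdry) (w : C3) :
    contactM.1 p (fun _ => w) = inner ℝ p.1 w.2 := by
  have hc := tubeBdry_subset_cone hp
  rw [FormM_apply contactM hc, retr_of_mem hp, contactM, restr_apply_bdry contactZ hp]
  · rw [contactZ_apply (tubeBdry_subset hp), fderiv_retr_snd hc]
  · intro i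
    have := fderiv_retr_mem hc w
    rwa [retr_of_mem hp] at this

theorem omegaM_apply {p : C3} (hp : p ∈ tubeBdry) {a b : C3} (ha : a ∈ tangentM p)
    (hb : b ∈ tangentM p) :
    omegaM.1 p ![a, b] = inner ℝ a.1 b.2 - inner ℝ b.1 a.2 := by
  have ht := tubeBdry_subset hp
  rw [omegaM, contactM, ← restr_dZ, restr_apply_bdry _ hp (by
    intro i; fin_cases i <;> assumption)]
  change tube.indicator (extDerivWithin contactZ.1 tube) p ![a, b] = _
  rw [indicator_of_mem ht, extDerivWithin_apply (FormZ_diff contactZ ht) (uniqueDiffOn_tube p ht),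
    Fin.sum_univ_two]
  have key : ∀ u w : C3, fderivWithin ℝ (fun q => contactZ.1 q (fun _ => w)) tube p u =
      inner ℝ u.1 w.2 := by
    intro u w
    have h1 : HasFDerivWithinAt (fun q : C3 => inner ℝ q.1 w.2)
        (((innerSL ℝ).flip w.2) ∘L ContinuousLinearMap.fst ℝ V3 V3) tube p := by
      exact (((innerSL ℝ).flip w.2) ∘L ContinuousLinearMap.fst ℝ V3 V3).hasFDerivWithinAt
    have h2 := h1.congr (fun q hq => contactZ_apply hq w) (contactZ_apply ht w)
    rw [h2.fderivWithin (uniqueDiffOn_tube p ht)]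
    rfl
  have e0 : (0 : Fin 2).removeNth ![a, b] = fun _ => b := by
    funext i; fin_cases i; rfl
  have e1 : (1 : Fin 2).removeNth ![a, b] = fun _ => a := by
    funext i; fin_cases i; rfl
  rw [e0, e1, key, key]
  simp
  ring

theorem norm_of_mem {p : C3} (hp : p ∈ tubeBdry) : ‖p.1‖ = 1 := by simpa using hp.1

theorem reeb_eq {p : C3} (hp : p ∈ tubeBdry) : reeb p = (0, p.1) := by
  rw [reeb, retr_of_mem hp]

theorem reeb_mem {p : C3} (hp : p ∈ tubeBdry) : reeb p ∈ tangentM p := by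
  rw [reeb_eq hp]
  simp [tangentM]

theorem contactM_reeb {p : C3} (hp : p ∈ tubeBdry) : contactM.1 p (fun _ => reeb p) = 1 := by
  rw [contactM_apply hp, reeb_eq hp, real_inner_self_eq_norm_sq, norm_of_mem hp]
  norm_num

theorem omegaM_reeb {p : C3} (hp : p ∈ tubeBdry) {b : C3} (hb : b ∈ tangentM p) :
    omegaM.1 p ![reeb p, b] = 0 := by
  rw [omegaM_apply hp (reeb_mem hp) hb, reeb_eq hp]
  have : inner ℝ p.1 b.1 = 0 := hb
  rw [real_inner_comm] at this
  simp [this]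

theorem mem_contactPlane {p : C3} (hp : p ∈ tubeBdry) {w : C3} :
    w ∈ contactPlane p ↔ inner ℝ p.1 w.1 = 0 ∧ inner ℝ p.1 w.2 = 0 := by
  change w ∈ tangentM p ∧ contactM.1 p (fun _ => w) = 0 ↔ _
  rw [contactM_apply hp]
  rfl

theorem cplx_mem_contactPlane {p : C3} (hp : p ∈ tubeBdry) {w : C3} (hw : w ∈ contactPlane p) :
    cplx w ∈ contactPlane p := by
  rw [mem_contactPlane hp] at *
  simp [cplx, hw.1, hw.2]

theorem sub_reeb_mem {p : C3} (hp : p ∈ tubeBdry) {w : C3} (hw : w ∈ tangentM p) :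
    w - contactM.1 p (fun _ => w) • reeb p ∈ contactPlane p := by
  rw [mem_contactPlane hp, contactM_apply hp, reeb_eq hp]
  have h : inner ℝ p.1 w.1 = 0 := hw
  simp [h, inner_sub_right, inner_smul_right, norm_of_mem hp]

theorem wedgeOne_two_apply (η : Alt 1) (σ : Alt 2) (v : Fin 3 → C3) :
    (η ⋏ σ) v = η (fun _ => v 0) * σ ![v 1, v 2] - η (fun _ => v 1) * σ ![v 0, v 2] +
      η (fun _ => v 2) * σ ![v 0, v 1] := by
  rw [wedgeOne_apply, Fin.sum_univ_three, (removeNth_three _).1, (removeNth_three _).2.1,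
    (removeNth_three _).2.2]
  simp
  ring

theorem extDeriv_wedge (η : FormM 1) (σ : FormM 2) {p : C3} (hp : p ∈ cone) (v : Fin 4 → C3) :
    (dM 3 (wedgeM η σ)).1 p v = wedgeTwoTwo ((dM 1 η).1 p) (σ.1 p) v -
      (η.1 p (fun _ => v 0) * (dM 2 σ).1 p ![v 1, v 2, v 3] -
        η.1 p (fun _ => v 1) * (dM 2 σ).1 p ![v 0, v 2, v 3] +
        η.1 p (fun _ => v 2) * (dM 2 σ).1 p ![v 0, v 1, v 3] -
        η.1 p (fun _ => v 3) * (dM 2 σ).1 p ![v 0, v 1, v 2]) := by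
  have d1 : ∀ {k : ℕ} (τ : FormM k), (dM k τ).1 p = extDeriv τ.1 p := fun τ =>
    indicator_of_mem hp _
  have hη := FormM_diff η hp
  have hσ := FormM_diff σ hp
  rw [d1, d1, d1, extDeriv_apply (FormM_diff (wedgeM η σ) hp)]
  have key : ∀ (u : C3) (w : Fin 3 → C3), fderiv ℝ (fun q => (wedgeM η σ).1 q w) p u =
      fderiv ℝ η.1 p u (fun _ => w 0) * σ.1 p ![w 1, w 2] +
        η.1 p (fun _ => w 0) * fderiv ℝ σ.1 p u ![w 1, w 2] -
      (fderiv ℝ η.1 p u (fun _ => w 1) * σ.1 p ![w 0, w 2] +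
        η.1 p (fun _ => w 1) * fderiv ℝ σ.1 p u ![w 0, w 2]) +
      (fderiv ℝ η.1 p u (fun _ => w 2) * σ.1 p ![w 0, w 1] +
        η.1 p (fun _ => w 2) * fderiv ℝ σ.1 p u ![w 0, w 1]) := by
    intro u w
    have e : ∀ {k : ℕ} (τ : FormM k) (x : Fin k → C3),
        HasFDerivAt (fun q => τ.1 q x)
          ((ContinuousAlternatingMap.apply ℝ C3 ℝ x) ∘L fderiv ℝ τ.1 p) p := fun τ x =>
      (ContinuousAlternatingMap.apply ℝ C3 ℝ x).hasFDerivAt.comp p (FormM_diff τ hp).hasFDerivAt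
    have h := ((((e η (fun _ => w 0)).mul (e σ ![w 1, w 2])).sub
      ((e η (fun _ => w 1)).mul (e σ ![w 0, w 2]))).add
      ((e η (fun _ => w 2)).mul (e σ ![w 0, w 1])))
    have h' : HasFDerivAt (fun q => (wedgeM η σ).1 q w) _ p :=
      h.congr_of_eventuallyEq (Filter.Eventually.of_forall fun q => by
        change (η.1 q ⋏ σ.1 q) w = _
        rw [wedgeOne_two_apply]
        rfl)
    rw [h'.fderiv]
    simp
    ring
  simp only [key]
  have dη : ∀ a b : C3, extDeriv η.1 p ![a, b] =
      fderiv ℝ η.1 p a (fun _ => b) - fderiv ℝ η.1 p b (fun _ => a) := by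
    intro a b
    have e0 : (0 : Fin 2).removeNth ![a, b] = fun _ => b := by
      funext i; fin_cases i; rfl
    have e1 : (1 : Fin 2).removeNth ![a, b] = fun _ => a := by
      funext i; fin_cases i; rfl
    rw [extDeriv, ContinuousAlternatingMap.alternatizeUncurryFin_apply, Fin.sum_univ_two, e0, e1]
    simp
    ring
  have dσ : ∀ a b c : C3, extDeriv σ.1 p ![a, b, c] =
      fderiv ℝ σ.1 p a ![b, c] - fderiv ℝ σ.1 p b ![a, c] + fderiv ℝ σ.1 p c ![a, b] := by
    intro a b c
    rw [extDeriv, ContinuousAlternatingMap.alternatizeUncurryFin_apply, Fin.sum_univ_three,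
      (removeNth_three _).1, (removeNth_three _).2.1, (removeNth_three _).2.2]
    simp
    ring
  simp only [wedgeTwoTwo, dη, dσ]
  rw [Fin.sum_univ_four, (removeNth_four _).1, (removeNth_four _).2.1, (removeNth_four _).2.2.1,
    (removeNth_four _).2.2.2]
  simp
  ring

theorem alt3_sub_smul (β : Alt 3) (a b c r : C3) (t : ℝ) :
    β ![a - t • r, b, c] = β ![a, b, c] - t * β ![r, b, c] := by
  have e : ∀ x : C3, β ![x, b, c] = β.curryLeft x ![b, c] := fun x => rfl
  rw [e, e, e, map_sub, map_smul]
  rfl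

theorem alt3_expand {β : Alt 3} {p : C3} (hp : p ∈ tubeBdry)
    (h0 : ∀ a ∈ contactPlane p, ∀ b ∈ contactPlane p, ∀ c ∈ contactPlane p, β ![a, b, c] = 0)
    {a b c : C3} (ha : a ∈ tangentM p) (hb : b ∈ tangentM p) (hc : c ∈ tangentM p) :
    β ![a, b, c] = contactM.1 p (fun _ => a) * β ![reeb p, b, c] -
      contactM.1 p (fun _ => b) * β ![reeb p, a, c] +
      contactM.1 p (fun _ => c) * β ![reeb p, a, b] := by
  have h := h0 _ (sub_reeb_mem hp ha) _ (sub_reeb_mem hp hb) _ (sub_reeb_mem hp hc)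
  generalize contactM.1 p (fun _ => a) = ta at *
  generalize contactM.1 p (fun _ => b) = tb at *
  generalize contactM.1 p (fun _ => c) = tc at *
  generalize reeb p = R at *
  have sub1 : ∀ a b c r : C3, ∀ t : ℝ, β ![a, b - t • r, c] = β ![a, b, c] - t * β ![a, r, c] :=
    fun a b c r t => by
      rw [alt3_swap01, alt3_sub_smul, alt3_swap01 β a b c, alt3_swap01 β a r c]; ring
  have sub2 : ∀ a b c r : C3, ∀ t : ℝ, β ![a, b, c - t • r] = β ![a, b, c] - t * β ![a, b, r] :=
    fun a b c r t => by
      rw [alt3_swap12, sub1, alt3_swap12 β a b c, alt3_swap12 β a b r]; ring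
  have z0 : ∀ c : C3, β ![R, R, c] = 0 := fun c => by
    have := alt3_swap01 β R R c
    linarith
  have z1 : ∀ b : C3, β ![R, b, R] = 0 := fun b => by rw [alt3_swap12, z0, neg_zero]
  have z2 : ∀ a : C3, β ![a, R, R] = 0 := fun a => by rw [alt3_swap01, z1, neg_zero]
  simp only [alt3_sub_smul, sub1, sub2, z0, z1, z2] at h
  rw [alt3_swap01 β a R c, alt3_swap12 β a b R, alt3_swap01 β a R b] at h
  linarith

theorem dM_wedge_eq_zero {γ : FormM 2} (hγ : γ ∈ HM) : dM 3 (wedgeM contactM γ) = 0 := by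
  refine FormM_ext fun p hp v hv => ?_
  obtain ⟨-, -, h3, h4⟩ := hγ p hp
  rw [extDeriv_wedge _ _ (tubeBdry_subset_cone hp)]
  change wedgeTwoTwo (omegaM.1 p) (γ.1 p) v - _ = (0 : ℝ)
  rw [h3 v hv]
  have hβ0 : ∀ a ∈ contactPlane p, ∀ b ∈ contactPlane p, ∀ c ∈ contactPlane p,
      (dM 2 γ).1 p ![a, b, c] = 0 := fun a ha b hb c hc => h4 _ (by
        intro i; fin_cases i <;> assumption)
  rw [alt3_expand hp hβ0 (hv 1) (hv 2) (hv 3), alt3_expand hp hβ0 (hv 0) (hv 2) (hv 3),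
    alt3_expand hp hβ0 (hv 0) (hv 1) (hv 3), alt3_expand hp hβ0 (hv 0) (hv 1) (hv 2)]
  ring

theorem contrReeb_apply {k : ℕ} (τ : FormM (k + 1)) {p : C3} (hp : p ∈ cone) (v : Fin k → C3) :
    (contrReeb k τ).1 p v = τ.1 p (Matrix.vecCons (reeb p) v) := by
  change cone.indicator (fun p => (τ.1 p).curryLeft (reeb p)) p v = _
  rw [indicator_of_mem hp]
  rfl

theorem wedge_contrReeb {τ : FormM 3} (h0 : ∀ p ∈ tubeBdry, ∀ a ∈ contactPlane p,
    ∀ b ∈ contactPlane p, ∀ c ∈ contactPlane p, τ.1 p ![a, b, c] = 0) :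
    wedgeM contactM (contrReeb 2 τ) = τ := by
  refine FormM_ext fun p hp v hv => ?_
  have hc := tubeBdry_subset_cone hp
  change (contactM.1 p ⋏ (contrReeb 2 τ).1 p) v = _
  rw [wedgeOne_two_apply, contrReeb_apply _ hc, contrReeb_apply _ hc, contrReeb_apply _ hc,
    vec3_eta v, alt3_expand hp (h0 p hp) (hv 0) (hv 1) (hv 2)]
  rfl

theorem alt2_sub_smul (β : Alt 2) (a b r : C3) (t : ℝ) :
    β ![a - t • r, b] = β ![a, b] - t * β ![r, b] := by
  have e : ∀ x : C3, β ![x, b] = β.curryLeft x ![b] := fun x => rfl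
  rw [e, e, e, map_sub, map_smul]
  rfl

theorem alt2_horizontal {β : Alt 2} {p : C3} (hp : p ∈ tubeBdry)
    (h : ∀ a ∈ tangentM p, β ![reeb p, a] = 0) {a b : C3} (ha : a ∈ tangentM p)
    (hb : b ∈ tangentM p) (s t : ℝ) :
    β ![a - s • reeb p, b - t • reeb p] = β ![a, b] := by
  have hb' : b - t • reeb p ∈ tangentM p :=
    sub_mem hb ((tangentM p).smul_mem t (reeb_mem hp))
  rw [alt2_sub_smul, h _ hb', alt2_swap, alt2_sub_smul, h _ ha, alt2_swap β a b]
  ring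

theorem contactPlane_le (p : C3) : contactPlane p ≤ tangentM p := fun _ h => h.1

theorem contrReeb_mem_HM {τ : FormM 3} (hd : dM 3 τ = 0)
    (h0 : ∀ p ∈ tubeBdry, ∀ a ∈ contactPlane p,
      ∀ b ∈ contactPlane p, ∀ c ∈ contactPlane p, τ.1 p ![a, b, c] = 0)
    (h1 : ∀ p ∈ tubeBdry, ∀ a ∈ contactPlane p, ∀ b ∈ contactPlane p,
      τ.1 p ![reeb p, cplx a, cplx b] = τ.1 p ![reeb p, a, b]) :
    contrReeb 2 τ ∈ HM := by
  intro p hp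
  have hc := tubeBdry_subset_cone hp
  have hL := fun v => extDeriv_wedge contactM (contrReeb 2 τ) hc v
  rw [wedge_contrReeb h0, hd] at hL
  have hz : ∀ v, (0 : FormM 4).1 p v = (0 : ℝ) := fun _ => rfl
  simp only [hz] at hL
  have hθ : ∀ w ∈ contactPlane p, contactM.1 p (fun _ => w) = 0 := fun w hw => hw.2
  have hor : ∀ a ∈ tangentM p, (contrReeb 2 τ).1 p ![reeb p, a] = 0 := by
    intro a _
    rw [contrReeb_apply _ hc]
    change τ.1 p ![reeb p, reeb p, a] = 0
    have := alt3_swap01 (τ.1 p) (reeb p) (reeb p) a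
    linarith
  have hω : ∀ v : Fin 4 → C3, (∀ i, v i ∈ tangentM p) →
      wedgeTwoTwo (omegaM.1 p) ((contrReeb 2 τ).1 p) v = 0 := by
    intro v hv
    have h := hL fun i => v i - contactM.1 p (fun _ => v i) • reeb p
    beta_reduce at h
    rw [hθ _ (sub_reeb_mem hp (hv 0)), hθ _ (sub_reeb_mem hp (hv 1)),
      hθ _ (sub_reeb_mem hp (hv 2)), hθ _ (sub_reeb_mem hp (hv 3))] at h
    simp only [zero_mul, sub_zero, add_zero] at h
    rw [h]
    change _ = wedgeTwoTwo (omegaM.1 p) ((contrReeb 2 τ).1 p) _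
    simp only [wedgeTwoTwo]
    simp only [alt2_horizontal hp (fun a ha => omegaM_reeb hp ha) (hv _) (hv _),
      alt2_horizontal hp hor (hv _) (hv _)]
  refine ⟨hor, fun a ha b hb => ?_, hω, fun v hv => ?_⟩
  · rw [contrReeb_apply _ hc, contrReeb_apply _ hc]
    exact h1 p hp a ha b hb
  · have h := hL ![reeb p, v 0, v 1, v 2]
    change 0 = wedgeTwoTwo (omegaM.1 p) ((contrReeb 2 τ).1 p) _ -
      (contactM.1 p (fun _ => reeb p) * (dM 2 (contrReeb 2 τ)).1 p ![v 0, v 1, v 2] -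
      contactM.1 p (fun _ => v 0) * _ + contactM.1 p (fun _ => v 1) * _ -
      contactM.1 p (fun _ => v 2) * _) at h
    rw [hθ _ (hv 0), hθ _ (hv 1), hθ _ (hv 2), contactM_reeb hp, hω _ ?_, ← vec3_eta v] at h
    · linarith
    · intro i
      fin_cases i
      · exact reeb_mem hp
      · exact (hv 0).1
      · exact (hv 1).1
      · exact (hv 2).1

/-- `{ρ ∈ Ω³(Z) : dρ = 0, dJρ = 0, ρ|_M = 0}`. -/
def KhatForms : Submodule ℝ (FormZ 3) :=
  LinearMap.ker (dZ 3) ⊓ LinearMap.ker (dZ 3 ∘ₗ JZ) ⊓ LinearMap.ker (restr 3)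

/-- `{dα : α ∈ Ω²(Z), α|_M = 0, dJdα = 0}`. -/
def KForms : Submodule ℝ (FormZ 3) :=
  (LinearMap.ker (restr 2)).map (dZ 2) ⊓ LinearMap.ker (dZ 3 ∘ₗ JZ)

/-- `{L_w Ψ : w|_M = 0}`. -/
def LieForms : Submodule ℝ (FormZ 3) := LinearMap.range (lieZ PsiZ)

/-- The space `𝒦 = {dα : α|_M = 0, dJdα = 0} / {L_w Ψ : w|_M = 0}` of infinitesimal deformations of `Ψ` in a
fixed enhanced boundary class. -/
abbrev DefK : Type := KForms ⧸ LieForms.submoduleOf KForms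
/-- The space `𝒦̂ = {ρ : dρ = 0, dJρ = 0, ρ|_M = 0} / {L_w Ψ : w|_M = 0}` of infinitesimal deformations
of `Ψ`, ignoring the enhancement. -/
abbrev DefKhat : Type := KhatForms ⧸ LieForms.submoduleOf KhatForms

/-- The closed `3`-forms on `Z` that vanish on `M`. -/
def H3RelForms : Submodule ℝ (FormZ 3) := LinearMap.ker (dZ 3) ⊓ LinearMap.ker (restr 3)

/-- `H³(Z, M)`: closed `3`-forms on `Z` vanishing on `M`, modulo `dα` with `α|_M = 0`. -/
abbrev H3Rel : Type :=
  H3RelForms ⧸ ((LinearMap.ker (restr 2)).map (dZ 2)).submoduleOf H3RelForms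

/-- The de Rham cohomology `H³(M)`. -/
abbrev H3M : Type :=
  LinearMap.ker (dM 3) ⧸ (LinearMap.range (dM 2)).submoduleOf (LinearMap.ker (dM 3))

/-- `Π_M : ℋ_M → H³(M)`, `γ ↦ [θ ∧ γ]`. -/
def PiM : HM →ₗ[ℝ] H3M :=
  Submodule.mkQ _ ∘ₗ
    LinearMap.codRestrict (LinearMap.ker (dM 3)) (wedgeM contactM ∘ₗ HM.subtype)
      (fun γ => dM_wedge_eq_zero γ.2)

theorem dZ_constZ {k : ℕ} (a : Alt k) : dZ k (constZ a) = 0 := by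
  apply Subtype.ext
  funext p
  by_cases hp : p ∈ tube
  · change tube.indicator (extDerivWithin (tube.indicator fun _ => a) tube) p = 0
    have : extDerivWithin (tube.indicator fun _ => a) tube p =
        extDerivWithin (fun _ => a) tube p :=
      extDerivWithin_congr' (fun q hq => indicator_of_mem hq _) hp
    rw [indicator_of_mem hp, this]
    simp only [extDerivWithin, fderivWithin_fun_const]
    ext v
    simp [ContinuousAlternatingMap.alternatizeUncurryFin_apply]
  · exact (dZ k (constZ a)).2.2.2 p hp

theorem lieZ_psi (w : VField) : lieZ PsiZ w = dZ 2 (interiorProd PsiZ w) := by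
  have h : dZ 3 PsiZ = 0 := dZ_constZ _
  rw [lieZ, h]
  apply Subtype.ext
  funext p
  simp [interiorProd]

theorem restr_interior {k : ℕ} (ρ : FormZ (k + 1)) (w : VField) : restr k (interiorProd ρ w) = 0 := by
  refine FormM_ext fun p hp v hv => ?_
  rw [restr_apply_bdry _ hp hv]
  change (ρ.1 p).curryLeft (w.1 p) v = 0
  rw [w.2.2.2.2 p hp]
  simp

theorem LieForms_le : LieForms ≤ (LinearMap.ker (restr 2)).map (dZ 2) := by
  rintro _ ⟨w, rfl⟩
  exact ⟨interiorProd PsiZ w, restr_interior _ _, (lieZ_psi w).symm⟩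

theorem KhatForms_le : KhatForms ≤ H3RelForms := fun _ h => ⟨h.1.1, h.2⟩

/-- `𝒦̂ → H³(Z, M)`, `[ρ] ↦ [ρ]`. -/
def PiZhat : DefKhat →ₗ[ℝ] H3Rel :=
  Submodule.mapQ _ _ (Submodule.inclusion KhatForms_le) fun _ h => LieForms_le h

theorem Theta_cplx (a b c : C3) :
    Theta ![cplx a, b, c] = Complex.I * Theta ![a, b, c] := by
  have e : ∀ (i : Fin 3) (w : C3), dz i (fun _ => cplx w) = Complex.I * dz i (fun _ => w) := by
    intro i w
    apply Complex.ext <;> simp [dz, dx, dy, cplx]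
  have e2 : ∀ (i j : Fin 3) (a b : C3), (dz i ⋏ dz j) ![a, b] =
      dz i (fun _ => a) * dz j (fun _ => b) - dz i (fun _ => b) * dz j (fun _ => a) := by
    intro i j a b
    have e0 : (0 : Fin 2).removeNth ![a, b] = fun _ => b := by
      funext i; fin_cases i; rfl
    have e1 : (1 : Fin 2).removeNth ![a, b] = fun _ => a := by
      funext i; fin_cases i; rfl
    rw [wedgeOne_apply, Fin.sum_univ_two, e0, e1]
    simp
    ring
  have e3 : ∀ a b c : C3, Theta ![a, b, c] = Complex.I * (
      dz 0 (fun _ => a) * (dz 1 ⋏ dz 2) ![b, c] - dz 0 (fun _ => b) * (dz 1 ⋏ dz 2) ![a, c] +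
      dz 0 (fun _ => c) * (dz 1 ⋏ dz 2) ![a, b]) := by
    intro a b c
    rw [Theta, ContinuousAlternatingMap.smul_apply, wedgeOne_apply, Fin.sum_univ_three,
      (removeNth_three _).1, (removeNth_three _).2.1, (removeNth_three _).2.2]
    simp
    ring
  rw [e3, e3, e2, e2, e2, e2, e2, e, e, e]
  ring

theorem cplx_cplx (a : C3) : cplx (cplx a) = -a := by
  exact Prod.ext (by simp [cplx]) (by simp [cplx])

theorem alt3_neg (β : Alt 3) (a b c : C3) :
    β ![-a, b, c] = -β ![a, b, c] ∧ β ![a, -b, c] = -β ![a, b, c] ∧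
      β ![a, b, -c] = -β ![a, b, c] := by
  have h0 : ∀ a b c : C3, β ![-a, b, c] = -β ![a, b, c] := fun a b c => by
    have e : ∀ x : C3, β ![x, b, c] = β.curryLeft x ![b, c] := fun x => rfl
    rw [e, e, map_neg]
    rfl
  have h1 : ∀ a b c : C3, β ![a, -b, c] = -β ![a, b, c] := fun a b c => by
    rw [alt3_swap01, h0, alt3_swap01 β a b c]
  exact ⟨h0 a b c, h1 a b c, by rw [alt3_swap12, h1, alt3_swap12 β a b c]⟩

theorem apply_of_restr_eq_zero {ρ : FormZ 3} (h : restr 3 ρ = 0) {p : C3} (hp : p ∈ tubeBdry)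
    {a b c : C3} (ha : a ∈ tangentM p) (hb : b ∈ tangentM p) (hc : c ∈ tangentM p) :
    ρ.1 p ![a, b, c] = 0 := by
  rw [← restr_apply_bdry ρ hp (by intro i; fin_cases i <;> assumption), h]
  rfl

theorem restr_JZ_apply (ρ : FormZ 3) {p : C3} (hp : p ∈ tubeBdry)
    {a b c : C3} (ha : a ∈ tangentM p) (hb : b ∈ tangentM p) (hc : c ∈ tangentM p) :
    (restr 3 (JZ ρ)).1 p ![a, b, c] = -(1 / 2) * (ρ.1 p ![cplx a, b, c] + ρ.1 p ![a, cplx b, c] +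
      ρ.1 p ![a, b, cplx c] + ρ.1 p ![cplx a, cplx b, cplx c]) := by
  rw [restr_apply_bdry _ hp (by intro i; fin_cases i <;> assumption)]
  exact opJ_apply _ _ _ _

theorem restr_JZ_contactPlane {ρ : FormZ 3} (h : restr 3 ρ = 0) : ∀ p ∈ tubeBdry,
    ∀ a ∈ contactPlane p, ∀ b ∈ contactPlane p, ∀ c ∈ contactPlane p,
      (restr 3 (JZ ρ)).1 p ![a, b, c] = 0 := by
  intro p hp a ha b hb c hc
  have hI := fun {w} (hw : w ∈ contactPlane p) => (cplx_mem_contactPlane hp hw).1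
  rw [restr_JZ_apply ρ hp ha.1 hb.1 hc.1, apply_of_restr_eq_zero h hp (hI ha) hb.1 hc.1,
    apply_of_restr_eq_zero h hp ha.1 (hI hb) hc.1, apply_of_restr_eq_zero h hp ha.1 hb.1 (hI hc),
    apply_of_restr_eq_zero h hp (hI ha) (hI hb) (hI hc)]
  norm_num

theorem contrReeb_restr_JZ_mem {ρ : FormZ 3} (hρ : ρ ∈ KhatForms) :
    contrReeb 2 (restr 3 (JZ ρ)) ∈ HM := by
  obtain ⟨⟨-, h2⟩, h3⟩ := hρ
  have h2' : dZ 3 (JZ ρ) = 0 := h2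
  refine contrReeb_mem_HM (by rw [← restr_dZ, h2', map_zero]) (restr_JZ_contactPlane h3) ?_
  intro p hp a ha b hb
  have hR := reeb_mem hp
  have hIa := cplx_mem_contactPlane hp ha
  have hIb := cplx_mem_contactPlane hp hb
  rw [restr_JZ_apply ρ hp hR hIa.1 hIb.1, restr_JZ_apply ρ hp hR ha.1 hb.1, cplx_cplx, cplx_cplx,
    (alt3_neg _ _ _ _).2.1, (alt3_neg _ _ _ _).2.2, (alt3_neg _ _ _ _).2.1, (alt3_neg _ _ _ _).2.2,
    apply_of_restr_eq_zero h3 hp hR ha.1 hIb.1, apply_of_restr_eq_zero h3 hp hR hIa.1 hb.1]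
  ring

theorem fderivWithin_vfield (w : VField) {p : C3} (hp : p ∈ tubeBdry) {a : C3}
    (ha : a ∈ tangentM p) : fderivWithin ℝ w.1 tube p a = 0 := by
  have hc := tubeBdry_subset_cone hp
  have hw : HasFDerivWithinAt w.1 (fderivWithin ℝ w.1 tube p) tube (retr p) := by
    rw [retr_of_mem hp]
    exact ((w.2.1.differentiableOn (by simp)) p (tubeBdry_subset hp)).hasFDerivWithinAt
  have h1 := hw.comp p (hasFDerivAt_retr hc).hasFDerivWithinAt
    (fun q (hq : q ∈ cone) => tubeBdry_subset (retr_mem_tubeBdry hq))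
  have h2 := h1.hasFDerivAt (isOpen_cone.mem_nhds hc)
  have h3 : (w.1 ∘ retr) =ᶠ[nhds p] fun _ => (0 : C3) := by
    filter_upwards [isOpen_cone.mem_nhds hc] with q hq using w.2.2.2.2 _ (retr_mem_tubeBdry hq)
  have h4 := DFunLike.congr_fun (h2.unique (h3.hasFDerivAt_iff.2 (hasFDerivAt_const (0 : C3) p))) a
  simpa [fderiv_retr_tangent hp ha] using h4

theorem lieZ_psi_apply (w : VField) {p : C3} (hp : p ∈ tube) (a b c : C3) :
    (lieZ PsiZ w).1 p ![a, b, c] =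
      PsiZ.1 p ![fderivWithin ℝ w.1 tube p a, b, c] +
      PsiZ.1 p ![a, fderivWithin ℝ w.1 tube p b, c] +
      PsiZ.1 p ![a, b, fderivWithin ℝ w.1 tube p c] := by
  rw [lieZ_psi]
  change tube.indicator (extDerivWithin (interiorProd PsiZ w).1 tube) p ![a, b, c] = _
  have hw := ((w.2.1.differentiableOn (by simp)) p hp).hasFDerivWithinAt
  have h1 : HasFDerivWithinAt (interiorProd PsiZ w).1
      ((PsiZ.1 p).curryLeft ∘L fderivWithin ℝ w.1 tube p) tube p := by
    have h2 : HasFDerivWithinAt (fun q => (PsiZ.1 p).curryLeft (w.1 q))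
      ((PsiZ.1 p).curryLeft ∘L fderivWithin ℝ w.1 tube p) tube p :=
      (PsiZ.1 p).curryLeft.hasFDerivAt.comp_hasFDerivWithinAt p hw
    have e : ∀ q ∈ tube, PsiZ.1 q = PsiZ.1 p := fun q hq => by
      rw [PsiZ, constZ]
      dsimp only
      rw [indicator_of_mem hq, indicator_of_mem hp]
    refine h2.congr (fun q hq => ?_) rfl
    change (PsiZ.1 q).curryLeft (w.1 q) = _
    rw [e q hq]
  rw [indicator_of_mem hp, extDerivWithin, h1.fderivWithin (uniqueDiffOn_tube p hp),
    deriv_action_apply]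

theorem psi_cplx {p : C3} (hp : p ∈ tube) (a b c : C3) :
    PsiZ.1 p ![cplx a, cplx b, c] = -PsiZ.1 p ![a, b, c] := by
  have e : ∀ v, PsiZ.1 p v = (Theta v).re := fun v => by
    rw [PsiZ, constZ]
    dsimp only
    rw [indicator_of_mem hp]
    rfl
  have sw : ∀ a b c, Theta ![a, b, c] = -Theta ![b, a, c] := by
    intro a b c
    rw [show -Theta ![b, a, c] = Theta (![b, a, c] ∘ Equiv.swap (0 : Fin 3) 1) from
      (Theta.toAlternatingMap.map_swap ![b, a, c] (i := 0) (j := 1) (by decide)).symm]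
    congr 1; funext i; fin_cases i <;> rfl
  rw [e, e, Theta_cplx, sw, Theta_cplx, sw b a c]
  simp

theorem restr_JZ_lieZ (w : VField) : restr 3 (JZ (lieZ PsiZ w)) = 0 := by
  refine FormM_ext fun p hp v hv => ?_
  rw [vec3_eta v, restr_JZ_apply _ hp (hv 0) (hv 1) (hv 2)]
  have ht := tubeBdry_subset hp
  have p01 := psi_cplx ht
  have p02 : ∀ a b c, PsiZ.1 p ![cplx a, b, cplx c] = -PsiZ.1 p ![a, b, c] := fun a b c => by
    rw [alt3_swap12, p01, alt3_swap12 (PsiZ.1 p) a b c]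
  have p12 : ∀ a b c, PsiZ.1 p ![a, cplx b, cplx c] = -PsiZ.1 p ![a, b, c] := fun a b c => by
    rw [alt3_swap01, p02, alt3_swap01 (PsiZ.1 p) a b c]
  have z0 : ∀ b c, PsiZ.1 p ![0, b, c] = 0 := fun b c =>
    (PsiZ.1 p).map_coord_zero (0 : Fin 3) rfl
  have z1 : ∀ a c, PsiZ.1 p ![a, 0, c] = 0 := fun b c =>
    (PsiZ.1 p).map_coord_zero (1 : Fin 3) rfl
  have z2 : ∀ a b, PsiZ.1 p ![a, b, 0] = 0 := fun b c =>
    (PsiZ.1 p).map_coord_zero (2 : Fin 3) rfl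
  simp only [lieZ_psi_apply w ht, fderivWithin_vfield w hp (hv _), z0, z1, z2, p01, p02, p12]
  change _ = (0 : ℝ)
  ring

/-- For `ρ` with `dρ = dJρ = 0` and `ρ|_M = 0`, the element `γ` of `ℋ_M` with `(Jρ)|_M = γ ∧ θ` (see
`wedge_bForms`), namely `γ = i_v ((Jρ)|_M)`. -/
def bForms : KhatForms →ₗ[ℝ] HM :=
  LinearMap.codRestrict HM (contrReeb 2 ∘ₗ restr 3 ∘ₗ JZ ∘ₗ KhatForms.subtype)
    fun ρ => contrReeb_restr_JZ_mem ρ.2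

/-- The defining property of `bForms`: `θ ∧ γ = (Jρ)|_M`. -/
theorem wedge_bForms (ρ : KhatForms) :
    wedgeM contactM (bForms ρ).1 = restr 3 (JZ ρ.1) :=
  wedge_contrReeb (restr_JZ_contactPlane ρ.2.2)

/-- The map `b : 𝒦̂ → ℋ_M`, where `b [ρ] = γ` if `(Jρ)|_M = γ ∧ θ`. -/
def bMap : DefKhat →ₗ[ℝ] HM :=
  Submodule.liftQ _ bForms <| by
    rintro ρ ⟨w, hw⟩
    apply Subtype.ext
    change contrReeb 2 (restr 3 (JZ ρ.1)) = 0
    have hw' : lieZ PsiZ w = ρ.1 := hw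
    rw [← hw', restr_JZ_lieZ, map_zero]

/-- `Π_Z : ℋ_M → H³(Z, M)`, obtained from `𝒦̂ → H³(Z, M)` through the isomorphism `b : 𝒦̂ ≅ ℋ_M`. -/
def PiZ (hb : Function.Bijective bMap) : HM →ₗ[ℝ] H3Rel :=
  PiZhat ∘ₗ (LinearEquiv.ofBijective bMap hb).symm.toLinearMap

/-- The function `|x|² - 1`, which defines the boundary of `Z`. -/
def bdryFn (p : C3) : ℝ := ‖p.1‖ ^ 2 - 1

/-- The Levi form (up to a positive factor) of the boundary of `Z`: the Hermitian part
`Hess(u,u) + Hess(Iu,Iu)` of the Hessian of the defining function. -/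
def leviForm (p u : C3) : ℝ :=
  fderiv ℝ (fderiv ℝ bdryFn) p u u + fderiv ℝ (fderiv ℝ bdryFn) p (cplx u) (cplx u)

/-- `Z` has strongly pseudoconvex boundary: the Levi form is positive definite on `TM ∩ I TM`. -/
def StronglyPseudoconvexBdry : Prop :=
  ∀ p ∈ tubeBdry, ∀ u : C3, u ∈ tangentM p → cplx u ∈ tangentM p → u ≠ 0 → 0 < leviForm p u

/-- `Ψ + iΨ̂` is a Calabi-Yau structure on `Z`: it is closed, nowhere zero and of type `(3,0)`. -/
def IsCalabiYau : Prop :=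
  dZ 3 PsiZ = 0 ∧ dZ 3 PsiHatZ = 0 ∧ ∀ p ∈ tube,
    (∃ v, (PsiZ.1 p v : ℂ) + Complex.I * PsiHatZ.1 p v ≠ 0) ∧
    ∀ a b c : C3, (PsiZ.1 p ![cplx a, b, c] : ℂ) + Complex.I * PsiHatZ.1 p ![cplx a, b, c] =
      Complex.I * ((PsiZ.1 p ![a, b, c] : ℂ) + Complex.I * PsiHatZ.1 p ![a, b, c])

/-- `Ψ` is rigid: `𝒦 = 0`. -/
def Rigid : Prop := Subsingleton DefK

/-- The coordinate vector `∂/∂xᵢ`. -/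
def ex (i : Fin 3) : C3 := (EuclideanSpace.single i 1, 0)

/-- The coordinate vector `∂/∂yᵢ`. -/
def ey (i : Fin 3) : C3 := (0, EuclideanSpace.single i 1)

/-- The integral of a `3`-form on `M = S² × T³` over `{x} × T³`. -/
def torusPeriod (x : V3) (τ : FormM 3) : ℝ :=
  ∫ y in {y : V3 | ∀ i, y i ∈ Ico (0 : ℝ) 1}, τ.1 (x, y) ![ey 0, ey 1, ey 2]

/-- The integral of a `3`-form on `Z = B³ × T³` over `B³ × {y}`. -/
def ballPeriod (y : V3) (ρ : FormZ 3) : ℝ :=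
  ∫ x in Metric.closedBall (0 : V3) 1, ρ.1 (x, y) ![ex 0, ex 1, ex 2]

end

end CYTube

open CYTube

/-! The proposition rests on three facts.

(a) A closed `ρ` with `dJρ = 0`, `ρ|_M = 0` and `(Jρ)|_M = 0` is some `L_w Ψ` with `w|_M = 0`
(`mem_LieForms`). The form `ρ + iJρ` is closed and has types (3,0) and (2,1). For each `j` its
(2,1)-coefficients `sigma21 ρ j k` form a ∂̄-closed (0,1)-form in `k`, and the boundary conditions
kill its tangential part. On `B³ × T³` such a form is `∂̄u_j` with `u_j = 0` on the boundary
(`exists_dbar_eq`). The `u_j` are the components of `w`. Then `ρ - L_w Ψ` is the real part of a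
holomorphic (3,0)-form whose coefficient vanishes on the boundary, so it is zero. The ∂̄-equation is
solved in each Fourier mode in `y`: the weight `e^{-2πn·x}` turns it into the Poincaré lemma on the
ball. Starting the integration at the boundary point where `n·x` is largest makes the estimate
uniform in `n` (`exists_mode`), so the Fourier series converges with all its derivatives.

(b) `ℋ_M` is the line spanned by `gammaM` (`HM_eq_smul`), and `gammaM` is the image of `2 dx₁dx₂dx₃`
under `b` (`bMap_two_chiZ`). Let `s` be the component of `θ ∧ γ` along the torus, extended to the
cone, constant along the rays. The algebraic conditions on `γ` and the closedness of `θ ∧ γ` give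
`|x|⁴ Δₓ s + ∑ (x × ∂_y)ᵢ² s = 0`. Multiplication by `s` and integration by parts show that `s` is
constant (`energy`, `exists_compS_eq`). If `s = 0`, the mixed components are tangent harmonic fields
on the spheres, hence zero, and so `γ = 0` (`HM_eq_zero`).

(c) Integration over `{x} × T³` kills exact forms on `M` but not `θ ∧ gammaM`; integration over `B³
× {y}` kills `dα` with `α|_M = 0` but not `2 dx₁dx₂dx₃` (`torusPeriod_dM`, `ballPeriod_dZ`).

By (a) `b` is injective, by (b) it is surjective. By (b) and (c) `Π_M` is injective. By (a) and (b)
every `ρ` in `KhatForms` is a Lie derivative plus a multiple of `2 dx₁dx₂dx₃`; if `ρ` is relatively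
exact, the ball period shows that the multiple is zero. This gives both the injectivity of `Π_Z` and
rigidity (`mem_LieForms_of_exact`). -/

namespace CYTube

open Set
open scoped ContDiff Pointwise

/-! ### Periodic functions on `ℝ³`: integrals over a period and Fourier inversion. -/

noncomputable section

section

open MeasureTheory

/-- The fundamental domain `[0,1)³` of `ℝ³ / ℤ³`. -/
def box : Set V3 := {y | ∀ i, y i ∈ Ico (0 : ℝ) 1}

/-- The lattice vector of `ℝ³` with integral coordinates `n`. -/
def lattV (n : Fin 3 → ℤ) : V3 := WithLp.toLp 2 fun i => (n i : ℝ)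

theorem box_subset_closedBall : box ⊆ Metric.closedBall 0 2 := by
  intro y hy
  rw [mem_closedBall_zero_iff, EuclideanSpace.norm_eq, Real.sqrt_le_left (by norm_num),
    Fin.sum_univ_three]
  have h : ∀ i, ‖y i‖ ^ 2 ≤ 1 := fun i => by
    rw [Real.norm_eq_abs, sq_abs]
    nlinarith [(hy i).1, (hy i).2]
  linarith [h 0, h 1, h 2]

theorem box_eq_preimage : (WithLp.toLp 2 : (Fin 3 → ℝ) → V3) ⁻¹' box = pi univ fun _ => Ico 0 1 := by
  ext t
  simp [box]

theorem measurableSet_box : MeasurableSet box := by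
  have : box = (WithLp.ofLp : V3 → (Fin 3 → ℝ)) ⁻¹' (pi univ fun _ => Ico 0 1) := by
    ext t
    simp [box]
  rw [this]
  exact (PiLp.volume_preserving_ofLp (Fin 3)).measurable
    (MeasurableSet.univ_pi fun _ => measurableSet_Ico)

theorem volume_box : volume box = 1 := by
  rw [← (PiLp.volume_preserving_toLp (Fin 3)).measure_preimage measurableSet_box.nullMeasurableSet,
    box_eq_preimage, Real.volume_pi_Ico]
  simp

/-- Moves integrals to the closed cube of `Fin 3 → ℝ`, on which the divergence theorem and the torus
Fourier coefficients are evaluated. The half-open and the closed cube differ by a null set. -/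
theorem setIntegral_box {E : Type*} [NormedAddCommGroup E] [NormedSpace ℝ E] (h : V3 → E) :
    ∫ y in box, h y = ∫ t in Icc (0 : Fin 3 → ℝ) 1, h (WithLp.toLp 2 t) := by
  rw [← (PiLp.volume_preserving_toLp (Fin 3)).setIntegral_preimage_emb
    (MeasurableEquiv.toLp 2 (Fin 3 → ℝ)).measurableEmbedding h box, box_eq_preimage]
  exact setIntegral_congr_set Measure.univ_pi_Ico_ae_eq_Icc

/-- Opposite faces of the cube differ by a period; this is why the boundary terms of the divergence
theorem cancel for periodic functions. -/
theorem toLp_insertNth (j : Fin 3) (t : Fin 2 → ℝ) :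
    (WithLp.toLp 2 (j.insertNth 1 t : Fin 3 → ℝ) : V3) =
      WithLp.toLp 2 (j.insertNth 0 t : Fin 3 → ℝ) + lattV (Pi.single j 1) := by
  ext i
  simp only [lattV, PiLp.add_apply]
  refine Fin.succAboveCases j ?_ (fun k => ?_) i
  · simp
  · simp [Fin.succAbove_ne]

/-- The integral over a period of a partial derivative of a periodic function vanishes. -/
theorem setIntegral_box_fderiv {E : Type*} [NormedAddCommGroup E] [NormedSpace ℝ E] {h : V3 → E}
    {h' : V3 → V3 →L[ℝ] E} (j : Fin 3) (hd : ∀ y, HasFDerivAt h (h' y) y)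
    (hc : Continuous fun y => h' y (EuclideanSpace.single j 1))
    (hp : ∀ y n, h (y + lattV n) = h y) :
    ∫ y in box, h' y (EuclideanSpace.single j 1) = 0 := by
  rw [setIntegral_box]
  have hcomp : ∀ t : Fin 3 → ℝ, HasFDerivAt (fun t : Fin 3 → ℝ => h (WithLp.toLp 2 t))
      (h' (WithLp.toLp 2 t) ∘L (PiLp.continuousLinearEquiv 2 ℝ fun _ : Fin 3 => ℝ).symm.toContinuousLinearMap) t :=
    fun t => (hd _).comp t (PiLp.continuousLinearEquiv 2 ℝ fun _ : Fin 3 => ℝ).symm.hasFDerivAt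
  -- The divergence theorem for the vector field whose only component is `h` in direction `j`; its
  -- divergence is the partial derivative in question.
  have key := integral_divergence_of_hasFDerivAt_off_countable' (E := E) (n := 2)
    (a := (0 : Fin 3 → ℝ)) (b := 1) zero_le_one
    (fun i t => if i = j then h (WithLp.toLp 2 t) else 0)
    (fun i t => if i = j then h' (WithLp.toLp 2 t) ∘L
      (PiLp.continuousLinearEquiv 2 ℝ fun _ : Fin 3 => ℝ).symm.toContinuousLinearMap else 0) ∅ countable_empty
    (fun i => by
      split_ifs
      · exact fun t _ => (hcomp t).continuousAt.continuousWithinAt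
      · exact continuousOn_const)
    (fun t _ i => by
      beta_reduce
      split_ifs
      · exact hcomp t
      · exact hasFDerivAt_const _ _)
  have e : ∀ t : Fin 3 → ℝ, (∑ i, (if i = j then h' (WithLp.toLp 2 t) ∘L
      (PiLp.continuousLinearEquiv 2 ℝ fun _ : Fin 3 => ℝ).symm.toContinuousLinearMap else 0)
        (Pi.single i 1)) = h' (WithLp.toLp 2 t) (EuclideanSpace.single j 1) := fun t => by
    rw [Finset.sum_eq_single j (fun i _ hi => by simp [hi]) (by simp), if_pos rfl]
    rfl
  simp only [e] at key
  rw [key]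
  · rw [Finset.sum_eq_single j (fun i _ hi => by simp [hi]) (by simp)]
    simp only [if_true, Pi.one_apply, Pi.zero_apply, toLp_insertNth, hp, sub_self]
  · refine ContinuousOn.integrableOn_compact isCompact_Icc (Continuous.continuousOn ?_)
    exact hc.comp (PiLp.continuousLinearEquiv 2 ℝ fun _ : Fin 3 => ℝ).symm.continuous

/-- The character `y ↦ e^{2πi n·y}` of `ℝ³ / ℤ³`. -/
def char (n : Fin 3 → ℤ) (y : V3) : ℂ :=
  Complex.exp (2 * Real.pi * Complex.I * ∑ k, (n k : ℂ) * (y k : ℂ))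

theorem norm_char (n : Fin 3 → ℤ) (y : V3) : ‖char n y‖ = 1 := by
  have : (2 * Real.pi * Complex.I * ∑ k, (n k : ℂ) * (y k : ℂ)) =
      ((2 * Real.pi * ∑ k, (n k : ℝ) * y k : ℝ) : ℂ) * Complex.I := by
    push_cast; ring
  rw [char, this, Complex.norm_exp_ofReal_mul_I]

theorem char_add_lattV (n m : Fin 3 → ℤ) (y : V3) : char n (y + lattV m) = char n y := by
  have : (2 * Real.pi * Complex.I * ∑ k, (n k : ℂ) * ((y + lattV m) k : ℂ)) =
      2 * Real.pi * Complex.I * ∑ k, (n k : ℂ) * (y k : ℂ) +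
        (∑ k, n k * m k : ℤ) * (2 * Real.pi * Complex.I) := by
    simp only [lattV, PiLp.add_apply, Fin.sum_univ_three]
    push_cast; ring
  rw [char, this, Complex.exp_add, Complex.exp_int_mul_two_pi_mul_I, mul_one, char]

theorem hasFDerivAt_char (n : Fin 3 → ℤ) (y : V3) :
    HasFDerivAt (char n) (∑ k, (2 * Real.pi * Complex.I * n k * char n y) •
      (Complex.ofRealCLM ∘L (EuclideanSpace.proj k : V3 →L[ℝ] ℝ))) y := by
  have h1 : HasFDerivAt (fun y : V3 => 2 * Real.pi * Complex.I * ∑ k, (n k : ℂ) * (y k : ℂ))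
      ((2 * Real.pi * Complex.I) • ∑ k, (n k : ℂ) •
        (Complex.ofRealCLM ∘L (EuclideanSpace.proj k : V3 →L[ℝ] ℝ))) y := by
    have h2 := (∑ k, (n k : ℂ) • (Complex.ofRealCLM ∘L
      (EuclideanSpace.proj k : V3 →L[ℝ] ℝ))).hasFDerivAt (x := y)
    have h3 := h2.const_mul (2 * Real.pi * Complex.I)
    refine h3.congr_of_eventuallyEq (Filter.Eventually.of_forall fun z => ?_)
    simp
  have h4 := h1.cexp
  convert! h4 using 1
  ext v
  simp only [char, smul_apply, Fin.sum_univ_three, smul_eq_mul, add_apply]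
  ring

theorem contDiff_char (n : Fin 3 → ℤ) : ContDiff ℝ ∞ (char n) := by
  unfold char
  refine Complex.contDiff_exp.comp (contDiff_const.mul (ContDiff.sum fun k _ => contDiff_const.mul ?_))
  exact Complex.ofRealCLM.contDiff.comp (EuclideanSpace.proj (𝕜 := ℝ) k).contDiff

/-- The Fourier coefficients of a periodic function on `ℝ³`. -/
def fcoef (F : V3 → ℂ) (n : Fin 3 → ℤ) : ℂ := ∫ y in box, char (-n) y * F y

theorem char_eq_mFourier (n : Fin 3 → ℤ) (t : Fin 3 → ℝ) :
    char n (WithLp.toLp 2 t) = UnitAddTorus.mFourier n (fun i => (t i : UnitAddCircle)) := by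
  simp only [char, UnitAddTorus.mFourier, ContinuousMap.coe_mk, fourier_coe_apply,
    ← Complex.exp_sum]
  congr 1
  rw [Finset.mul_sum]
  refine Finset.sum_congr rfl fun k _ => ?_
  push_cast; ring

/-- Fourier inversion for periodic functions on `ℝ³`. -/
theorem hasSum_fcoef {F : V3 → ℂ} (hF : Continuous F) (hp : ∀ y n, F (y + lattV n) = F y)
    (hs : Summable (fcoef F)) (y : V3) : HasSum (fun n => fcoef F n * char n y) (F y) := by
  -- A periodic continuous function descends to a continuous function `G` on the torus, because `ℝ³
  -- → (ℝ/ℤ)³` is a quotient map.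
  have hπ' : IsOpenQuotientMap fun (t : Fin 3 → ℝ) (i : Fin 3) => (t i : UnitAddCircle) :=
    IsOpenQuotientMap.piMap (fun _ : Fin 3 => QuotientAddGroup.isOpenQuotientMap_mk)
  let π : C(Fin 3 → ℝ, UnitAddTorus (Fin 3)) := ⟨_, hπ'.continuous⟩
  have hπ : IsOpenQuotientMap π := hπ'
  have hc : Continuous fun t : Fin 3 → ℝ => F (WithLp.toLp 2 t) :=
    hF.comp (PiLp.continuousLinearEquiv 2 ℝ fun _ : Fin 3 => ℝ).symm.continuous
  have hfac : Function.FactorsThrough (fun t : Fin 3 → ℝ => F (WithLp.toLp 2 t)) π := by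
    intro a b hab
    have h1 : ∀ i, ∃ m : ℤ, b i + m = a i := fun i => by
      have h2 := congrFun hab i
      obtain ⟨m, hm⟩ := AddSubgroup.mem_zmultiples_iff.1 (QuotientAddGroup.eq.1 h2.symm)
      refine ⟨m, ?_⟩
      simp only [zsmul_eq_mul, mul_one] at hm
      linarith
    choose m hm using h1
    have : (WithLp.toLp 2 a : V3) = WithLp.toLp 2 b + lattV m := by
      ext i
      simp [lattV, hm]
    change F (WithLp.toLp 2 a) = F (WithLp.toLp 2 b)
    rw [this, hp]
  let G : C(UnitAddTorus (Fin 3), ℂ) := hπ.isQuotientMap.lift ⟨_, hc⟩ hfac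
  have hG : ∀ t, G (π t) = F (WithLp.toLp 2 t) := fun t =>
    DFunLike.congr_fun (hπ.isQuotientMap.lift_comp ⟨_, hc⟩ hfac) t
  have hcoef : ∀ n, UnitAddTorus.mFourierCoeff G n = fcoef F n := by
    intro n
    rw [UnitAddTorus.mFourierCoeff_eq_integral G n 0, fcoef, setIntegral_box]
    have e : {x : Fin 3 → ℝ | ∀ i, x i ∈ Ioc ((0 : Fin 3 → ℝ) i) ((0 : Fin 3 → ℝ) i + 1)} =
        pi univ fun i => Ioc ((0 : Fin 3 → ℝ) i) ((1 : Fin 3 → ℝ) i) := by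
      ext x; simp
    have e2 : (pi univ fun i => Ioc ((0 : Fin 3 → ℝ) i) ((1 : Fin 3 → ℝ) i)) =ᵐ[volume]
        Icc (0 : Fin 3 → ℝ) 1 := Measure.univ_pi_Ioc_ae_eq_Icc
    rw [e, setIntegral_congr_set e2]
    refine setIntegral_congr_fun measurableSet_Icc fun t _ => ?_
    simp only [smul_eq_mul, char_eq_mFourier]
    congr 1
    exact hG t
  have := UnitAddTorus.hasSum_mFourier_series_apply_of_summable (f := G)
    (by simpa only [funext hcoef] using hs) (π (WithLp.ofLp y))
  simp only [hcoef, hG, smul_eq_mul] at this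
  convert! this using 2 with n
  exact congrArg (fcoef F n * ·) (char_eq_mFourier n (WithLp.ofLp y))

end

end

/-! ### Smooth periodic functions on the tube and their Fourier coefficients in `y`. -/

noncomputable section

section

open MeasureTheory

/-- The complex-valued real-linear form `∑ cⱼ dxⱼ` on `ℝ³`. -/
def oneForm (c : Fin 3 → ℂ) : V3 →L[ℝ] ℂ :=
  ∑ j, c j • (Complex.ofRealCLM ∘L (EuclideanSpace.proj j : V3 →L[ℝ] ℝ))

theorem oneForm_apply (c : Fin 3 → ℂ) (v : V3) : oneForm c v = ∑ j, c j * v j := by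
  simp [oneForm]

theorem oneForm_single (c : Fin 3 → ℂ) (j : Fin 3) :
    oneForm c (EuclideanSpace.single j 1) = c j := by
  rw [oneForm_apply, Finset.sum_eq_single j (fun i _ hi => by simp [hi]) (by simp)]
  simp

theorem V3_eq_sum (v : V3) : v = ∑ j, v j • EuclideanSpace.single j (1 : ℝ) := by
  ext i
  simp [Pi.single_apply]

/-- Used throughout to identify a derivative by its three partial derivatives. -/
theorem eq_oneForm {L : V3 →L[ℝ] ℂ} {c : Fin 3 → ℂ}
    (h : ∀ j, L (EuclideanSpace.single j 1) = c j) : L = oneForm c := by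
  ext v
  conv_lhs => rw [V3_eq_sum v]
  simp only [map_sum, map_smul, h, oneForm_apply, Complex.real_smul]
  exact Finset.sum_congr rfl fun j _ => mul_comm _ _

theorem norm_oneForm_le (c : Fin 3 → ℂ) : ‖oneForm c‖ ≤ ∑ j, ‖c j‖ := by
  refine ContinuousLinearMap.opNorm_le_bound _ (Finset.sum_nonneg fun _ _ => norm_nonneg _)
    fun v => ?_
  rw [oneForm_apply, Finset.sum_mul]
  refine (norm_sum_le _ _).trans (Finset.sum_le_sum fun j _ => ?_)
  rw [norm_mul, Complex.norm_real]
  exact mul_le_mul_of_nonneg_left (PiLp.norm_apply_le v j) (norm_nonneg _)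

theorem continuous_oneForm : Continuous oneForm := by
  unfold oneForm
  fun_prop

/-- A continuous function on a closed convex set with interior that is differentiable in the interior,
with a derivative that extends continuously, is differentiable on the set. -/
theorem hasFDerivWithinAt_of_interior {E F : Type*} [NormedAddCommGroup E] [NormedSpace ℝ E]
    [NormedAddCommGroup F] [NormedSpace ℝ F] {s : Set E} (hs : Convex ℝ s) (hcl : IsClosed s)
    (hne : (interior s).Nonempty) {f : E → F} {f' : E → E →L[ℝ] F} (hf : ContinuousOn f s)
    (hf' : ContinuousOn f' s) (hd : ∀ x ∈ interior s, HasFDerivAt f (f' x) x) {x : E} (hx : x ∈ s) :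
    HasFDerivWithinAt f (f' x) s x := by
  have hc : closure (interior s) = s := by
    rw [hs.closure_interior_eq_closure_of_nonempty_interior hne, hcl.closure_eq]
  have h := hasFDerivWithinAt_closure_of_tendsto_fderiv (f := f) (s := interior s) (x := x)
    (f' := f' x) (fun y hy => (hd y hy).differentiableAt.differentiableWithinAt) hs.interior
    isOpen_interior (fun y hy => (hf y (hc ▸ hy)).mono interior_subset) ?_
  · rwa [hc] at h
  · have h2 : Filter.Tendsto f' (nhdsWithin x (interior s)) (nhds (f' x)) :=
      (hf' x hx).mono interior_subset
    refine h2.congr' ?_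
    filter_upwards [self_mem_nhdsWithin] with y hy using (hd y hy).fderiv.symm

/-- The closed unit ball of `ℝ³`. -/
abbrev ball3 : Set V3 := Metric.closedBall 0 1

theorem interior_ball3 : interior ball3 = Metric.ball 0 1 :=
  interior_closedBall (0 : V3) one_ne_zero

theorem interior_ball3_nonempty : (interior ball3).Nonempty := by
  rw [interior_ball3]; exact ⟨0, by simp⟩

theorem mk_mem_tube {x y : V3} : (x, y) ∈ tube ↔ x ∈ ball3 := by simp [tube]

theorem interior_tube : interior tube = Metric.ball 0 1 ×ˢ univ := by
  rw [tube, interior_prod_eq, interior_ball3, interior_univ]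

/-- Smooth periodic complex functions on the closed tube. -/
structure SmoothPer (f : C3 → ℂ) : Prop where
  contDiffOn : ContDiffOn ℝ ∞ f tube
  periodic : ∀ p n, f (p + latt n) = f p

namespace SmoothPer

variable {f g : C3 → ℂ}

theorem fderivWithin_apply (hf : SmoothPer f) (v : C3) :
    SmoothPer fun p => fderivWithin ℝ f tube p v :=
  ⟨(hf.contDiffOn.fderivWithin (m := ∞) uniqueDiffOn_tube (by simp)).clm_apply contDiffOn_const,
    fun p n => by rw [fderivWithin_periodic hf.periodic]⟩

theorem const_mul (hf : SmoothPer f) (c : ℂ) : SmoothPer fun p => c * f p :=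
  ⟨contDiffOn_const.mul hf.contDiffOn, fun p n => by rw [hf.periodic]⟩

theorem add (hf : SmoothPer f) (hg : SmoothPer g) : SmoothPer fun p => f p + g p :=
  ⟨hf.contDiffOn.add hg.contDiffOn, fun p n => by rw [hf.periodic, hg.periodic]⟩

theorem continuousOn (hf : SmoothPer f) : ContinuousOn f tube := hf.contDiffOn.continuousOn

theorem hasFDerivWithinAt (hf : SmoothPer f) {p : C3} (hp : p ∈ tube) :
    HasFDerivWithinAt f (fderivWithin ℝ f tube p) tube p :=
  (hf.contDiffOn.differentiableOn (by simp) p hp).hasFDerivWithinAt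

theorem per_snd (hf : SmoothPer f) (x : V3) (y : V3) (n : Fin 3 → ℤ) :
    f (x, y + lattV n) = f (x, y) := by
  rw [← hf.periodic (x, y) n]
  simp [latt, lattV]

theorem hasFDerivAt_snd (hf : SmoothPer f) {x : V3} (hx : x ∈ ball3) (y : V3) :
    HasFDerivAt (fun y => f (x, y))
      (fderivWithin ℝ f tube (x, y) ∘L ContinuousLinearMap.inr ℝ V3 V3) y := by
  have h := (hf.hasFDerivWithinAt (mk_mem_tube.2 hx)).comp (s := univ) y
    (hasFDerivAt_prodMk_right x y).hasFDerivWithinAt (fun z _ => mk_mem_tube.2 hx)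
  rwa [hasFDerivWithinAt_univ] at h

theorem continuous_snd (hf : SmoothPer f) {x : V3} (hx : x ∈ ball3) :
    Continuous fun y => f (x, y) :=
  continuous_iff_continuousAt.2 fun y => (hf.hasFDerivAt_snd hx y).continuousAt

/-- A lattice translation by the integer parts moves `y` into `box`, so continuity on a compact set
suffices. -/
theorem exists_bound (hf : SmoothPer f) : ∃ C, 0 ≤ C ∧ ∀ p ∈ tube, ‖f p‖ ≤ C := by
  have hK : IsCompact (ball3 ×ˢ Metric.closedBall (0 : V3) 2) :=
    (isCompact_closedBall 0 1).prod (isCompact_closedBall 0 2)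
  obtain ⟨C, hC⟩ := hK.exists_bound_of_continuousOn
    (hf.continuousOn.mono (prod_mono_right (subset_univ _)))
  refine ⟨max C 0, le_max_right _ _, fun p hp => (?_ : _ ≤ C).trans (le_max_left _ _)⟩
  have h1 : p.2 + lattV (fun i => -⌊p.2 i⌋) ∈ box := fun i => by
    simp only [lattV, PiLp.add_apply, Int.cast_neg]
    exact ⟨by linarith [Int.floor_le (p.2 i)], by linarith [Int.lt_floor_add_one (p.2 i)]⟩
  rw [show f p = f (p.1, p.2 + lattV (fun i => -⌊p.2 i⌋)) from (hf.per_snd _ _ _).symm]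
  exact hC _ ⟨hp.1, box_subset_closedBall h1⟩

end SmoothPer

/-- The coefficient of `e^{2πi n·y}` in the Fourier expansion of `f` in `y`. -/
def coef (f : C3 → ℂ) (n : Fin 3 → ℤ) (x : V3) : ℂ := fcoef (fun y => f (x, y)) n

theorem norm_coef_le {f : C3 → ℂ} {C : ℝ} (hC : ∀ p ∈ tube, ‖f p‖ ≤ C) (n : Fin 3 → ℤ) {x : V3}
    (hx : x ∈ ball3) : ‖coef f n x‖ ≤ C := by
  have h := norm_setIntegral_le_of_norm_le_const (μ := volume) (s := box) (C := C)
    (f := fun y => char (-n) y * f (x, y)) (by rw [volume_box]; simp) fun y _ => by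
      rw [norm_mul, norm_char, one_mul]
      exact hC _ (mk_mem_tube.2 hx)
  rw [Measure.real, volume_box, ENNReal.toReal_one, mul_one] at h
  exact h

theorem integrableOn_box {E : Type*} [NormedAddCommGroup E] {h : V3 → E} (hh : Continuous h) :
    IntegrableOn h box :=
  (hh.continuousOn.integrableOn_compact (isCompact_closedBall (0 : V3) 2)).mono_set
    box_subset_closedBall

theorem coef_add {f g : C3 → ℂ} (hf : SmoothPer f) (hg : SmoothPer g) (n : Fin 3 → ℤ) {x : V3}
    (hx : x ∈ ball3) : coef (fun p => f p + g p) n x = coef f n x + coef g n x := by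
  simp only [coef, fcoef, mul_add]
  exact integral_add
    (integrableOn_box ((contDiff_char (-n)).continuous.mul (hf.continuous_snd hx)))
    (integrableOn_box ((contDiff_char (-n)).continuous.mul (hg.continuous_snd hx)))

theorem coef_const_mul (f : C3 → ℂ) (c : ℂ) (n : Fin 3 → ℤ) (x : V3) :
    coef (fun p => c * f p) n x = c * coef f n x := by
  simp only [coef, fcoef, ← integral_const_mul]
  exact integral_congr_ae (Filter.Eventually.of_forall fun y => by ring)

theorem coef_congr {f g : C3 → ℂ} (h : ∀ p ∈ tube, f p = g p) (n : Fin 3 → ℤ) {x : V3}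
    (hx : x ∈ ball3) : coef f n x = coef g n x := by
  simp only [coef, h _ (mk_mem_tube.2 hx)]

/-- Integration by parts: the `j`-th derivative of the periodic function `char (-n) * f` has
integral zero over a period. -/
theorem coef_fderiv_snd {f : C3 → ℂ} (hf : SmoothPer f) (n : Fin 3 → ℤ) {x : V3} (hx : x ∈ ball3)
    (j : Fin 3) : coef (fun p => fderivWithin ℝ f tube p (ey j)) n x =
      2 * Real.pi * Complex.I * n j * coef f n x := by
  have hd : ∀ y, HasFDerivAt (fun y => char (-n) y * f (x, y)) _ y := fun y =>
    (hasFDerivAt_char (-n) y).mul (hf.hasFDerivAt_snd hx y)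
  have e : ∀ y, (char (-n) y • (fderivWithin ℝ f tube (x, y) ∘L ContinuousLinearMap.inr ℝ V3 V3) +
      f (x, y) • ∑ k, (2 * Real.pi * Complex.I * ((-n) k : ℤ) * char (-n) y) •
      (Complex.ofRealCLM ∘L (EuclideanSpace.proj k : V3 →L[ℝ] ℝ))) (EuclideanSpace.single j 1) =
      char (-n) y * fderivWithin ℝ f tube (x, y) (ey j) -
        2 * Real.pi * Complex.I * n j * (char (-n) y * f (x, y)) := fun y => by
    have h1 := oneForm_single (fun k => 2 * Real.pi * Complex.I * ((-n) k : ℤ) * char (-n) y) j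
    rw [oneForm] at h1
    rw [add_apply, smul_apply, smul_apply, h1]
    simp [ey]
    ring
  have c1 : Continuous fun y => char (-n) y * fderivWithin ℝ f tube (x, y) (ey j) :=
    (contDiff_char (-n)).continuous.mul ((hf.fderivWithin_apply (ey j)).continuous_snd hx)
  have c2 : Continuous fun y => 2 * Real.pi * Complex.I * n j * (char (-n) y * f (x, y)) :=
    continuous_const.mul ((contDiff_char (-n)).continuous.mul (hf.continuous_snd hx))
  have key := setIntegral_box_fderiv j hd (by simp only [e]; exact c1.sub c2) fun y m => by
    rw [char_add_lattV, hf.per_snd]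
  simp only [e] at key
  rw [integral_sub (integrableOn_box c1) (integrableOn_box c2), integral_const_mul] at key
  exact sub_eq_zero.1 key

theorem continuousOn_coef {f : C3 → ℂ} (hf : SmoothPer f) (n : Fin 3 → ℤ) :
    ContinuousOn (coef f n) ball3 := by
  obtain ⟨C, -, hC⟩ := hf.exists_bound
  refine continuousOn_of_dominated (bound := fun _ => C) (fun x hx => ?_) (fun x hx => ?_) ?_ ?_
  · exact ((contDiff_char (-n)).continuous.mul (hf.continuous_snd hx)).aestronglyMeasurable
  · refine Filter.Eventually.of_forall fun y => ?_
    rw [norm_mul, norm_char, one_mul]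
    exact hC _ (mk_mem_tube.2 hx)
  · exact integrableOn_box continuous_const
  · refine Filter.Eventually.of_forall fun y => continuousOn_const.mul ?_
    exact hf.continuousOn.comp (by fun_prop) fun x hx => mk_mem_tube.2 hx

theorem hasFDerivWithinAt_coef {f : C3 → ℂ} (hf : SmoothPer f) (n : Fin 3 → ℤ) {x : V3}
    (hx : x ∈ ball3) : HasFDerivWithinAt (coef f n)
      (oneForm fun j => coef (fun p => fderivWithin ℝ f tube p (ex j)) n x) ball3 x := by
  -- Differentiation under the integral sign is carried out in the open ball only; the formula for
  -- the derivative is continuous up to the sphere, so it persists there.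
  refine hasFDerivWithinAt_of_interior (f' := fun x => oneForm fun j =>
    coef (fun p => fderivWithin ℝ f tube p (ex j)) n x) (convex_closedBall 0 1)
    Metric.isClosed_closedBall interior_ball3_nonempty (continuousOn_coef hf n)
    (continuous_oneForm.comp_continuousOn
      (continuousOn_pi.2 fun j => continuousOn_coef (hf.fderivWithin_apply (ex j)) n)) ?_ hx
  intro x hx
  rw [interior_ball3] at hx
  have hsub : Metric.ball (0 : V3) 1 ⊆ ball3 := Metric.ball_subset_closedBall
  have hC : ∃ C, ∀ p ∈ tube, ‖fderivWithin ℝ f tube p ∘L ContinuousLinearMap.inl ℝ V3 V3‖ ≤ C := by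
    choose C h0 hC using fun j : Fin 3 => (hf.fderivWithin_apply (ex j)).exists_bound
    refine ⟨∑ j, C j, fun p hp => ?_⟩
    rw [eq_oneForm (L := fderivWithin ℝ f tube p ∘L ContinuousLinearMap.inl ℝ V3 V3)
      (c := fun j => fderivWithin ℝ f tube p (ex j)) fun j => rfl]
    exact (norm_oneForm_le _).trans (Finset.sum_le_sum fun j _ => hC j p hp)
  obtain ⟨C, hC⟩ := hC
  have hcont : Continuous fun y => char (-n) y •
      (fderivWithin ℝ f tube (x, y) ∘L ContinuousLinearMap.inl ℝ V3 V3) := by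
    have : ∀ y, fderivWithin ℝ f tube (x, y) ∘L ContinuousLinearMap.inl ℝ V3 V3 =
        oneForm fun j => fderivWithin ℝ f tube (x, y) (ex j) := fun y => eq_oneForm fun j => rfl
    simp only [this]
    exact (contDiff_char (-n)).continuous.smul (continuous_oneForm.comp
      (continuous_pi fun j => (hf.fderivWithin_apply (ex j)).continuous_snd (hsub hx)))
  have key := hasFDerivAt_integral_of_dominated_of_fderiv_le (μ := volume.restrict box) (𝕜 := ℝ)
    (F := fun x y => char (-n) y * f (x, y)) (x₀ := x) (bound := fun _ => C)
    (s := Metric.ball (0 : V3) 1) (F' := fun x y => char (-n) y •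
      (fderivWithin ℝ f tube (x, y) ∘L ContinuousLinearMap.inl ℝ V3 V3))
    (Metric.isOpen_ball.mem_nhds hx) ?_ ?_ ?_ ?_ ?_ ?_
  · have e : (∫ y in box, char (-n) y •
        (fderivWithin ℝ f tube (x, y) ∘L ContinuousLinearMap.inl ℝ V3 V3)) =
        oneForm fun j => coef (fun p => fderivWithin ℝ f tube p (ex j)) n x := by
      refine eq_oneForm fun j => ?_
      rw [ContinuousLinearMap.integral_apply (integrableOn_box hcont)]
      rfl
    rw [← e]
    exact key
  · filter_upwards [Metric.isOpen_ball.mem_nhds hx] with z hz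
    exact ((contDiff_char (-n)).continuous.mul
      (hf.continuous_snd (hsub hz))).aestronglyMeasurable
  · exact integrableOn_box ((contDiff_char (-n)).continuous.mul (hf.continuous_snd (hsub hx)))
  · exact hcont.aestronglyMeasurable
  · refine Filter.Eventually.of_forall fun y z hz => ?_
    rw [norm_smul, norm_char, one_mul]
    exact hC _ (mk_mem_tube.2 (hsub hz))
  · exact integrableOn_box continuous_const
  · refine Filter.Eventually.of_forall fun y z hz => ?_
    have h1 : HasFDerivAt f (fderivWithin ℝ f tube (z, y)) (z, y) := by
      refine (hf.hasFDerivWithinAt (mk_mem_tube.2 (hsub hz))).hasFDerivAt ?_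
      rw [mem_interior_iff_mem_nhds.symm, interior_tube]
      exact ⟨hz, mem_univ _⟩
    exact (h1.comp z (hasFDerivAt_prodMk_left z y)).const_mul (char (-n) y)

theorem exists_norm_eq (n : Fin 3 → ℤ) : ∃ j, ‖n‖ = ‖n j‖ := by
  obtain ⟨j, hj⟩ := Finite.exists_max fun j => ‖n j‖
  exact ⟨j, le_antisymm ((pi_norm_le_iff_of_nonneg (norm_nonneg _)).2 hj) (norm_le_pi_norm n j)⟩

/-- Each `y_j`-derivative multiplies the coefficient by `2πi n_j`, of modulus at least `‖n j‖`;
hence the induction over all smooth periodic `f` at once. The constant does not depend on `x`. -/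
theorem coef_decay_coord (N : ℕ) (j : Fin 3) : ∀ {f : C3 → ℂ}, SmoothPer f →
    ∃ C, 0 ≤ C ∧ ∀ n, ∀ x ∈ ball3, ‖n j‖ ^ N * ‖coef f n x‖ ≤ C := by
  induction N with
  | zero =>
    intro f hf
    obtain ⟨C, h0, hC⟩ := hf.exists_bound
    exact ⟨C, h0, fun n x hx => by simpa using norm_coef_le hC n hx⟩
  | succ N ih =>
    intro f hf
    obtain ⟨C, h0, hC⟩ := ih (hf.fderivWithin_apply (ey j))
    refine ⟨C, h0, fun n x hx => le_trans ?_ (hC n x hx)⟩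
    rw [coef_fderiv_snd hf n hx, pow_succ, mul_assoc]
    refine mul_le_mul_of_nonneg_left ?_ (by positivity)
    rw [norm_mul]
    refine mul_le_mul_of_nonneg_right ?_ (norm_nonneg _)
    have h1 : ‖(2 * Real.pi * Complex.I * n j : ℂ)‖ = 2 * Real.pi * ‖n j‖ := by
      simp [abs_of_pos Real.pi_pos, Int.norm_eq_abs]
    rw [h1]
    nlinarith [Real.pi_gt_three, norm_nonneg (n j)]

theorem coef_decay {f : C3 → ℂ} (hf : SmoothPer f) (N : ℕ) :
    ∃ C, 0 ≤ C ∧ ∀ n, ∀ x ∈ ball3, ‖n‖ ^ N * ‖coef f n x‖ ≤ C := by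
  choose C h0 hC using fun j => coef_decay_coord N j hf
  refine ⟨∑ j, C j, Finset.sum_nonneg fun j _ => h0 j, fun n x hx => ?_⟩
  obtain ⟨j, hj⟩ := exists_norm_eq n
  rw [hj]
  exact (hC j n x hx).trans (Finset.single_le_sum (fun j _ => h0 j) (Finset.mem_univ j))

/-- The exponent 4 exceeds the rank 3 of the lattice. -/
theorem summable_norm_inv_pow : Summable fun n : Fin 3 → ℤ => ‖n‖⁻¹ ^ 4 := by
  let L := Submodule.span ℤ (range (Pi.basisFun ℝ (Fin 3)))
  have hL : Module.finrank ℤ L < 4 := by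
    rw [ZLattice.rank ℝ L]
    simp
  have h := ZLattice.summable_norm_pow_inv L 4 hL
  have hmem : ∀ n : Fin 3 → ℤ, (fun i => (n i : ℝ)) ∈ L := fun n => by
    have : (fun i => (n i : ℝ)) = ∑ i, n i • Pi.basisFun ℝ (Fin 3) i := by
      ext i
      simp [Pi.single_apply]
    rw [this]
    exact Submodule.sum_mem _ fun i _ => Submodule.smul_mem _ _
      (Submodule.subset_span (mem_range_self i))
  have := h.comp_injective (i := fun n : Fin 3 → ℤ => (⟨fun i => (n i : ℝ), hmem n⟩ : L)) (by
    intro n m hnm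
    funext i
    have h1 : (n i : ℝ) = m i := congrFun (congrArg Subtype.val hnm) i
    exact_mod_cast h1)
  refine this.congr fun n => ?_
  have e : ‖n‖ = ‖(fun i => (n i : ℝ) : Fin 3 → ℝ)‖ := by
    simp only [Pi.norm_def]
    rfl
  simp only [Function.comp]
  rw [e]
  rfl

/-- A summable sequence that dominates rapidly decreasing sequences. -/
def decay (n : Fin 3 → ℤ) : ℝ := if n = 0 then 1 else ‖n‖⁻¹ ^ 4

theorem summable_decay : Summable decay := by
  refine (summable_norm_inv_pow.add (summable_of_hasFiniteSupport (f := fun n : Fin 3 → ℤ =>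
    if n = 0 then (1 : ℝ) else 0) ((finite_singleton 0).subset fun n hn => ?_))).congr fun n => ?_
  · by_contra h
    exact hn (if_neg h)
  · by_cases h : n = 0 <;> simp [decay, h]

/-- The bound of order 4 serves for `n ≠ 0`; it says nothing at `n = 0`, where the bound of order 0
takes over. -/
theorem le_decay {a C D : ℝ} {n : Fin 3 → ℤ} (h0 : a ≤ C) (h4 : ‖n‖ ^ 4 * a ≤ D)
    (hC : 0 ≤ C) (hD : 0 ≤ D) : a ≤ (C + D) * decay n := by
  by_cases h : n = 0
  · simp only [decay, h, if_true]; linarith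
  · have hn : 0 < ‖n‖ := norm_pos_iff.2 h
    rw [decay, if_neg h, inv_pow, ← div_eq_mul_inv, le_div_iff₀ (by positivity)]
    linarith

theorem summable_coef {f : C3 → ℂ} (hf : SmoothPer f) {x : V3} (hx : x ∈ ball3) :
    Summable fun n => coef f n x := by
  obtain ⟨C, h0, hC⟩ := coef_decay hf 0
  obtain ⟨D, h1, hD⟩ := coef_decay hf 4
  refine Summable.of_norm_bounded (summable_decay.mul_left (C + D)) fun n => ?_
  exact le_decay (by simpa using hC n x hx) (hD n x hx) h0 h1

theorem hasSum_coef {f : C3 → ℂ} (hf : SmoothPer f) {p : C3} (hp : p ∈ tube) :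
    HasSum (fun n => coef f n p.1 * char n p.2) (f p) :=
  hasSum_fcoef (hf.continuous_snd hp.1) (hf.per_snd p.1) (summable_coef hf hp.1) p.2

theorem eq_zero_of_coef {f : C3 → ℂ} (hf : SmoothPer f) (h : ∀ n, ∀ x ∈ ball3, coef f n x = 0)
    {p : C3} (hp : p ∈ tube) : f p = 0 := by
  have := hasSum_coef hf hp
  simp only [h _ _ hp.1, zero_mul] at this
  exact this.unique hasSum_zero

end

end

/-! ### The ∂̄-equation on `B³ × T³` with zero boundary values. -/

noncomputable section

/-- The Cauchy-Riemann operator `∂/∂z̄ₖ` on functions on the closed tube. -/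
def dbar (k : Fin 3) (f : C3 → ℂ) (p : C3) : ℂ :=
  (1 / 2) * (fderivWithin ℝ f tube p (ex k) + Complex.I * fderivWithin ℝ f tube p (ey k))

/-- On the mode `e^{2πi n·y}` the operator `∂/∂z̄ₖ` acts as `½ (∂/∂xₖ - 2π nₖ)`. -/
theorem coef_fderiv_fst {f : C3 → ℂ} (hf : SmoothPer f) (n : Fin 3 → ℤ) {x : V3} (hx : x ∈ ball3)
    (k : Fin 3) : coef (fun p => fderivWithin ℝ f tube p (ex k)) n x =
      2 * coef (dbar k f) n x + 2 * Real.pi * n k * coef f n x := by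
  have h : coef (dbar k f) n x = (1 / 2) * (coef (fun p => fderivWithin ℝ f tube p (ex k)) n x +
      Complex.I * (2 * Real.pi * Complex.I * n k * coef f n x)) := by
    rw [← coef_fderiv_snd hf n hx, ← coef_const_mul, ← coef_add (hf.fderivWithin_apply (ex k))
      ((hf.fderivWithin_apply (ey k)).const_mul Complex.I) n hx, ← coef_const_mul]
    rfl
  rw [h]
  linear_combination (-2 * (Real.pi : ℂ) * n k * coef f n x) * Complex.I_mul_I

/-- The function `x ↦ exp (∑ aₖ xₖ)`. -/
def cexpL (a : Fin 3 → ℂ) (x : V3) : ℂ := Complex.exp (oneForm a x)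

theorem hasFDerivAt_cexpL (a : Fin 3 → ℂ) (x : V3) :
    HasFDerivAt (cexpL a) (oneForm fun k => a k * cexpL a x) x := by
  have h := (oneForm a).hasFDerivAt (x := x) |>.cexp
  refine h.congr_fderiv (eq_oneForm fun j => ?_)
  rw [smul_apply, oneForm_single, smul_eq_mul, mul_comm, cexpL]

/-- The linear map `c ↦ ∑ cⱼ dxⱼ`. -/
def oneFormL : (Fin 3 → ℂ) →L[ℝ] V3 →L[ℝ] ℂ :=
  LinearMap.toContinuousLinearMap
    { toFun := oneForm
      map_add' := fun a b => by ext v; simp [oneForm_apply, add_mul, Finset.sum_add_distrib]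
      map_smul' := fun c a => by ext v; simp [oneForm_apply, Finset.mul_sum, mul_assoc] }

theorem oneFormL_apply (c : Fin 3 → ℂ) : oneFormL c = oneForm c := rfl

/-- The exponent `2πn` of the weight of the `n`-th Fourier mode. -/
def wt (n : Fin 3 → ℤ) : Fin 3 → ℂ := fun k => 2 * Real.pi * n k

theorem oneForm_wt (n : Fin 3 → ℤ) (x : V3) :
    oneForm (wt n) x = ((2 * Real.pi * inner ℝ (lattV n) x : ℝ) : ℂ) := by
  rw [oneForm_apply, PiLp.inner_apply]
  simp only [Fin.sum_univ_three, wt, lattV]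
  simp
  ring

theorem norm_cexpL_wt (n : Fin 3 → ℤ) (x : V3) :
    ‖cexpL (wt n) x‖ = Real.exp (2 * Real.pi * inner ℝ (lattV n) x) := by
  rw [cexpL, oneForm_wt, Complex.norm_exp, Complex.ofReal_re]

theorem cexpL_neg (a : Fin 3 → ℂ) (x : V3) : cexpL (-a) x * cexpL a x = 1 := by
  rw [cexpL, cexpL, ← Complex.exp_add, ← oneFormL_apply, ← oneFormL_apply, map_neg]
  simp

/-- Cauchy-Schwarz, with `x₀ = u/|u|`; for `u = 0` any unit vector does. The point `x₀` is the base
point of the integration in `exists_mode`. -/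
theorem exists_unit_maximizer (u : V3) :
    ∃ x₀ : V3, ‖x₀‖ = 1 ∧ ∀ x ∈ ball3, inner ℝ u x ≤ inner ℝ u x₀ := by
  by_cases h : u = 0
  · exact ⟨EuclideanSpace.single 0 1, by simp, fun x _ => by simp [h]⟩
  · have hu : ‖u‖ ≠ 0 := norm_ne_zero_iff.2 h
    refine ⟨‖u‖⁻¹ • u, by simp [norm_smul, hu], fun x hx => ?_⟩
    rw [inner_smul_right, real_inner_self_eq_norm_sq]
    have h1 : ‖x‖ ≤ 1 := by simpa using hx
    have h2 := real_inner_le_norm u x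
    have h3 : ‖u‖⁻¹ * ‖u‖ ^ 2 = ‖u‖ := by field_simp
    rw [h3]
    nlinarith [norm_nonneg u]

theorem isPreconnected_cone : IsPreconnected cone := by
  have h : cone = ({0}ᶜ : Set V3) ×ˢ (univ : Set V3) := by
    ext p; simp [cone]
  rw [h]
  refine IsPreconnected.prod ?_ isPreconnected_univ
  refine (isConnected_compl_singleton_of_one_lt_rank ?_ (0 : V3)).isPreconnected
  rw [← Module.finrank_eq_rank]
  norm_cast
  simp

/-- A function on the ball whose derivative vanishes on the tangent vectors of the sphere is constant on
the sphere. -/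
theorem eq_of_tangential_zero {g : V3 → ℂ} {g' : V3 → V3 →L[ℝ] ℂ}
    (hg : ∀ x ∈ ball3, HasFDerivWithinAt g (g' x) ball3 x)
    (h : ∀ x v : V3, ‖x‖ = 1 → inner ℝ x v = 0 → g' x v = 0) {x z : V3} (hx : ‖x‖ = 1)
    (hz : ‖z‖ = 1) : g x = g z := by
  -- The pull-back of `g` under the retraction has zero derivative, since the derivative of `retr`
  -- takes values in the tangent vectors; the cone is connected.
  have hd : ∀ p ∈ cone, HasFDerivAt (fun p => g (retr p).1) (0 : C3 →L[ℝ] ℂ) p := by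
    intro p hp
    have h1 := retr_mem_tubeBdry hp
    have h2 := ((hg (retr p).1 (tubeBdry_subset h1).1).comp p
      (hasFDerivAt_retr hp).fst.hasFDerivWithinAt (s := cone)
      fun q hq => (tubeBdry_subset (retr_mem_tubeBdry hq)).1).hasFDerivAt (isOpen_cone.mem_nhds hp)
    refine h2.congr_fderiv (ContinuousLinearMap.ext fun w => ?_)
    exact h _ _ (norm_of_mem h1) (fderiv_retr_mem hp w)
  have hm : ∀ {x : V3}, ‖x‖ = 1 → ((x, 0) : C3) ∈ tubeBdry := fun hx => by
    simp [tubeBdry, hx]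
  have := isOpen_cone.is_const_of_fderiv_eq_zero (𝕜 := ℝ) isPreconnected_cone
    (fun p hp => (hd p hp).differentiableAt.differentiableWithinAt) (fun p hp => (hd p hp).fderiv)
    (tubeBdry_subset_cone (hm hx)) (tubeBdry_subset_cone (hm hz))
  simpa [retr_of_mem (hm hx), retr_of_mem (hm hz)] using this

/-- The relations `x_l c_k = x_k c_l` say that `c` is parallel to `x`: for `|x| = 1` one gets `c =
(x·c) x`, which kills `x^⊥`. -/
theorem oneForm_eq_zero_of_parallel {x v : V3} {c : Fin 3 → ℂ} (hx : ‖x‖ = 1)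
    (hv : inner ℝ x v = 0) (hc : ∀ k l, x l * c k = x k * c l) : oneForm c v = 0 := by
  have h1 : ((∑ l, x l ^ 2 : ℝ) : ℂ) = 1 := by
    rw [← EuclideanSpace.real_norm_sq_eq, hx]; norm_num
  have h2 : ((∑ l, x l * v l : ℝ) : ℂ) = 0 := by
    rw [PiLp.inner_apply] at hv
    have : ∑ l, x l * v l = 0 := by
      rw [← hv]; exact Finset.sum_congr rfl fun l _ => by simp [mul_comm]
    rw [this]; simp
  have h3 : ∀ k, c k = x k * ∑ l, x l * c l := fun k => by
    calc c k = ((∑ l, x l ^ 2 : ℝ) : ℂ) * c k := by rw [h1, one_mul]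
      _ = ∑ l, x l * (x l * c k) := by
        push_cast; rw [Finset.sum_mul]; exact Finset.sum_congr rfl fun l _ => by ring
      _ = x k * ∑ l, x l * c l := by
        rw [Finset.mul_sum]
        exact Finset.sum_congr rfl fun l _ => by rw [hc k l]; ring
  rw [oneForm_apply]
  calc ∑ j, c j * v j = (∑ l, x l * c l) * ((∑ l, x l * v l : ℝ) : ℂ) := by
        push_cast
        rw [Finset.mul_sum]
        exact Finset.sum_congr rfl fun j _ => by rw [h3 j]; ring
    _ = 0 := by rw [h2, mul_zero]

/-- The solution of the weighted Poincaré problem for one Fourier mode, with vanishing boundary values and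
with an estimate that is uniform in the mode. -/
theorem exists_mode (n : Fin 3 → ℤ) {c : Fin 3 → V3 → ℂ} {d : Fin 3 → Fin 3 → V3 → ℂ} {M : ℝ}
    (hc : ∀ k, ∀ x ∈ ball3, HasFDerivWithinAt (c k) (oneForm fun j => d k j x) ball3 x)
    (hd : ∀ k j, ∀ x ∈ ball3, d k j x - wt n j * c k x = d j k x - wt n k * c j x)
    (hb : ∀ x : V3, ‖x‖ = 1 → ∀ k l, x l * c k x = x k * c l x)
    (hM : ∀ k, ∀ x ∈ ball3, ‖c k x‖ ≤ M) :
    ∃ b : V3 → ℂ, (∀ x ∈ ball3, HasFDerivWithinAt b (oneForm fun k => wt n k * b x + c k x) ball3 x) ∧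
      (∀ x : V3, ‖x‖ = 1 → b x = 0) ∧ ∀ x ∈ ball3, ‖b x‖ ≤ 6 * M := by
  have hw : ∀ x, HasFDerivAt (cexpL (-wt n)) (oneForm fun k => -wt n k * cexpL (-wt n) x) x :=
    fun x => hasFDerivAt_cexpL (-wt n) x
  -- The substitution `b = e^{2πn·x} g` turns `∂ₖb - 2πnₖ b = cₖ` into `∂ₖg = e^{-2πn·x} cₖ`, whose
  -- right side is a closed 1-form by `hd`.
  have hω : ∀ x ∈ ball3, HasFDerivWithinAt (fun x => oneForm fun k => cexpL (-wt n) x * c k x)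
      (oneFormL ∘L ContinuousLinearMap.pi fun k => oneForm fun j =>
        cexpL (-wt n) x * (d k j x - wt n j * c k x)) ball3 x := by
    intro x hx
    have hpi : HasFDerivWithinAt (fun x k => cexpL (-wt n) x * c k x)
        (ContinuousLinearMap.pi fun k => oneForm fun j =>
          cexpL (-wt n) x * (d k j x - wt n j * c k x)) ball3 x := by
      refine hasFDerivWithinAt_pi.2 fun k => ?_
      refine ((hw x).hasFDerivWithinAt.mul (hc k x hx)).congr_fderiv (eq_oneForm fun j => ?_)
      rw [add_apply, smul_apply, smul_apply, oneForm_single, oneForm_single]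
      simp only [smul_eq_mul]
      ring
    exact oneFormL.hasFDerivAt.comp_hasFDerivWithinAt x hpi
  -- The Poincaré lemma on the convex ball gives a primitive of this closed form.
  obtain ⟨g, hg⟩ := (convex_closedBall (0 : V3) 1).exists_forall_hasFDerivWithinAt_of_hasFDerivWithinAt_symmetric
    hω (by
      intro x hx u _ v _
      simp only [ContinuousLinearMap.comp_apply, oneFormL_apply, ContinuousLinearMap.pi_apply,
        oneForm_apply, Finset.sum_mul]
      rw [Finset.sum_comm]
      refine Finset.sum_congr rfl fun j _ => Finset.sum_congr rfl fun k _ => ?_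
      rw [hd k j x hx]
      ring)
  obtain ⟨x₀, hx₀, hmax⟩ := exists_unit_maximizer (lattV n)
  have hx₀' : x₀ ∈ ball3 := by simp [hx₀]
  refine ⟨fun x => cexpL (wt n) x * (g x - g x₀), fun x hx => ?_, fun x hx => ?_, fun x hx => ?_⟩
  · refine ((hasFDerivAt_cexpL (wt n) x).hasFDerivWithinAt.mul
      ((hg x hx).sub_const (g x₀))).congr_fderiv (eq_oneForm fun j => ?_)
    rw [add_apply, smul_apply, smul_apply, oneForm_single, oneForm_single]
    simp only [smul_eq_mul]
    linear_combination (c j x) * cexpL_neg (wt n) x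
  · beta_reduce
    -- By `hb` the 1-form vanishes on tangent vectors of the sphere, so `g` is constant there;
    -- subtracting `g x₀` gives zero boundary values.
    rw [eq_of_tangential_zero hg (fun x v hx hv => oneForm_eq_zero_of_parallel hx hv fun k l => ?_)
      hx hx₀, sub_self, mul_zero]
    linear_combination cexpL (-wt n) x * hb x hx k l
  · have hM0 : 0 ≤ M := (norm_nonneg _).trans (hM 0 x hx)
    have hseg : segment ℝ x₀ x ⊆ ball3 := (convex_closedBall 0 1).segment_subset hx₀' hx
    have hwx : ∀ z, ‖cexpL (-wt n) z‖ = Real.exp (-(2 * Real.pi * inner ℝ (lattV n) z)) := by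
      intro z
      have h1 := congrArg norm (cexpL_neg (wt n) z)
      rw [norm_mul, norm_cexpL_wt, norm_one] at h1
      rw [Real.exp_neg]
      exact eq_inv_of_mul_eq_one_left h1
    -- Since `n·x₀` is maximal, `n·z ≥ n·x` on the segment, so the weight there is at most
    -- `e^{-2πn·x}`. This cancels the factor `e^{2πn·x}` in `b`. The 3 counts the components; with
    -- the length 2 of the segment it gives `6 * M`.
    have hbd : ∀ z ∈ segment ℝ x₀ x, ‖oneForm fun k => cexpL (-wt n) z * c k z‖ ≤
        Real.exp (-(2 * Real.pi * inner ℝ (lattV n) x)) * (3 * M) := by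
      intro z hz
      have hzx : inner ℝ (lattV n) x ≤ inner ℝ (lattV n) z := by
        obtain ⟨a, b, ha, hb, hab, rfl⟩ := hz
        rw [inner_add_right, inner_smul_right, inner_smul_right]
        have h1 := mul_le_mul_of_nonneg_left (hmax x hx) ha
        rw [eq_sub_of_add_eq' hab]
        linarith
      refine (norm_oneForm_le _).trans ?_
      simp only [norm_mul, hwx, ← Finset.mul_sum]
      refine mul_le_mul (Real.exp_le_exp.2 ?_) ?_ (Finset.sum_nonneg fun _ _ => norm_nonneg _)
        (Real.exp_nonneg _)
      · have := mul_le_mul_of_nonneg_left hzx (by positivity : 0 ≤ 2 * Real.pi)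
        linarith
      · rw [Fin.sum_univ_three]
        linarith [hM 0 z (hseg hz), hM 1 z (hseg hz), hM 2 z (hseg hz)]
    have key := Convex.norm_image_sub_le_of_norm_hasFDerivWithin_le
      (fun z hz => (hg z (hseg hz)).mono hseg) hbd (convex_segment x₀ x)
      (left_mem_segment ℝ x₀ x) (right_mem_segment ℝ x₀ x)
    have hdist : ‖x - x₀‖ ≤ 2 := by
      have h1 : ‖x‖ ≤ 1 := by simpa using hx
      linarith [norm_sub_le x x₀]
    rw [norm_mul, norm_cexpL_wt]
    calc Real.exp (2 * Real.pi * inner ℝ (lattV n) x) * ‖g x - g x₀‖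
        ≤ Real.exp (2 * Real.pi * inner ℝ (lattV n) x) *
          (Real.exp (-(2 * Real.pi * inner ℝ (lattV n) x)) * (3 * M) * 2) := by
          refine mul_le_mul_of_nonneg_left (key.trans ?_) (Real.exp_nonneg _)
          exact mul_le_mul_of_nonneg_left hdist (by positivity)
      _ = 6 * M * (Real.exp (2 * Real.pi * inner ℝ (lattV n) x) *
          Real.exp (-(2 * Real.pi * inner ℝ (lattV n) x))) := by ring
      _ = 6 * M := by rw [← Real.exp_add]; simp

/-- The function with Fourier coefficients `bₙ`. -/
def synth (b : (Fin 3 → ℤ) → V3 → ℂ) (p : C3) : ℂ := ∑' n, b n p.1 * char n p.2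

/-- The Fourier coefficients of `∂/∂yⱼ`. -/
def derivY (j : Fin 3) (b : (Fin 3 → ℤ) → V3 → ℂ) (n : Fin 3 → ℤ) (x : V3) : ℂ :=
  2 * Real.pi * Complex.I * n j * b n x

/-- The coefficients `bₙ` decrease rapidly and satisfy the equations `∂u/∂z̄ₖ = fₖ` mode by mode. -/
structure DbarModes (b : (Fin 3 → ℤ) → V3 → ℂ) (f : Fin 3 → C3 → ℂ) : Prop where
  smooth : ∀ k, SmoothPer (f k)
  deriv : ∀ n, ∀ x ∈ ball3, HasFDerivWithinAt (b n)
    (oneForm fun k => wt n k * b n x + 2 * coef (f k) n x) ball3 x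
  rapid : ∀ N : ℕ, ∃ C, 0 ≤ C ∧ ∀ n, ∀ x ∈ ball3, ‖n‖ ^ N * ‖b n x‖ ≤ C

theorem exists_decay_bound {b : (Fin 3 → ℤ) → V3 → ℂ}
    (h : ∀ N : ℕ, ∃ C, 0 ≤ C ∧ ∀ n, ∀ x ∈ ball3, ‖n‖ ^ N * ‖b n x‖ ≤ C) :
    ∃ C, 0 ≤ C ∧ ∀ n, ∀ x ∈ ball3, ‖b n x‖ ≤ C * decay n := by
  obtain ⟨C, h0, hC⟩ := h 0
  obtain ⟨D, h1, hD⟩ := h 4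
  exact ⟨C + D, add_nonneg h0 h1, fun n x hx =>
    le_decay (by simpa using hC n x hx) (hD n x hx) h0 h1⟩

namespace DbarModes

variable {b : (Fin 3 → ℤ) → V3 → ℂ} {f : Fin 3 → C3 → ℂ}

/-- The mode equations have coefficients independent of `y`, so they are preserved by `∂/∂y_j`; the
factor `2πi n_j` costs one power of `‖n‖` in the decay. This drives the induction on smoothness. -/
theorem derivY (h : DbarModes b f) (j : Fin 3) :
    DbarModes (derivY j b) fun k p => fderivWithin ℝ (f k) tube p (ey j) where
  smooth k := (h.smooth k).fderivWithin_apply (ey j)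
  deriv n x hx := by
    refine ((h.deriv n x hx).const_mul (2 * Real.pi * Complex.I * n j)).congr_fderiv
      (eq_oneForm fun k => ?_)
    rw [smul_apply, oneForm_single, coef_fderiv_snd (h.smooth k) n hx, CYTube.derivY, smul_eq_mul]
    ring
  rapid N := by
    obtain ⟨C, h0, hC⟩ := h.rapid (N + 1)
    refine ⟨2 * Real.pi * C, by positivity, fun n x hx => ?_⟩
    have h1 : ‖(2 * Real.pi * Complex.I * n j : ℂ)‖ ≤ 2 * Real.pi * ‖n‖ := by
      have : ‖(2 * Real.pi * Complex.I * n j : ℂ)‖ = 2 * Real.pi * ‖n j‖ := by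
        simp [abs_of_pos Real.pi_pos, Int.norm_eq_abs]
      rw [this]
      exact mul_le_mul_of_nonneg_left (norm_le_pi_norm n j) (by positivity)
    calc ‖n‖ ^ N * ‖CYTube.derivY j b n x‖
        = ‖(2 * Real.pi * Complex.I * n j : ℂ)‖ * (‖n‖ ^ N * ‖b n x‖) := by
          rw [CYTube.derivY, norm_mul]; ring
      _ ≤ 2 * Real.pi * ‖n‖ * (‖n‖ ^ N * ‖b n x‖) :=
          mul_le_mul_of_nonneg_right h1 (by positivity)
      _ = 2 * Real.pi * (‖n‖ ^ (N + 1) * ‖b n x‖) := by ring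
      _ ≤ 2 * Real.pi * C := mul_le_mul_of_nonneg_left (hC n x hx) (by positivity)

theorem hasSum_synth (h : DbarModes b f) {p : C3} (hp : p ∈ tube) :
    HasSum (fun n => b n p.1 * char n p.2) (synth b p) := by
  obtain ⟨C, h0, hC⟩ := exists_decay_bound h.rapid
  refine (Summable.of_norm_bounded (summable_decay.mul_left C) fun n => ?_).hasSum
  rw [norm_mul, norm_char, mul_one]
  exact hC n _ hp.1

theorem continuousOn_synth (h : DbarModes b f) : ContinuousOn (synth b) tube := by
  obtain ⟨C, h0, hC⟩ := exists_decay_bound h.rapid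
  refine continuousOn_tsum (fun n => ?_) (summable_decay.mul_left C) fun n p hp => ?_
  · refine ContinuousOn.mul ?_ ((contDiff_char n).continuous.comp continuous_snd).continuousOn
    exact ContinuousOn.comp (fun x hx => (h.deriv n x hx).continuousWithinAt)
      continuous_fst.continuousOn fun p hp => hp.1
  · rw [norm_mul, norm_char, mul_one]
    exact hC n _ hp.1

end DbarModes

/-- The real-linear form `∑ cⱼ dxⱼ + ∑ dⱼ dyⱼ`, as a linear function of its coefficients. -/
def oneFormXY : (Fin 3 → ℂ) × (Fin 3 → ℂ) →L[ℝ] C3 →L[ℝ] ℂ :=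
  LinearMap.toContinuousLinearMap
    { toFun := fun c => oneFormL c.1 ∘L ContinuousLinearMap.fst ℝ V3 V3 +
        oneFormL c.2 ∘L ContinuousLinearMap.snd ℝ V3 V3
      map_add' := fun a b => by ext v <;> simp
      map_smul' := fun c a => by ext v <;> simp }

theorem oneFormXY_apply (c : (Fin 3 → ℂ) × (Fin 3 → ℂ)) (v : C3) :
    oneFormXY c v = oneForm c.1 v.1 + oneForm c.2 v.2 := rfl

theorem eq_oneFormXY {L : C3 →L[ℝ] ℂ} {c d : Fin 3 → ℂ} (h1 : ∀ j, L (ex j) = c j)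
    (h2 : ∀ j, L (ey j) = d j) : L = oneFormXY (c, d) := by
  have e1 : L ∘L ContinuousLinearMap.inl ℝ V3 V3 = oneForm c := eq_oneForm h1
  have e2 : L ∘L ContinuousLinearMap.inr ℝ V3 V3 = oneForm d := eq_oneForm h2
  refine ContinuousLinearMap.ext fun v => ?_
  rw [oneFormXY_apply, ← e1, ← e2]
  simp [← map_add]

namespace DbarModes

variable {b : (Fin 3 → ℤ) → V3 → ℂ} {f : Fin 3 → C3 → ℂ}

/-- By the mode equation the `xₖ`-derivatives of the terms sum to `2 fₖ - i ∂u/∂yₖ`. They are thus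
controlled by `f` and the `y`-derivatives, and no separate estimate in `x` is needed. -/
theorem hasSum_deriv (h : DbarModes b f) {p : C3} (hp : p ∈ tube) :
    HasSum (fun n => oneFormXY (fun k => (wt n k * b n p.1 + 2 * coef (f k) n p.1) * char n p.2,
        fun k => CYTube.derivY k b n p.1 * char n p.2))
      (oneFormXY (fun k => 2 * f k p - Complex.I * synth (CYTube.derivY k b) p,
        fun k => synth (CYTube.derivY k b) p)) := by
  refine oneFormXY.hasSum (HasSum.prodMk (Pi.hasSum.2 fun k => ?_)
    (Pi.hasSum.2 fun k => (h.derivY k).hasSum_synth hp))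
  refine (((hasSum_coef (h.smooth k) hp).mul_left 2).sub
    (((h.derivY k).hasSum_synth hp).mul_left Complex.I)).congr_fun fun n => ?_
  rw [wt, CYTube.derivY]
  linear_combination (2 * (Real.pi : ℂ) * n k * b n p.1 * char n p.2) * Complex.I_mul_I

theorem hasFDerivWithinAt_synth (h : DbarModes b f) {p : C3} (hp : p ∈ tube) :
    HasFDerivWithinAt (synth b)
      (oneFormXY (fun k => 2 * f k p - Complex.I * synth (CYTube.derivY k b) p,
        fun k => synth (CYTube.derivY k b) p)) tube p := by
  refine hasFDerivWithinAt_of_interior (f' := fun p =>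
      oneFormXY (fun k => 2 * f k p - Complex.I * synth (CYTube.derivY k b) p,
        fun k => synth (CYTube.derivY k b) p)) convex_tube
    (Metric.isClosed_closedBall.prod isClosed_univ) ⟨0, zero_mem_interior_tube⟩
    h.continuousOn_synth ?_ ?_ hp
  · refine oneFormXY.continuous.comp_continuousOn ((continuousOn_pi.2 fun k => ?_).prodMk
      (continuousOn_pi.2 fun k => (h.derivY k).continuousOn_synth))
    exact (continuousOn_const.mul (h.smooth k).continuousOn).sub
      (continuousOn_const.mul (h.derivY k).continuousOn_synth)
  intro p hp
  have hpt := interior_subset hp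
  rw [← (h.hasSum_deriv hpt).tsum_eq]
  choose C hC0 hC using fun k => exists_decay_bound (h.derivY k).rapid
  choose D hD0 hD using fun k => exists_decay_bound (b := coef (f k)) (coef_decay (h.smooth k))
  let B : ℝ := ∑ k, (C k + 2 * D k)
  have hB : ∀ k, C k + 2 * D k ≤ B := fun k => Finset.single_le_sum
    (f := fun k => C k + 2 * D k) (fun k _ => by linarith [hC0 k, hD0 k]) (Finset.mem_univ k)
  have hdec : ∀ n, 0 ≤ decay n := fun n => by
    unfold decay; split_ifs <;> positivity
  -- Termwise differentiation in the open tube, with a summable majorant; the extension to the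
  -- boundary is the earlier `hasFDerivWithinAt_of_interior`.
  refine hasFDerivAt_tsum_of_isPreconnected (s := interior tube)
    (u := fun n => ‖oneFormXY‖ * (B * decay n)) ((summable_decay.mul_left B).mul_left _)
    isOpen_interior convex_tube.interior.isPreconnected ?_ ?_ hp (h.hasSum_synth hpt).summable hp
    (f := fun n p => b n p.1 * char n p.2)
    (f' := fun n p => oneFormXY (fun k => (wt n k * b n p.1 + 2 * coef (f k) n p.1) * char n p.2,
        fun k => CYTube.derivY k b n p.1 * char n p.2))
  · intro n q hq
    have h1 : HasFDerivAt (b n) _ q.1 := (h.deriv n q.1 (interior_subset hq).1).hasFDerivAt (by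
      rw [interior_tube] at hq
      rw [← mem_interior_iff_mem_nhds, interior_ball3]
      exact hq.1)
    have h2 := (h1.comp q hasFDerivAt_fst).mul ((hasFDerivAt_char n q.2).comp q hasFDerivAt_snd)
    refine h2.congr_fderiv (eq_oneFormXY (fun j => ?_) fun j => ?_)
    · have h3 := oneForm_single (fun k => wt n k * b n q.1 + 2 * coef (f k) n q.1) j
      simp only [add_apply, smul_apply, ContinuousLinearMap.comp_apply, ex,
        ContinuousLinearMap.coe_fst', ContinuousLinearMap.coe_snd', map_zero, smul_eq_mul, mul_zero,
        zero_add, h3, Function.comp]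
      ring
    · have h3 := oneForm_single (fun k => 2 * Real.pi * Complex.I * n k * char n q.2) j
      rw [oneForm] at h3
      simp only [add_apply, smul_apply, ContinuousLinearMap.comp_apply, ey,
        ContinuousLinearMap.coe_fst', ContinuousLinearMap.coe_snd', map_zero, smul_eq_mul, mul_zero,
        add_zero, h3, Function.comp, CYTube.derivY]
      ring
  · intro n q hq
    have hq1 := (interior_subset hq).1
    -- `2πnₖ` and `2πi nₖ` have the same modulus, so the bound for the `y`-derivative also serves
    -- for this part of the `x`-derivative.
    have hwd : ∀ k, ‖wt n k * b n q.1‖ = ‖CYTube.derivY k b n q.1‖ := fun k => by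
      simp [wt, CYTube.derivY]
    refine (oneFormXY.le_opNorm _).trans (mul_le_mul_of_nonneg_left ?_ (norm_nonneg _))
    have h0 : 0 ≤ B * decay n := mul_nonneg
      (Finset.sum_nonneg fun k _ => by linarith [hC0 k, hD0 k]) (hdec n)
    refine max_le ((pi_norm_le_iff_of_nonneg h0).2 fun k => ?_)
      ((pi_norm_le_iff_of_nonneg h0).2 fun k => ?_)
    · rw [norm_mul, norm_char, mul_one]
      refine (norm_add_le _ _).trans ?_
      rw [hwd, norm_mul, Complex.norm_two]
      have h1 := hC k n q.1 hq1
      have h2 := hD k n q.1 hq1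
      have h3 := mul_le_mul_of_nonneg_right (hB k) (hdec n)
      linarith
    · rw [norm_mul, norm_char, mul_one]
      have h1 := hC k n q.1 hq1
      have h3 := mul_le_mul_of_nonneg_right (hB k) (hdec n)
      nlinarith [hD0 k, hdec n]

/-- Bootstrapping: the derivative of `synth b` is built from the smooth `f` and from `synth (derivY
k b)`, which satisfies the same hypotheses. For this reason the induction quantifies over all `b`
and `f`. -/
theorem contDiffOn_synth_nat (k : ℕ) : ∀ {b : (Fin 3 → ℤ) → V3 → ℂ} {f : Fin 3 → C3 → ℂ},
    DbarModes b f → ContDiffOn ℝ k (synth b) tube := by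
  induction k with
  | zero => exact fun h => contDiffOn_zero.2 h.continuousOn_synth
  | succ k ih =>
    intro b f h
    have hk : ((k : ℕ) : WithTop ℕ∞) ≠ ⊤ := by simp
    rw [Nat.cast_succ]
    refine (contDiffOn_succ_iff_hasFDerivWithinAt (by simp)).2 fun p hp =>
      ⟨tube, ?_, fun h => absurd h hk, _, fun q hq => h.hasFDerivWithinAt_synth hq, ?_⟩
    · rw [insert_eq_of_mem hp]
      exact self_mem_nhdsWithin
    · refine oneFormXY.contDiff.comp_contDiffOn ((contDiffOn_pi.2 fun j => ?_).prodMk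
        (contDiffOn_pi.2 fun j => ih (h.derivY j)))
      exact (contDiffOn_const.mul ((h.smooth j).contDiffOn.of_le (by exact_mod_cast le_top))).sub
        (contDiffOn_const.mul (ih (h.derivY j)))

theorem smoothPer_synth (h : DbarModes b f) : SmoothPer (synth b) where
  contDiffOn := contDiffOn_infty.2 fun k => contDiffOn_synth_nat k h
  periodic p n := by
    have e : p + latt n = (p.1, p.2 + lattV n) := by
      simp [latt, lattV, Prod.ext_iff]
    simp only [synth, e, char_add_lattV]

theorem dbar_synth (h : DbarModes b f) {p : C3} (hp : p ∈ tube) (k : Fin 3) :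
    dbar k (synth b) p = f k p := by
  have e := oneForm_single
  rw [dbar, (h.hasFDerivWithinAt_synth hp).fderivWithin (uniqueDiffOn_tube p hp),
    oneFormXY_apply, oneFormXY_apply]
  simp only [ex, ey, map_zero, add_zero, zero_add, e]
  ring

end DbarModes

theorem norm_eq_one_iff_mem {x y : V3} : (x, y) ∈ tubeBdry ↔ ‖x‖ = 1 := by simp [tubeBdry]

theorem coef_parallel {f : Fin 3 → C3 → ℂ}
    (hb : ∀ p ∈ tubeBdry, ∀ k l, p.1 l * f k p = p.1 k * f l p) (n : Fin 3 → ℤ) {x : V3}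
    (hx : ‖x‖ = 1) (k l : Fin 3) : x l * coef (f k) n x = x k * coef (f l) n x := by
  rw [← coef_const_mul, ← coef_const_mul]
  simp only [coef]
  congr 1
  funext y
  exact hb (x, y) (norm_eq_one_iff_mem.2 hx) k l

/-- The `∂̄`-equation on `B³ × T³` with zero boundary values: a `∂̄`-closed form whose tangential part
vanishes on the boundary is `∂̄u` for a function `u` that vanishes on the boundary. -/
theorem exists_dbar_eq {f : Fin 3 → C3 → ℂ} (hf : ∀ k, SmoothPer (f k))
    (hcl : ∀ p ∈ tube, ∀ k l, dbar l (f k) p = dbar k (f l) p)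
    (hb : ∀ p ∈ tubeBdry, ∀ k l, p.1 l * f k p = p.1 k * f l p) :
    ∃ u, SmoothPer u ∧ (∀ p ∈ tube, ∀ k, dbar k u p = f k p) ∧ ∀ p ∈ tubeBdry, u p = 0 := by
  have hbound : ∀ n, ∀ M : ℝ, (∀ k, ∀ x ∈ ball3, ‖coef (f k) n x‖ ≤ M) →
      ∃ b : V3 → ℂ, (∀ x ∈ ball3, HasFDerivWithinAt b
        (oneForm fun k => wt n k * b x + 2 * coef (f k) n x) ball3 x) ∧
      (∀ x : V3, ‖x‖ = 1 → b x = 0) ∧ ∀ x ∈ ball3, ‖b x‖ ≤ 6 * (2 * M) := by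
    intro n M hM
    refine exists_mode n (c := fun k x => 2 * coef (f k) n x)
      (d := fun k j x => 2 * coef (fun p => fderivWithin ℝ (f k) tube p (ex j)) n x)
      (fun k x hx => ?_) (fun k j x hx => ?_) (fun x hx k l => ?_) fun k x hx => ?_
    · refine ((hasFDerivWithinAt_coef (hf k) n hx).const_mul 2).congr_fderiv
        (eq_oneForm fun j => ?_)
      rw [smul_apply, oneForm_single, smul_eq_mul]
    · rw [coef_fderiv_fst (hf k) n hx, coef_fderiv_fst (hf j) n hx,
        coef_congr (fun p hp => hcl p hp k j) n hx, wt, wt]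
      ring
    · linear_combination 2 * coef_parallel hb n hx k l
    · rw [norm_mul, Complex.norm_two]
      exact mul_le_mul_of_nonneg_left (hM k x hx) (by norm_num)
  -- The solution in `hbound` may depend on `M`, whereas rapid decay needs one `b` for all orders
  -- `N`. Taking for `M` the largest supremum of the coefficients gives a `b` that obeys the
  -- estimate for every admissible `M`.
  have hsup : ∀ n, ∃ b : V3 → ℂ, (∀ x ∈ ball3, HasFDerivWithinAt b
        (oneForm fun k => wt n k * b x + 2 * coef (f k) n x) ball3 x) ∧
      (∀ x : V3, ‖x‖ = 1 → b x = 0) ∧ ∀ M : ℝ, (∀ k, ∀ x ∈ ball3, ‖coef (f k) n x‖ ≤ M) →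
        ∀ x ∈ ball3, ‖b x‖ ≤ 6 * (2 * M) := by
    intro n
    have hbdd : ∀ k, BddAbove ((fun x => ‖coef (f k) n x‖) '' ball3) := fun k =>
      ((isCompact_closedBall 0 1).image_of_continuousOn (continuousOn_coef (hf k) n).norm).bddAbove
    obtain ⟨k₀, hk₀⟩ := Finite.exists_max fun k => sSup ((fun x => ‖coef (f k) n x‖) '' ball3)
    obtain ⟨b, h1, h2, h3⟩ := hbound n (sSup ((fun x => ‖coef (f k₀) n x‖) '' ball3))
      fun k x hx => (le_csSup (hbdd k) (mem_image_of_mem _ hx)).trans (hk₀ k)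
    refine ⟨b, h1, h2, fun M hM x hx => (h3 x hx).trans ?_⟩
    have : sSup ((fun x => ‖coef (f k₀) n x‖) '' ball3) ≤ M :=
      csSup_le (Nonempty.image _ ⟨0, by simp⟩) (by
        rintro _ ⟨z, hz, rfl⟩
        exact hM k₀ z hz)
    linarith
  choose b h1 h2 h3 using hsup
  have h : DbarModes b f := by
    refine ⟨hf, h1, fun N => ?_⟩
    choose C hC0 hC using fun k => coef_decay (hf k) N
    -- `12 = 6 · 2`: the 6 of `exists_mode`, and the 2 from `cₖ = 2 coef (f k) n`.
    refine ⟨12 * ∑ k, C k, mul_nonneg (by norm_num) (Finset.sum_nonneg fun k _ => hC0 k),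
      fun n x hx => ?_⟩
    have hS : ∀ k, C k ≤ ∑ k, C k := fun k =>
      Finset.single_le_sum (fun k _ => hC0 k) (Finset.mem_univ k)
    by_cases hn : ‖n‖ ^ N = 0
    · rw [hn, zero_mul]
      exact mul_nonneg (by norm_num) (Finset.sum_nonneg fun k _ => hC0 k)
    · have hpos : 0 < ‖n‖ ^ N := lt_of_le_of_ne (by positivity) (Ne.symm hn)
      have := h3 n ((∑ k, C k) / ‖n‖ ^ N) (fun k x hx => by
        rw [le_div_iff₀ hpos, mul_comm]
        exact (hC k n x hx).trans (hS k)) x hx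
      calc ‖n‖ ^ N * ‖b n x‖ ≤ ‖n‖ ^ N * (6 * (2 * ((∑ k, C k) / ‖n‖ ^ N))) :=
            mul_le_mul_of_nonneg_left this hpos.le
        _ = 12 * ∑ k, C k := by field_simp; ring
  refine ⟨synth b, h.smoothPer_synth, fun p hp k => h.dbar_synth hp k, fun p hp => ?_⟩
  simp only [synth, h2 _ p.1 (norm_of_mem hp), zero_mul, tsum_zero]

/-- A holomorphic function on `B³ × T³` that vanishes on the boundary is zero. -/
theorem eq_zero_of_dbar_eq_zero {f : C3 → ℂ} (hf : SmoothPer f)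
    (hd : ∀ p ∈ tube, ∀ k, dbar k f p = 0) (hb : ∀ p ∈ tubeBdry, f p = 0) {p : C3}
    (hp : p ∈ tube) : f p = 0 := by
  refine eq_zero_of_coef hf (fun n x hx => ?_) hp
  -- Each coefficient is a constant multiple of `e^{2πn·x}`, so its vanishing at one boundary point
  -- suffices.
  have hder : ∀ x ∈ ball3, HasFDerivWithinAt (fun x => cexpL (-wt n) x * coef f n x)
      (0 : V3 →L[ℝ] ℂ) ball3 x := by
    intro x hx
    refine ((hasFDerivAt_cexpL (-wt n) x).hasFDerivWithinAt.mul
      (hasFDerivWithinAt_coef hf n hx)).congr_fderiv ?_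
    have h0 : (0 : V3 →L[ℝ] ℂ) = oneForm fun _ => 0 := eq_oneForm fun j => rfl
    rw [h0]
    refine eq_oneForm fun j => ?_
    rw [add_apply, smul_apply, smul_apply, oneForm_single, oneForm_single,
      coef_fderiv_fst hf n hx, coef_congr (g := fun _ => 0) (fun p hp => hd p hp j) n hx]
    have : coef (fun _ => 0) n x = 0 := by simp [coef, fcoef]
    rw [this]
    simp only [smul_eq_mul, Pi.neg_apply, wt]
    ring
  have hx₁ : (EuclideanSpace.single 0 1 : V3) ∈ ball3 := by simp
  have hconst := (convex_closedBall (0 : V3) 1).is_const_of_fderivWithin_eq_zero (𝕜 := ℝ)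
    (fun x hx => (hder x hx).differentiableWithinAt)
    (fun x hx => (hder x hx).fderivWithin
      ((uniqueDiffOn_convex (convex_closedBall 0 1) interior_ball3_nonempty) x hx)) hx hx₁
  have hz : coef f n (EuclideanSpace.single 0 1) = 0 := by
    have : ∀ y, f (EuclideanSpace.single 0 1, y) = 0 := fun y =>
      hb _ (norm_eq_one_iff_mem.2 (by simp))
    simp [coef, fcoef, this]
  beta_reduce at hconst
  rw [hz, mul_zero] at hconst
  exact (mul_eq_zero.1 hconst).resolve_left (Complex.exp_ne_zero _)

end

/-! ### Complex 3-forms of types (3,0) and (2,1), and the operator `J`. -/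

noncomputable section

/-- Complex-valued real alternating `3`-forms on `ℂ³`. -/
abbrev CAlt3 : Type := C3 [⋀^Fin 3]→L[ℝ] ℂ

namespace CAlt3

variable (T : CAlt3)

theorem swap01 (a b c : C3) : T ![a, b, c] = -T ![b, a, c] := by
  rw [show -T ![b, a, c] = T (![b, a, c] ∘ Equiv.swap (0 : Fin 3) 1) from
    (T.toAlternatingMap.map_swap ![b, a, c] (i := 0) (j := 1) (by decide)).symm]
  congr 1; funext i; fin_cases i <;> rfl

theorem swap12 (a b c : C3) : T ![a, b, c] = -T ![a, c, b] := by
  rw [show -T ![a, c, b] = T (![a, c, b] ∘ Equiv.swap (1 : Fin 3) 2) from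
    (T.toAlternatingMap.map_swap ![a, c, b] (i := 1) (j := 2) (by decide)).symm]
  congr 1; funext i; fin_cases i <;> rfl

theorem self01 (a c : C3) : T ![a, a, c] = 0 := self_eq_neg.1 (swap01 T a a c)

theorem self12 (a b : C3) : T ![a, b, b] = 0 := self_eq_neg.1 (swap12 T a b b)

theorem self02 (a b : C3) : T ![a, b, a] = 0 := by rw [swap12, self01, neg_zero]

theorem lin0 (u v b c : C3) (s : ℝ) :
    T ![u + s • v, b, c] = T ![u, b, c] + s * T ![v, b, c] := by
  have e : ∀ x : C3, T ![x, b, c] = T.curryLeft x ![b, c] := fun x => rfl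
  rw [e, e, e, map_add, map_smul]
  simp

theorem lin1 (a u v c : C3) (s : ℝ) :
    T ![a, u + s • v, c] = T ![a, u, c] + s * T ![a, v, c] := by
  rw [swap01, lin0, swap01 T u, swap01 T v]; ring

theorem lin2 (a b u v : C3) (s : ℝ) :
    T ![a, b, u + s • v] = T ![a, b, u] + s * T ![a, b, v] := by
  rw [swap12, lin1, swap12 T a u, swap12 T a v]; ring

theorem neg0 (a b c : C3) : T ![-a, b, c] = -T ![a, b, c] := by
  have e : ∀ x : C3, T ![x, b, c] = T.curryLeft x ![b, c] := fun x => rfl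
  rw [e, e, map_neg]
  rfl

theorem neg1 (a b c : C3) : T ![a, -b, c] = -T ![a, b, c] := by
  rw [swap01, neg0, swap01 T a b]

theorem neg2 (a b c : C3) : T ![a, b, -c] = -T ![a, b, c] := by
  rw [swap12, neg1, swap12 T a b]

/-- The form lies in `Ω^{3,0} ⊕ Ω^{2,1}`: it vanishes on pairs of vectors of type `(0,1)`. -/
def IsF2 : Prop := ∀ a b c : C3, T ![a, b, c] - T ![cplx a, cplx b, c] +
  Complex.I * (T ![cplx a, b, c] + T ![a, cplx b, c]) = 0

variable {T}

/-- Alternation carries the condition on the first two arguments to any other pair. -/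
theorem IsF2.pair12 (h : IsF2 T) (a b c : C3) : T ![a, b, c] - T ![a, cplx b, cplx c] +
    Complex.I * (T ![a, cplx b, c] + T ![a, b, cplx c]) = 0 := by
  have e : ∀ a b c, T ![a, b, c] = T ![b, c, a] := fun a b c => by
    rw [swap01, swap12, neg_neg]
  rw [e a b c, e a (cplx b) (cplx c), e a (cplx b) c, e a b (cplx c)]
  exact h b c a

theorem IsF2.pair02 (h : IsF2 T) (a b c : C3) : T ![a, b, c] - T ![cplx a, b, cplx c] +
    Complex.I * (T ![cplx a, b, c] + T ![a, b, cplx c]) = 0 := by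
  rw [swap12 T a b c, swap12 T (cplx a) b (cplx c), swap12 T (cplx a) b c,
    swap12 T a b (cplx c)]
  linear_combination -h a c b

end CAlt3

theorem eq_zero_of_basis {F : C3 → ℂ} (hF : ∀ u v : C3, ∀ s : ℝ, F (u + s • v) = F u + s * F v)
    (hx : ∀ k, F (ex k) = 0) (hy : ∀ k, F (ey k) = 0) (v : C3) : F v = 0 := by
  have h0 : F 0 = 0 := by
    have := hF 0 0 1
    simpa using this
  have hs : ∀ (s : ℝ) v, F (s • v) = s * F v := fun s v => by
    have := hF 0 v s
    rwa [zero_add, h0, zero_add] at this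
  have ha : ∀ u v, F (u + v) = F u + F v := fun u v => by simpa using hF u v 1
  have e : v = (v.1 0 • ex 0 + v.1 1 • ex 1 + v.1 2 • ex 2) +
      (v.2 0 • ey 0 + v.2 1 • ey 1 + v.2 2 • ey 2) := by
    refine Prod.ext ?_ ?_
    · conv_lhs => rw [V3_eq_sum v.1, Fin.sum_univ_three]
      simp [ex, ey]
    · conv_lhs => rw [V3_eq_sum v.2, Fin.sum_univ_three]
      simp [ex, ey]
  rw [e]
  simp only [ha, hs, hx, hy, mul_zero, add_zero]

theorem cplx_ex (k : Fin 3) : cplx (ex k) = ey k := by simp [cplx, ex, ey]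

theorem cplx_ey (k : Fin 3) : cplx (ey k) = -ex k := by
  rw [← cplx_ex, cplx_cplx]

/-- The complex `3`-form `ρ + iJρ`, that is, twice the part of `ρ` in `Ω^{3,0} ⊕ Ω^{2,1}`. -/
def hodgePart (r : Alt 3) : CAlt3 :=
  Complex.ofRealCLM.compContinuousAlternatingMap r +
    Complex.I • Complex.ofRealCLM.compContinuousAlternatingMap (opJ r)

theorem hodgePart_apply (r : Alt 3) (v : Fin 3 → C3) :
    hodgePart r v = (r v : ℂ) + Complex.I * (opJ r v : ℂ) := rfl

/-- Since `J` is `-i` on types (3,0), (2,1) and `i` on the others, `1 + iJ` is 2 on the former and 0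
on the latter. -/
theorem isF2_hodgePart (r : Alt 3) : CAlt3.IsF2 (hodgePart r) := by
  intro a b c
  have n0 := fun a b c => (alt3_neg r a b c).1
  have n1 := fun a b c => (alt3_neg r a b c).2.1
  simp only [hodgePart_apply, opJ_apply, cplx_cplx, n0, n1]
  push_cast
  linear_combination (r ![a, b, c] - r ![cplx a, cplx b, c] : ℂ) * Complex.I_mul_I

/-- For a form in `Ω^{3,0} ⊕ Ω^{2,1}`, the operator `J` maps the real part to the imaginary part. -/
theorem hodgePart_re {T : CAlt3} (hT : CAlt3.IsF2 T) {r : Alt 3}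
    (hr : ∀ a b c, r ![a, b, c] = (T ![a, b, c]).re) (a b c : C3) :
    opJ r ![a, b, c] = (T ![a, b, c]).im := by
  have h1 := hT a b c
  have h2 := hT.pair12 a b c
  have h3 := hT.pair02 a b c
  have k1 := hT a b (cplx c)
  have k2 := hT.pair12 (cplx a) b c
  have k3 := hT.pair02 a (cplx b) c
  -- This is `JT = -iT`. It is the sum of the type conditions over the three pairs of arguments,
  -- taken at `(a,b,c)` and again with `I` applied to the remaining argument.
  have key : T ![cplx a, b, c] + T ![a, cplx b, c] + T ![a, b, cplx c] +
      T ![cplx a, cplx b, cplx c] = 2 * Complex.I * T ![a, b, c] := by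
    linear_combination (-1 / 3 : ℂ) * (k1 + k2 + k3) - (2 / 3) * Complex.I * (h1 + h2 + h3) +
      (4 / 3 * (T ![cplx a, b, c] + T ![a, cplx b, c] + T ![a, b, cplx c])) * Complex.I_mul_I
  rw [opJ_apply, hr, hr, hr, hr, ← Complex.add_re, ← Complex.add_re, ← Complex.add_re, key]
  simp

end

/-! ### The components of `ρ + iJρ`: closedness, boundary behaviour, Lie derivatives. -/

noncomputable section

theorem hasFDerivWithinAt_form {k : ℕ} (τ : FormZ k) {p : C3} (hp : p ∈ tube) (v : Fin k → C3) :
    HasFDerivWithinAt (fun q => τ.1 q v) (fderivWithin ℝ (fun q => τ.1 q v) tube p) tube p :=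
  ((contDiffOn_alt_apply (v := fun i _ => v i) τ.2.1 fun i => contDiffOn_const).differentiableOn
    (by simp) p hp).hasFDerivWithinAt

theorem dZ_three_apply (τ : FormZ 3) {p : C3} (hp : p ∈ tube) (a b c d : C3) :
    (dZ 3 τ).1 p ![a, b, c, d] = fderivWithin ℝ (fun q => τ.1 q ![b, c, d]) tube p a -
      fderivWithin ℝ (fun q => τ.1 q ![a, c, d]) tube p b +
      fderivWithin ℝ (fun q => τ.1 q ![a, b, d]) tube p c -
      fderivWithin ℝ (fun q => τ.1 q ![a, b, c]) tube p d := by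
  change tube.indicator (extDerivWithin τ.1 tube) p _ = _
  rw [indicator_of_mem hp, extDerivWithin_apply (FormZ_diff τ hp) (uniqueDiffOn_tube p hp),
    Fin.sum_univ_four, (removeNth_four _).1, (removeNth_four _).2.1, (removeNth_four _).2.2.1,
    (removeNth_four _).2.2.2]
  simp
  ring

theorem dZ_two_apply (τ : FormZ 2) {p : C3} (hp : p ∈ tube) (a b c : C3) :
    (dZ 2 τ).1 p ![a, b, c] = fderivWithin ℝ (fun q => τ.1 q ![b, c]) tube p a -
      fderivWithin ℝ (fun q => τ.1 q ![a, c]) tube p b +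
      fderivWithin ℝ (fun q => τ.1 q ![a, b]) tube p c := by
  change tube.indicator (extDerivWithin τ.1 tube) p _ = _
  rw [indicator_of_mem hp, extDerivWithin_apply (FormZ_diff τ hp) (uniqueDiffOn_tube p hp),
    Fin.sum_univ_three, (removeNth_three _).1, (removeNth_three _).2.1, (removeNth_three _).2.2]
  simp
  ring

theorem dZ_dZ {k : ℕ} (τ : FormZ k) : dZ (k + 1) (dZ k τ) = 0 := by
  apply Subtype.ext
  funext p
  by_cases hp : p ∈ tube
  · change tube.indicator (extDerivWithin (tube.indicator (extDerivWithin τ.1 tube)) tube) p = 0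
    rw [indicator_of_mem hp, extDerivWithin_congr' (fun q hq => indicator_of_mem hq _) hp]
    refine extDerivWithin_extDerivWithin_apply (r := ∞) (τ.2.1 p hp) (by simpa using two_le_inf)
      uniqueDiffOn_tube ?_ hp
    rw [convex_tube.closure_interior_eq_closure_of_nonempty_interior ⟨0, zero_mem_interior_tube⟩]
    exact subset_closure hp
  · exact (dZ (k + 1) (dZ k τ)).2.2.2 p hp

/-- The components of the form `ρ + iJρ`. -/
def sigma (ρ : FormZ 3) (a b c p : C3) : ℂ := hodgePart (ρ.1 p) ![a, b, c]

theorem sigma_eq (ρ : FormZ 3) (a b c : C3) : sigma ρ a b c = fun p =>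
    (ρ.1 p ![a, b, c] : ℂ) + Complex.I * ((JZ ρ).1 p ![a, b, c] : ℂ) := rfl

theorem smoothPer_sigma (ρ : FormZ 3) (a b c : C3) : SmoothPer (sigma ρ a b c) where
  contDiffOn := (Complex.ofRealCLM.contDiff.comp_contDiffOn (contDiffOn_alt3 ρ.2.1 a b c)).add
    (contDiffOn_const.mul
      (Complex.ofRealCLM.contDiff.comp_contDiffOn (contDiffOn_alt3 (JZ ρ).2.1 a b c)))
  periodic p n := by rw [sigma, sigma, ρ.2.2.1]

theorem fderivWithin_sigma (ρ : FormZ 3) (a b c v : C3) {p : C3} (hp : p ∈ tube) :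
    fderivWithin ℝ (sigma ρ a b c) tube p v =
      (fderivWithin ℝ (fun q => ρ.1 q ![a, b, c]) tube p v : ℂ) +
        Complex.I * (fderivWithin ℝ (fun q => (JZ ρ).1 q ![a, b, c]) tube p v : ℂ) := by
  have h := (Complex.ofRealCLM.hasFDerivAt.comp_hasFDerivWithinAt p
    (hasFDerivWithinAt_form ρ hp ![a, b, c])).add
    ((Complex.ofRealCLM.hasFDerivAt.comp_hasFDerivWithinAt p
      (hasFDerivWithinAt_form (JZ ρ) hp ![a, b, c])).const_mul Complex.I)
  have h' : HasFDerivWithinAt (sigma ρ a b c) _ tube p := h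
  rw [h'.fderivWithin (uniqueDiffOn_tube p hp)]
  simp

theorem sigma_closed {ρ : FormZ 3} (h : dZ 3 ρ = 0) (hJ : dZ 3 (JZ ρ) = 0) {p : C3}
    (hp : p ∈ tube) (a b c d : C3) : fderivWithin ℝ (sigma ρ b c d) tube p a -
      fderivWithin ℝ (sigma ρ a c d) tube p b + fderivWithin ℝ (sigma ρ a b d) tube p c -
      fderivWithin ℝ (sigma ρ a b c) tube p d = 0 := by
  have h1 := dZ_three_apply ρ hp a b c d
  have h2 := dZ_three_apply (JZ ρ) hp a b c d
  rw [h] at h1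
  rw [hJ] at h2
  change (0 : ℝ) = _ at h1 h2
  have h1' := congrArg (fun t : ℝ => (t : ℂ)) h1
  have h2' := congrArg (fun t : ℝ => (t : ℂ)) h2
  simp only [fderivWithin_sigma ρ _ _ _ _ hp]
  push_cast at h1' h2'
  linear_combination -h1' - Complex.I * h2'

/-- Differentiates the pointwise type condition `IsF2`. -/
theorem fderivWithin_eq_zero_of_comb {f₁ f₂ f₃ f₄ : C3 → ℂ} (h₁ : SmoothPer f₁)
    (h₂ : SmoothPer f₂) (h₃ : SmoothPer f₃) (h₄ : SmoothPer f₄)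
    (h : ∀ p ∈ tube, f₁ p - f₂ p + Complex.I * (f₃ p + f₄ p) = 0) {p : C3} (hp : p ∈ tube) (v : C3) :
    fderivWithin ℝ f₁ tube p v - fderivWithin ℝ f₂ tube p v +
      Complex.I * (fderivWithin ℝ f₃ tube p v + fderivWithin ℝ f₄ tube p v) = 0 := by
  have k := ((h₁.hasFDerivWithinAt hp).sub (h₂.hasFDerivWithinAt hp)).add
    (((h₃.hasFDerivWithinAt hp).add (h₄.hasFDerivWithinAt hp)).const_mul Complex.I)
  have k2 : HasFDerivWithinAt (fun _ : C3 => (0 : ℂ)) _ tube p :=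
    k.congr (fun q hq => (h q hq).symm) (h p hp).symm
  have k3 := (uniqueDiffOn_tube p hp).eq k2 (hasFDerivWithinAt_const (0 : ℂ) p tube)
  have k4 := DFunLike.congr_fun k3 v
  simpa [mul_add] using k4

/-- The coefficient of `ρ + iJρ` on `∂/∂z_{j+1}, ∂/∂z_{j+2}, ∂/∂z̄ₖ`. -/
def sigma21 (ρ : FormZ 3) (j k : Fin 3) (p : C3) : ℂ :=
  (1 / 2) * (sigma ρ (ex (j + 1)) (ex (j + 2)) (ex k) p +
    Complex.I * sigma ρ (ex (j + 1)) (ex (j + 2)) (ey k) p)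

theorem smoothPer_sigma21 (ρ : FormZ 3) (j k : Fin 3) : SmoothPer (sigma21 ρ j k) :=
  ((smoothPer_sigma ρ _ _ _).add ((smoothPer_sigma ρ _ _ _).const_mul Complex.I)).const_mul _

theorem fderivWithin_sigma21 (ρ : FormZ 3) (j k : Fin 3) {p : C3} (hp : p ∈ tube) (v : C3) :
    fderivWithin ℝ (sigma21 ρ j k) tube p v = (1 / 2) *
      (fderivWithin ℝ (sigma ρ (ex (j + 1)) (ex (j + 2)) (ex k)) tube p v +
        Complex.I * fderivWithin ℝ (sigma ρ (ex (j + 1)) (ex (j + 2)) (ey k)) tube p v) := by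
  have h := (((smoothPer_sigma ρ (ex (j + 1)) (ex (j + 2)) (ex k)).hasFDerivWithinAt hp).add
    (((smoothPer_sigma ρ (ex (j + 1)) (ex (j + 2)) (ey k)).hasFDerivWithinAt hp).const_mul
      Complex.I)).const_mul (1 / 2)
  have h' : HasFDerivWithinAt (sigma21 ρ j k) _ tube p := h
  rw [h'.fderivWithin (uniqueDiffOn_tube p hp)]
  simp
  ring

/-- Evaluate `d(ρ + iJρ) = 0` on `e_{j+1}, e_{j+2}, ∂/∂z̄ₖ, ∂/∂z̄_l`. The terms differentiated along
`e_{j+1}` and `e_{j+2}` contain both vectors of type (0,1) and vanish by type. What remains says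
that, for fixed `j`, the coefficients form a ∂̄-closed (0,1)-form. -/
theorem dbar_sigma21 {ρ : FormZ 3} (h : dZ 3 ρ = 0) (hJ : dZ 3 (JZ ρ) = 0) {p : C3}
    (hp : p ∈ tube) (j k l : Fin 3) :
    dbar l (sigma21 ρ j k) p = dbar k (sigma21 ρ j l) p := by
  simp only [dbar, fderivWithin_sigma21 ρ _ _ hp]
  have hz : ∀ b v : C3, fderivWithin ℝ (sigma ρ b (ex k) (ex l)) tube p v -
      fderivWithin ℝ (sigma ρ b (ey k) (ey l)) tube p v +
      Complex.I * (fderivWithin ℝ (sigma ρ b (ey k) (ex l)) tube p v +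
        fderivWithin ℝ (sigma ρ b (ex k) (ey l)) tube p v) = 0 := fun b v =>
    fderivWithin_eq_zero_of_comb (smoothPer_sigma ρ _ _ _) (smoothPer_sigma ρ _ _ _)
      (smoothPer_sigma ρ _ _ _) (smoothPer_sigma ρ _ _ _) (fun p _ => by
        have := (isF2_hodgePart (ρ.1 p)).pair12 b (ex k) (ex l)
        rwa [cplx_ex, cplx_ex] at this) hp v
  have c := fun u v => sigma_closed h hJ hp (ex (j + 1)) (ex (j + 2)) u v
  linear_combination (1 / 4 : ℂ) * (hz (ex (j + 2)) (ex (j + 1)) - hz (ex (j + 1)) (ex (j + 2))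
    - c (ex k) (ex l) + c (ey k) (ey l) - Complex.I * (c (ey k) (ex l) + c (ex k) (ey l)))
    + (1 / 4 : ℂ) * (fderivWithin ℝ (sigma ρ (ex (j + 1)) (ex (j + 2)) (ey k)) tube p (ey l) -
      fderivWithin ℝ (sigma ρ (ex (j + 1)) (ex (j + 2)) (ey l)) tube p (ey k)) * Complex.I_mul_I

/-- The outward normal vector `(x, 0)`. -/
def normalV (p : C3) : C3 := (p.1, 0)

theorem cplx_normalV {p : C3} (hp : p ∈ tubeBdry) : cplx (normalV p) = reeb p := by
  rw [reeb_eq hp]; simp [cplx, normalV]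

theorem exists_tangent_decomp {p : C3} (hp : p ∈ tubeBdry) (a : C3) :
    ∃ u ∈ tangentM p, ∃ s : ℝ, a = u + s • normalV p := by
  refine ⟨a - (inner ℝ p.1 a.1 : ℝ) • normalV p, ?_, inner ℝ p.1 a.1, by simp⟩
  change inner ℝ p.1 (a.1 - (inner ℝ p.1 a.1 : ℝ) • p.1) = 0
  rw [inner_sub_right, inner_smul_right, real_inner_self_eq_norm_sq, norm_of_mem hp]
  ring

/-- A form in `Ω^{3,0} ⊕ Ω^{2,1}` whose restriction to the boundary vanishes is zero on any two vectors and a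
vector of type `(0,1)` tangent to the boundary. -/
theorem F2_contact {T : CAlt3} (hT : CAlt3.IsF2 T) {p : C3} (hp : p ∈ tubeBdry)
    (h0 : ∀ a ∈ tangentM p, ∀ b ∈ tangentM p, ∀ c ∈ tangentM p, T ![a, b, c] = 0) (a b : C3)
    {t : C3} (ht : t ∈ tangentM p) (ht' : cplx t ∈ tangentM p) :
    T ![a, b, t] + Complex.I * T ![a, b, cplx t] = 0 := by
  obtain ⟨u, hu, s, rfl⟩ := exists_tangent_decomp hp a
  obtain ⟨v, hv, r, rfl⟩ := exists_tangent_decomp hp b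
  -- `I` maps the normal to the Reeb vector, which is tangent. In the type condition for the normal
  -- and `t` every term containing it vanishes by `h0`.
  have hN : ∀ c ∈ tangentM p, T ![normalV p, c, t] + Complex.I * T ![normalV p, c, cplx t] = 0 := by
    intro c hc
    have h := hT.pair02 (normalV p) c t
    rw [cplx_normalV hp, h0 _ (reeb_mem hp) _ hc _ ht', h0 _ (reeb_mem hp) _ hc _ ht] at h
    linear_combination h
  have hN' : T ![u, normalV p, t] + Complex.I * T ![u, normalV p, cplx t] = 0 := by
    rw [CAlt3.swap01, CAlt3.swap01 T u]
    linear_combination -hN u hu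
  simp only [CAlt3.lin0, CAlt3.lin1, CAlt3.self01, h0 u hu v hv t ht, h0 u hu v hv _ ht']
  linear_combination (s : ℂ) * hN v hv + (r : ℂ) * hN'

/-- The vector `x_l ∂/∂xₖ - xₖ ∂/∂x_l` and its image under `I` are tangent to `M`, so `F2_contact`
applies. The result is the boundary hypothesis of `exists_dbar_eq`. -/
theorem sigma21_parallel {ρ : FormZ 3} (h : restr 3 ρ = 0) (hJ : restr 3 (JZ ρ) = 0) {p : C3}
    (hp : p ∈ tubeBdry) (j k l : Fin 3) :
    (p.1 l : ℂ) * sigma21 ρ j k p = p.1 k * sigma21 ρ j l p := by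
  have h0 : ∀ a ∈ tangentM p, ∀ b ∈ tangentM p, ∀ c ∈ tangentM p,
      hodgePart (ρ.1 p) ![a, b, c] = 0 := by
    intro a ha b hb c hc
    rw [hodgePart_apply, apply_of_restr_eq_zero h hp ha hb hc]
    have := apply_of_restr_eq_zero hJ hp ha hb hc
    change opJ (ρ.1 p) ![a, b, c] = 0 at this
    rw [this]
    simp
  have hc : ∀ i, inner ℝ p.1 (EuclideanSpace.single i (1 : ℝ)) = p.1 i := fun i => by
    rw [EuclideanSpace.inner_single_right]; simp
  -- The summand `0` puts the vector into the shape `u + s • v` required by `CAlt3.lin2`.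
  have ht : (0 : C3) + p.1 l • ex k + (-p.1 k) • ex l ∈ tangentM p := by
    change inner ℝ p.1 (0 + p.1 l • EuclideanSpace.single k (1 : ℝ) +
      (-p.1 k) • EuclideanSpace.single l (1 : ℝ)) = 0
    rw [inner_add_right, inner_add_right, inner_smul_right, inner_smul_right, hc, hc,
      inner_zero_right]
    ring
  have e : cplx ((0 : C3) + p.1 l • ex k + (-p.1 k) • ex l) =
      (0 : C3) + p.1 l • ey k + (-p.1 k) • ey l := by
    rw [map_add, map_add, map_smul, map_smul, cplx_ex, cplx_ex, map_zero]
  have ht' : cplx ((0 : C3) + p.1 l • ex k + (-p.1 k) • ex l) ∈ tangentM p := by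
    rw [e]
    simp [tangentM, ey]
  have key := F2_contact (isF2_hodgePart (ρ.1 p)) hp h0 (ex (j + 1)) (ex (j + 2)) ht ht'
  have z : hodgePart (ρ.1 p) ![ex (j + 1), ex (j + 2), 0] = 0 :=
    (hodgePart (ρ.1 p)).map_coord_zero 2 rfl
  rw [e] at key
  simp only [CAlt3.lin2, z] at key
  simp only [sigma21, sigma]
  push_cast at key
  linear_combination (1 / 2 : ℂ) * key

/-- The derivation `T ↦ T(A·,·,·) + T(·,A·,·) + T(·,·,A·)` induced by a real-linear map maps `(3,0)`-forms to
`Ω^{3,0} ⊕ Ω^{2,1}`; here for the holomorphic volume form. -/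
def thetaDeriv (A : C3 →L[ℝ] C3) : CAlt3 :=
  ContinuousAlternatingMap.alternatizeUncurryFin (Theta.curryLeft ∘L A)

theorem thetaDeriv_apply (A : C3 →L[ℝ] C3) (a b c : C3) : thetaDeriv A ![a, b, c] =
    Theta ![A a, b, c] + Theta ![a, A b, c] + Theta ![a, b, A c] := by
  rw [thetaDeriv, ContinuousAlternatingMap.alternatizeUncurryFin_apply, Fin.sum_univ_three,
    (removeNth_three _).1, (removeNth_three _).2.1, (removeNth_three _).2.2]
  simp only [ContinuousLinearMap.comp_apply, ContinuousAlternatingMap.curryLeft_apply_apply]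
  have h1 := CAlt3.swap01 Theta (A b) a c
  have h2 := CAlt3.swap01 Theta (A c) a b
  have h3 := CAlt3.swap12 Theta a (A c) b
  change (-1 : ℤ) ^ 0 • Theta ![A a, b, c] + (-1 : ℤ) ^ 1 • Theta ![A b, a, c] +
    (-1 : ℤ) ^ 2 • Theta ![A c, a, b] = _
  rw [h1, h2, h3]
  simp

theorem Theta_cplx1 (a b c : C3) : Theta ![a, cplx b, c] = Complex.I * Theta ![a, b, c] := by
  rw [CAlt3.swap01, Theta_cplx, CAlt3.swap01 Theta a b]; ring

theorem Theta_cplx2 (a b c : C3) : Theta ![a, b, cplx c] = Complex.I * Theta ![a, b, c] := by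
  rw [CAlt3.swap12, Theta_cplx1, CAlt3.swap12 Theta a b]; ring

/-- Each summand replaces one argument and stays complex linear in the other two. Of two arguments
of type (0,1) at least one is left in place, and it kills the summand. -/
theorem isF2_thetaDeriv (A : C3 →L[ℝ] C3) : CAlt3.IsF2 (thetaDeriv A) := by
  intro a b c
  simp only [thetaDeriv_apply, Theta_cplx, Theta_cplx1]
  linear_combination (Theta ![A a, b, c] + Theta ![a, A b, c] + Theta ![a, b, A c]) *
    Complex.I_mul_I

theorem lieZ_constZ (r : Alt 3) (w : VField) :
    lieZ (constZ r) w = dZ 2 (interiorProd (constZ r) w) := by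
  have h : dZ 3 (constZ r) = 0 := dZ_constZ _
  rw [lieZ, h]
  apply Subtype.ext
  funext p
  simp [interiorProd]

theorem lieZ_constZ_apply (r : Alt 3) (w : VField) {p : C3} (hp : p ∈ tube) (a b c : C3) :
    (lieZ (constZ r) w).1 p ![a, b, c] =
      r ![fderivWithin ℝ w.1 tube p a, b, c] + r ![a, fderivWithin ℝ w.1 tube p b, c] +
      r ![a, b, fderivWithin ℝ w.1 tube p c] := by
  rw [lieZ_constZ]
  change tube.indicator (extDerivWithin (interiorProd (constZ r) w).1 tube) p ![a, b, c] = _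
  have hw := ((w.2.1.differentiableOn (by simp)) p hp).hasFDerivWithinAt
  have h1 : HasFDerivWithinAt (interiorProd (constZ r) w).1
      (r.curryLeft ∘L fderivWithin ℝ w.1 tube p) tube p := by
    have e : ∀ q ∈ tube, (constZ r).1 q = r := fun q hq =>
      show tube.indicator (fun _ => r) q = r from indicator_of_mem hq _
    refine (r.curryLeft.hasFDerivAt.comp_hasFDerivWithinAt p hw).congr (fun q hq => ?_) ?_
    · change ((constZ r).1 q).curryLeft (w.1 q) = _
      rw [e q hq]
      rfl
    · change ((constZ r).1 p).curryLeft (w.1 p) = _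
      rw [e p hp]
      rfl
  rw [indicator_of_mem hp, extDerivWithin, h1.fderivWithin (uniqueDiffOn_tube p hp),
    deriv_action_apply]

theorem lieZ_PsiZ_apply (w : VField) {p : C3} (hp : p ∈ tube) (a b c : C3) :
    (lieZ PsiZ w).1 p ![a, b, c] = (thetaDeriv (fderivWithin ℝ w.1 tube p) ![a, b, c]).re := by
  rw [PsiZ, lieZ_constZ_apply _ w hp, thetaDeriv_apply]
  rfl

/-- `L_w(Ψ + iΨ̂)` has types (3,0) and (2,1), so `J` maps its real part to its imaginary part. Hence
`J L_w Ψ` is exact, which places `LieForms` inside `KhatForms`. -/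
theorem JZ_lieZ_PsiZ (w : VField) : JZ (lieZ PsiZ w) = lieZ PsiHatZ w := by
  apply Subtype.ext
  funext p
  by_cases hp : p ∈ tube
  · ext v
    rw [vec3_eta v]
    change opJ ((lieZ PsiZ w).1 p) ![v 0, v 1, v 2] = _
    rw [hodgePart_re (isF2_thetaDeriv (fderivWithin ℝ w.1 tube p))
      (fun a b c => lieZ_PsiZ_apply w hp a b c), PsiHatZ, lieZ_constZ_apply _ w hp, thetaDeriv_apply]
    rfl
  · rw [(JZ (lieZ PsiZ w)).2.2.2 p hp, (lieZ PsiHatZ w).2.2.2 p hp]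

theorem dZ_lieZ_constZ (r : Alt 3) (w : VField) : dZ 3 (lieZ (constZ r) w) = 0 := by
  rw [lieZ_constZ, dZ_dZ]

theorem restr_lieZ_constZ (r : Alt 3) (w : VField) : restr 3 (lieZ (constZ r) w) = 0 := by
  rw [lieZ_constZ, restr_dZ, restr_interior, map_zero]

theorem LieForms_le_KhatForms : LieForms ≤ KhatForms := by
  rintro _ ⟨w, rfl⟩
  refine ⟨⟨dZ_lieZ_constZ _ w, ?_⟩, restr_lieZ_constZ _ w⟩
  change dZ 3 (JZ (lieZ PsiZ w)) = 0
  rw [JZ_lieZ_PsiZ]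
  exact dZ_lieZ_constZ _ w

theorem hodgePart_lieZ (w : VField) {p : C3} (hp : p ∈ tube) (a b c : C3) :
    hodgePart ((lieZ PsiZ w).1 p) ![a, b, c] =
      thetaDeriv (fderivWithin ℝ w.1 tube p) ![a, b, c] := by
  rw [hodgePart_apply, hodgePart_re (isF2_thetaDeriv (fderivWithin ℝ w.1 tube p))
      (fun a b c => lieZ_PsiZ_apply w hp a b c), lieZ_PsiZ_apply w hp, mul_comm]
  exact Complex.re_add_im _

end

/-! ### Deformations with `(Jρ)|_M = 0` are Lie derivatives. -/

noncomputable section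

/-- The complex coordinate `zᵢ` as a real-linear map. -/
def zcoord (i : Fin 3) : C3 →L[ℝ] ℂ :=
  Complex.ofRealCLM ∘L EuclideanSpace.proj i ∘L ContinuousLinearMap.fst ℝ V3 V3 +
    Complex.I • (Complex.ofRealCLM ∘L EuclideanSpace.proj i ∘L ContinuousLinearMap.snd ℝ V3 V3)

theorem zcoord_apply (i : Fin 3) (v : C3) : zcoord i v = v.1 i + Complex.I * v.2 i := by
  simp [zcoord]

theorem Theta_apply (a b c : C3) : Theta ![a, b, c] = Complex.I *
    (zcoord 0 a * (zcoord 1 b * zcoord 2 c - zcoord 1 c * zcoord 2 b) -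
      zcoord 0 b * (zcoord 1 a * zcoord 2 c - zcoord 1 c * zcoord 2 a) +
      zcoord 0 c * (zcoord 1 a * zcoord 2 b - zcoord 1 b * zcoord 2 a)) := by
  have e : ∀ (i : Fin 3) (w : C3), dz i (fun _ => w) = zcoord i w := fun i w => rfl
  have e2 : ∀ (i j : Fin 3) (a b : C3), (dz i ⋏ dz j) ![a, b] =
      zcoord i a * zcoord j b - zcoord i b * zcoord j a := by
    intro i j a b
    have e0 : (0 : Fin 2).removeNth ![a, b] = fun _ => b := by
      funext i; fin_cases i; rfl
    have e1 : (1 : Fin 2).removeNth ![a, b] = fun _ => a := by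
      funext i; fin_cases i; rfl
    rw [wedgeOne_apply, Fin.sum_univ_two, e0, e1]
    simp [e]
    ring
  rw [Theta, ContinuousAlternatingMap.smul_apply, wedgeOne_apply, Fin.sum_univ_three,
    (removeNth_three _).1, (removeNth_three _).2.1, (removeNth_three _).2.2]
  simp [e, e2]
  ring

theorem zcoord_ex (i k : Fin 3) : zcoord i (ex k) = if i = k then 1 else 0 := by
  rw [zcoord_apply]
  by_cases h : i = k <;> simp [ex, h]

/-- Contraction with the two other coordinate vectors isolates one complex coordinate; this links
the component `u j` of a vector field to `sigma21 _ j k`. -/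
theorem Theta_ex_ex (j : Fin 3) (v : C3) :
    Theta ![ex (j + 1), ex (j + 2), v] = Complex.I * zcoord j v := by
  rw [Theta_apply]
  fin_cases j <;> simp [zcoord_ex]

/-- The vector field on `Z` with complex components `uᵢ`. -/
def vfieldOfComplex (u : Fin 3 → C3 → ℂ) (hu : ∀ i, SmoothPer (u i))
    (hb : ∀ i, ∀ p ∈ tubeBdry, u i p = 0) : VField :=
  ⟨tube.indicator fun p => (WithLp.toLp 2 fun i => (u i p).re, WithLp.toLp 2 fun i => (u i p).im), by
    refine ⟨?_, fun p n => ?_, fun p hp => indicator_of_notMem hp _, fun p hp => ?_⟩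
    · refine ContDiffOn.congr ?_ fun p hp => indicator_of_mem hp _
      refine ContDiffOn.prodMk ?_ ?_
      · exact contDiffOn_euclidean.2 fun i =>
          Complex.reCLM.contDiff.comp_contDiffOn (hu i).contDiffOn
      · exact contDiffOn_euclidean.2 fun i =>
          Complex.imCLM.contDiff.comp_contDiffOn (hu i).contDiffOn
    · by_cases hp : p ∈ tube
      · rw [indicator_of_mem hp, indicator_of_mem (add_latt_mem_tube.2 hp)]
        simp only [(hu _).periodic]
      · rw [indicator_of_notMem hp, indicator_of_notMem (mt add_latt_mem_tube.1 hp)]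
    · rw [indicator_of_mem (tubeBdry_subset hp)]
      simp only [hb _ p hp]
      rfl⟩

theorem zcoord_fderivWithin_vfieldOfComplex {u : Fin 3 → C3 → ℂ} (hu : ∀ i, SmoothPer (u i))
    (hb : ∀ i, ∀ p ∈ tubeBdry, u i p = 0) {p : C3} (hp : p ∈ tube) (i : Fin 3) (v : C3) :
    zcoord i (fderivWithin ℝ (vfieldOfComplex u hu hb).1 tube p v) =
      fderivWithin ℝ (u i) tube p v := by
  have hw := (((vfieldOfComplex u hu hb).2.1.differentiableOn (by simp)) p hp).hasFDerivWithinAt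
  have e : ∀ q ∈ tube, u i q = zcoord i ((vfieldOfComplex u hu hb).1 q) := fun q hq => by
    change _ = zcoord i (tube.indicator _ q)
    rw [indicator_of_mem hq, zcoord_apply, mul_comm]
    exact (Complex.re_add_im _).symm
  have h1 := ((zcoord i).hasFDerivAt.comp_hasFDerivWithinAt p hw).congr (fun q hq => e q hq) (e p hp)
  rw [h1.fderivWithin (uniqueDiffOn_tube p hp)]
  rfl

/-- Where the derivative of `w` enters one of the first two arguments, the third is `∂/∂z̄ₖ` and
`Theta` kills it. Only the last argument contributes, through `∂u_j/∂z̄ₖ`; the factor `i` is that of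
`i dz₁dz₂dz₃`. -/
theorem sigma21_lieZ {u : Fin 3 → C3 → ℂ} (hu : ∀ i, SmoothPer (u i))
    (hb : ∀ i, ∀ p ∈ tubeBdry, u i p = 0) {p : C3} (hp : p ∈ tube) (j k : Fin 3) :
    sigma21 (lieZ PsiZ (vfieldOfComplex u hu hb)) j k p = Complex.I * dbar k (u j) p := by
  simp only [sigma21, sigma, hodgePart_lieZ _ hp, thetaDeriv_apply, Theta_ex_ex,
    zcoord_fderivWithin_vfieldOfComplex hu hb hp, dbar]
  rw [← cplx_ex, Theta_cplx2, Theta_cplx2]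
  linear_combination (1 / 2) * (Theta ![fderivWithin ℝ (vfieldOfComplex u hu hb).1 tube p
    (ex (j + 1)), ex (j + 2), ex k] + Theta ![ex (j + 1), fderivWithin ℝ
      (vfieldOfComplex u hu hb).1 tube p (ex (j + 2)), ex k]) * Complex.I_mul_I

namespace CAlt3

variable {T : CAlt3}

/-- A form in `Ω^{3,0} ⊕ Ω^{2,1}` without `(2,1)`-part is complex linear in its last argument. -/
theorem IsF2.cplx2 (hT : IsF2 T) (h : ∀ j k : Fin 3, T ![ex (j + 1), ex (j + 2), ex k] +
    Complex.I * T ![ex (j + 1), ex (j + 2), ey k] = 0) (a b c : C3) :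
    T ![a, b, cplx c] = Complex.I * T ![a, b, c] := by
  suffices H : T ![a, b, c] + Complex.I * T ![a, b, cplx c] = 0 by
    linear_combination -Complex.I * H + T ![a, b, cplx c] * Complex.I_mul_I
  have swap : ∀ a b c : C3, T ![a, b, c] + Complex.I * T ![a, b, cplx c] =
      -(T ![b, a, c] + Complex.I * T ![b, a, cplx c]) := fun a b c => by
    rw [swap01 T a b, swap01 T a b]; ring
  -- Passing from `a` to `I a` preserves the condition by type, so the vectors `ex` in the first two
  -- arguments suffice.
  have step : ∀ a b c : C3, T ![a, b, c] + Complex.I * T ![a, b, cplx c] = 0 →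
      T ![cplx a, b, c] + Complex.I * T ![cplx a, b, cplx c] = 0 := fun a b c h0 => by
    linear_combination Complex.I * h0 - Complex.I * hT.pair02 a b c + T ![cplx a, b, c] *
      Complex.I_mul_I
  have hx : ∀ i j k : Fin 3, T ![ex i, ex j, ex k] + Complex.I * T ![ex i, ex j, cplx (ex k)] = 0 := by
    intro i j k
    rw [cplx_ex]
    by_cases hij : i = j
    · rw [hij, self01, self01]; simp
    by_cases h1 : j = i + 1
    · have e : i = (i + 2) + 1 ∧ j = (i + 2) + 2 := by subst h1; revert i; decide
      rw [e.1, e.2]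
      convert h (i + 2) k using 6
    · have e : j = (j + 2) + 1 ∧ i = (j + 2) + 2 := by revert i j; decide
      have := h (j + 2) k
      rw [← e.1, ← e.2] at this
      rw [swap01 T (ex i), swap01 T (ex i)]
      linear_combination -this
  have hy : ∀ a b : C3, (∀ k, T ![a, b, ex k] + Complex.I * T ![a, b, cplx (ex k)] = 0) →
      ∀ c, T ![a, b, c] + Complex.I * T ![a, b, cplx c] = 0 := fun a b h0 c =>
    eq_zero_of_basis (F := fun c => T ![a, b, c] + Complex.I * T ![a, b, cplx c])
      (fun u v s => by rw [map_add, map_smul, lin2, lin2]; ring) h0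
      (fun k => by
        have := h0 k
        rw [cplx_ex] at this
        simp only [cplx_ey, neg2]
        linear_combination -Complex.I * this + T ![a, b, ey k] * Complex.I_mul_I) c
  have h2 : ∀ i j c, T ![ex i, ex j, c] + Complex.I * T ![ex i, ex j, cplx c] = 0 := fun i j =>
    hy _ _ (hx i j)
  have h3 : ∀ a j c, T ![a, ex j, c] + Complex.I * T ![a, ex j, cplx c] = 0 := fun a j c =>
    eq_zero_of_basis (F := fun a => T ![a, ex j, c] + Complex.I * T ![a, ex j, cplx c])
      (fun u v s => by rw [lin0, lin0]; ring) (fun i => h2 i j c)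
      (fun i => by simp only [← cplx_ex]; exact step _ _ _ (h2 i j c)) a
  exact eq_zero_of_basis (F := fun b => T ![a, b, c] + Complex.I * T ![a, b, cplx c])
      (fun u v s => by rw [lin1, lin1]; ring) (fun i => h3 a i c)
      (fun i => by
        simp only [← cplx_ex]
        rw [swap, step _ _ _ (by rw [swap, h3, neg_zero]), neg_zero]) b

theorem cplx1 (h : ∀ a b c, T ![a, b, cplx c] = Complex.I * T ![a, b, c]) (a b c : C3) :
    T ![a, cplx b, c] = Complex.I * T ![a, b, c] := by
  rw [swap12, h, swap12 T a b]; ring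

theorem cplx0 (h : ∀ a b c, T ![a, b, cplx c] = Complex.I * T ![a, b, c]) (a b c : C3) :
    T ![cplx a, b, c] = Complex.I * T ![a, b, c] := by
  rw [swap01, cplx1 h, swap01 T a b]; ring

/-- A complex trilinear alternating form on `ℂ³` is a multiple of the determinant. -/
theorem eq_zero_of_ex (h : ∀ a b c, T ![a, b, cplx c] = Complex.I * T ![a, b, c])
    (h0 : T ![ex 0, ex 1, ex 2] = 0) (a b c : C3) : T ![a, b, c] = 0 := by
  have hx : ∀ i j k : Fin 3, T ![ex i, ex j, ex k] = 0 := by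
    have c1 : T ![ex 1, ex 0, ex 2] = 0 := by rw [swap01, h0, neg_zero]
    have c2 : T ![ex 0, ex 2, ex 1] = 0 := by rw [swap12, h0, neg_zero]
    have c3 : T ![ex 2, ex 0, ex 1] = 0 := by rw [swap01, c2, neg_zero]
    have c4 : T ![ex 1, ex 2, ex 0] = 0 := by rw [swap12, c1, neg_zero]
    have c5 : T ![ex 2, ex 1, ex 0] = 0 := by rw [swap12, c3, neg_zero]
    intro i j k
    by_cases hij : i = j
    · rw [hij, self01]
    by_cases hjk : j = k
    · rw [hjk, self12]
    by_cases hik : i = k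
    · rw [hik, self02]
    fin_cases i <;> fin_cases j <;> fin_cases k <;> first | assumption | exact absurd rfl ‹_›
  have h2 : ∀ i j c, T ![ex i, ex j, c] = 0 := fun i j =>
    eq_zero_of_basis (F := fun c => T ![ex i, ex j, c]) (fun u v s => lin2 T _ _ u v s) (hx i j)
      fun k => by simp only [← cplx_ex]; rw [h, hx, mul_zero]
  have h3 : ∀ a j c, T ![a, ex j, c] = 0 := fun a j c =>
    eq_zero_of_basis (F := fun a => T ![a, ex j, c]) (fun u v s => lin0 T u v _ _ s)
      (fun i => h2 i j c) (fun i => by simp only [← cplx_ex]; rw [cplx0 h, h2, mul_zero]) a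
  exact eq_zero_of_basis (F := fun b => T ![a, b, c]) (fun u v s => lin1 T _ u v _ s)
      (fun i => h3 a i c) (fun i => by simp only [← cplx_ex]; rw [cplx1 h, h3, mul_zero]) b

/-- The normal is `-I` times the Reeb vector. By complex linearity the vanishing on `TM` therefore
spreads to the normal direction, one argument at a time. -/
theorem eq_zero_of_tangent (h : ∀ a b c, T ![a, b, cplx c] = Complex.I * T ![a, b, c]) {p : C3}
    (hp : p ∈ tubeBdry)
    (h0 : ∀ a ∈ tangentM p, ∀ b ∈ tangentM p, ∀ c ∈ tangentM p, T ![a, b, c] = 0) (a b c : C3) :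
    T ![a, b, c] = 0 := by
  have hI : ∀ {z : ℂ}, Complex.I * z = 0 → z = 0 := fun hz =>
    (mul_eq_zero.1 hz).resolve_left Complex.I_ne_zero
  have h1 : ∀ a, ∀ b ∈ tangentM p, ∀ c ∈ tangentM p, T ![a, b, c] = 0 := by
    intro a b hb c hc
    obtain ⟨u, hu, s, rfl⟩ := exists_tangent_decomp hp a
    rw [lin0, h0 u hu b hb c hc, hI (z := T ![normalV p, b, c]), mul_zero, add_zero]
    rw [← cplx0 h, cplx_normalV hp, h0 _ (reeb_mem hp) b hb c hc]
  have h2 : ∀ a b, ∀ c ∈ tangentM p, T ![a, b, c] = 0 := by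
    intro a b c hc
    obtain ⟨u, hu, s, rfl⟩ := exists_tangent_decomp hp b
    rw [lin1, h1 a u hu c hc, hI (z := T ![a, normalV p, c]), mul_zero, add_zero]
    rw [← cplx1 h, cplx_normalV hp, h1 a _ (reeb_mem hp) c hc]
  obtain ⟨u, hu, s, rfl⟩ := exists_tangent_decomp hp c
  rw [lin2, h2 a b u hu, hI (z := T ![a, b, normalV p]), mul_zero, add_zero]
  rw [← h, cplx_normalV hp, h2 a b _ (reeb_mem hp)]

end CAlt3

theorem fderivWithin_add_I_mul_eq_zero {f g : C3 → ℂ} (hf : SmoothPer f) (hg : SmoothPer g)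
    (h : ∀ p ∈ tube, f p + Complex.I * g p = 0) {p : C3} (hp : p ∈ tube) (v : C3) :
    fderivWithin ℝ f tube p v + Complex.I * fderivWithin ℝ g tube p v = 0 := by
  have k := (hf.hasFDerivWithinAt hp).add ((hg.hasFDerivWithinAt hp).const_mul Complex.I)
  have k2 : HasFDerivWithinAt (fun _ : C3 => (0 : ℂ)) _ tube p :=
    k.congr (fun q hq => (h q hq).symm) (h p hp).symm
  have k4 := DFunLike.congr_fun
    ((uniqueDiffOn_tube p hp).eq k2 (hasFDerivWithinAt_const (0 : ℂ) p tube)) v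
  simpa using k4

theorem sigma_sub (ρ τ : FormZ 3) (a b c p : C3) :
    sigma (ρ - τ) a b c p = sigma ρ a b c p - sigma τ a b c p := by
  have e : JZ (ρ - τ) = JZ ρ - JZ τ := map_sub JZ ρ τ
  rw [sigma_eq, sigma_eq, sigma_eq, e]
  change ((ρ.1 p ![a, b, c] - τ.1 p ![a, b, c] : ℝ) : ℂ) + Complex.I *
    (((JZ ρ).1 p ![a, b, c] - (JZ τ).1 p ![a, b, c] : ℝ) : ℂ) = _
  push_cast
  ring

theorem hodgePart_tangent {ρ : FormZ 3} (h : restr 3 ρ = 0) (hJ : restr 3 (JZ ρ) = 0) {p : C3}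
    (hp : p ∈ tubeBdry) : ∀ a ∈ tangentM p, ∀ b ∈ tangentM p, ∀ c ∈ tangentM p,
      hodgePart (ρ.1 p) ![a, b, c] = 0 := by
  intro a ha b hb c hc
  rw [hodgePart_apply, apply_of_restr_eq_zero h hp ha hb hc]
  have := apply_of_restr_eq_zero hJ hp ha hb hc
  change opJ (ρ.1 p) ![a, b, c] = 0 at this
  rw [this]
  simp

/-- A holomorphic volume form on `Z` whose restriction to the boundary vanishes is zero. -/
theorem eq_zero_of_sigma21 {ρ : FormZ 3} (hρ : ρ ∈ KhatForms) (hJ : restr 3 (JZ ρ) = 0)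
    (h : ∀ p ∈ tube, ∀ j k, sigma21 ρ j k p = 0) : ρ = 0 := by
  obtain ⟨⟨h1, h2⟩, h3⟩ := hρ
  have hI : ∀ p ∈ tube, ∀ a b c, hodgePart (ρ.1 p) ![a, b, cplx c] =
      Complex.I * hodgePart (ρ.1 p) ![a, b, c] := fun p hp =>
    (isF2_hodgePart (ρ.1 p)).cplx2 fun j k => by
      have := h p hp j k
      simpa [sigma21, sigma] using this
  have hI0 : ∀ p ∈ tube, ∀ k b c, sigma ρ (ex k) b c p + Complex.I * sigma ρ (ey k) b c p = 0 := by
    intro p hp k b c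
    rw [sigma, sigma, ← cplx_ex, CAlt3.cplx0 (hI p hp)]
    linear_combination hodgePart (ρ.1 p) ![ex k, b, c] * Complex.I_mul_I
  have hz : ∀ p ∈ tube, sigma ρ (ex 0) (ex 1) (ex 2) p = 0 := by
    intro p hp
    refine eq_zero_of_dbar_eq_zero (smoothPer_sigma ρ _ _ _) (fun p hp k => ?_) (fun p hp => ?_) hp
    -- The form is now of type (3,0). In `dσ(∂/∂z̄ₖ, e₀, e₁, e₂) = 0` every term with `∂/∂z̄ₖ` as an
    -- argument of `σ` drops out, so the coefficient is holomorphic.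
    · have c := fun v => sigma_closed h1 h2 hp v (ex 0) (ex 1) (ex 2)
      have e := fun b c v => fderivWithin_add_I_mul_eq_zero (smoothPer_sigma ρ _ _ _)
        (smoothPer_sigma ρ _ _ _) (fun p hp => hI0 p hp k b c) hp v
      rw [dbar]
      linear_combination (1 / 2 : ℂ) * (c (ex k) + Complex.I * c (ey k) + e (ex 1) (ex 2) (ex 0) -
        e (ex 0) (ex 2) (ex 1) + e (ex 0) (ex 1) (ex 2))
    · exact CAlt3.eq_zero_of_tangent (hI p (tubeBdry_subset hp)) hp (hodgePart_tangent h3 hJ hp) _ _ _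
  apply Subtype.ext
  funext p
  by_cases hp : p ∈ tube
  · ext v
    have := CAlt3.eq_zero_of_ex (hI p hp) (hz p hp) (v 0) (v 1) (v 2)
    rw [← vec3_eta, hodgePart_apply] at this
    have := congrArg Complex.re this
    simpa using this
  · exact ρ.2.2.2 p hp

/-- A deformation `ρ` with `(Jρ)|_M = 0` is trivial. -/
theorem mem_LieForms {ρ : FormZ 3} (hρ : ρ ∈ KhatForms) (hJ : restr 3 (JZ ρ) = 0) :
    ρ ∈ LieForms := by
  obtain ⟨⟨h1, h2⟩, h3⟩ := hρ
  -- The factor `-i` compensates the `i` in `sigma21_lieZ`, so that `ρ` and `L_w Ψ` have the same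
  -- (2,1)-part.
  have key := fun j => exists_dbar_eq (f := fun k p => -Complex.I * sigma21 ρ j k p)
    (fun k => (smoothPer_sigma21 ρ j k).const_mul _)
    (fun p hp k l => by
      have e : ∀ k l, dbar l (fun p => -Complex.I * sigma21 ρ j k p) p =
          -Complex.I * dbar l (sigma21 ρ j k) p := fun k l => by
        have := ((smoothPer_sigma21 ρ j k).hasFDerivWithinAt hp).const_mul (-Complex.I)
        simp only [dbar]
        rw [this.fderivWithin (uniqueDiffOn_tube p hp)]
        simp
        ring
      rw [e, e, dbar_sigma21 h1 h2 hp])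
    (fun p hp k l => by linear_combination -Complex.I * sigma21_parallel h3 hJ hp j k l)
  choose u hu hd hb using key
  have hw := LieForms_le_KhatForms ⟨vfieldOfComplex u hu hb, rfl⟩
  have h0 := eq_zero_of_sigma21 (KhatForms.sub_mem ⟨⟨h1, h2⟩, h3⟩ hw)
    (by rw [map_sub, map_sub, hJ, restr_JZ_lieZ]; exact sub_self _)
    (fun p hp j k => by
      have e : ∀ τ : FormZ 3, sigma21 (ρ - τ) j k p = sigma21 ρ j k p - sigma21 τ j k p := fun τ => by
        simp only [sigma21, sigma_sub]; ring
      rw [e, sigma21_lieZ hu hb hp, hd j p hp k]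
      linear_combination sigma21 ρ j k p * Complex.I_mul_I)
  exact ⟨_, (sub_eq_zero.1 h0).symm⟩

end

/-! ### The explicit forms, the Calabi-Yau structure and pseudoconvexity. -/

noncomputable section

theorem constZ_apply {k : ℕ} (r : Alt k) {p : C3} (hp : p ∈ tube) : (constZ r).1 p = r :=
  show tube.indicator (fun _ => r) p = r from indicator_of_mem hp _

/-- The determinant of three vectors of `ℝ³`. -/
def det3 (u v w : V3) : ℝ :=
  u 0 * (v 1 * w 2 - v 2 * w 1) - u 1 * (v 0 * w 2 - v 2 * w 0) + u 2 * (v 0 * w 1 - v 1 * w 0)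

theorem inner_V3 (u v : V3) : inner ℝ u v = u 0 * v 0 + u 1 * v 1 + u 2 * v 2 := by
  rw [PiLp.inner_apply, Fin.sum_univ_three]
  simp
  ring

theorem norm_sq_V3 (u : V3) : ‖u‖ ^ 2 = u 0 ^ 2 + u 1 ^ 2 + u 2 ^ 2 := by
  rw [← real_inner_self_eq_norm_sq, inner_V3]; ring

theorem sum_sq_of_mem {p : C3} (hp : p ∈ tubeBdry) :
    p.1 0 ^ 2 + p.1 1 ^ 2 + p.1 2 ^ 2 = 1 := by
  rw [← norm_sq_V3, norm_of_mem hp, one_pow]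

/-- Three vectors of the plane `x^⊥` are dependent. The certificate pairs `det(u,v,w) x = (x·u) v×w
+ (x·v) w×u + (x·w) u×v` with `x`. -/
theorem det3_eq_zero {x u v w : V3} (hx : x 0 ^ 2 + x 1 ^ 2 + x 2 ^ 2 = 1)
    (hu : inner ℝ x u = 0) (hv : inner ℝ x v = 0) (hw : inner ℝ x w = 0) : det3 u v w = 0 := by
  rw [inner_V3] at hu hv hw
  rw [det3]
  linear_combination (-(u 0 * (v 1 * w 2 - v 2 * w 1) - u 1 * (v 0 * w 2 - v 2 * w 0) +
    u 2 * (v 0 * w 1 - v 1 * w 0))) * hx +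
    (x 0 * (v 1 * w 2 - v 2 * w 1) + x 1 * (v 2 * w 0 - v 0 * w 2) +
      x 2 * (v 0 * w 1 - v 1 * w 0)) * hu +
    (x 0 * (w 1 * u 2 - w 2 * u 1) + x 1 * (w 2 * u 0 - w 0 * u 2) +
      x 2 * (w 0 * u 1 - w 1 * u 0)) * hv +
    (x 0 * (u 1 * v 2 - u 2 * v 1) + x 1 * (u 2 * v 0 - u 0 * v 2) +
      x 2 * (u 0 * v 1 - u 1 * v 0)) * hw

theorem wedgeOne_one_apply (η τ : Alt 1) (a b : C3) : (η ⋏ τ) ![a, b] =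
    η (fun _ => a) * τ (fun _ => b) - η (fun _ => b) * τ (fun _ => a) := by
  have e0 : (0 : Fin 2).removeNth ![a, b] = fun _ => b := by
    funext i; fin_cases i; rfl
  have e1 : (1 : Fin 2).removeNth ![a, b] = fun _ => a := by
    funext i; fin_cases i; rfl
  rw [wedgeOne_apply, Fin.sum_univ_two, e0, e1]
  simp
  ring

theorem dx_apply (i : Fin 3) (a : C3) : dx i (fun _ => a) = a.1 i := rfl

theorem dy_apply (i : Fin 3) (a : C3) : dy i (fun _ => a) = a.2 i := rfl

theorem chi_apply (a b c : C3) : (dx 0 ⋏ dx 1 ⋏ dx 2) ![a, b, c] = det3 a.1 b.1 c.1 := by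
  rw [wedgeOne_two_apply]
  change dx 0 (fun _ => a) * (dx 1 ⋏ dx 2) ![b, c] - dx 0 (fun _ => b) * (dx 1 ⋏ dx 2) ![a, c] +
    dx 0 (fun _ => c) * (dx 1 ⋏ dx 2) ![a, b] = _
  simp only [wedgeOne_one_apply, dx_apply, det3]
  ring

theorem two_chiZ_apply {p : C3} (hp : p ∈ tube) (a b c : C3) :
    ((2 : ℝ) • chiZ).1 p ![a, b, c] = 2 * det3 a.1 b.1 c.1 := by
  change 2 * chiZ.1 p ![a, b, c] = _
  rw [chiZ, constZ_apply _ hp, chi_apply]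

theorem JZ_constZ (r : Alt 3) : JZ (constZ r) = constZ (opJ r) := by
  apply Subtype.ext
  funext p
  by_cases hp : p ∈ tube
  · change opJ ((constZ r).1 p) = _
    rw [constZ_apply _ hp, constZ_apply _ hp]
  · rw [(JZ (constZ r)).2.2.2 p hp, (constZ _).2.2.2 p hp]

theorem restr_chiZ : restr 3 chiZ = 0 := by
  refine FormM_ext fun p hp v hv => ?_
  rw [restr_apply_bdry _ hp hv, vec3_eta v, chiZ, constZ_apply _ (tubeBdry_subset hp), chi_apply]
  exact det3_eq_zero (sum_sq_of_mem hp) (hv 0) (hv 1) (hv 2)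

theorem two_chiZ_mem : (2 : ℝ) • chiZ ∈ KhatForms := by
  refine KhatForms.smul_mem 2 ⟨⟨dZ_constZ _, ?_⟩, restr_chiZ⟩
  change dZ 3 (JZ (constZ _)) = 0
  rw [JZ_constZ, dZ_constZ]

theorem gammaM_apply {p : C3} (hp : p ∈ tubeBdry) {a b : C3} (ha : a ∈ tangentM p)
    (hb : b ∈ tangentM p) : gammaM.1 p ![a, b] = det3 p.1 a.1 b.1 + det3 p.1 a.2 b.2 := by
  rw [gammaM, restr_apply_bdry _ hp (by intro i; fin_cases i <;> assumption)]
  change tube.indicator (fun p => ∑ i, p.1 i • (dx (i + 1) ⋏ dx (i + 2) + dy (i + 1) ⋏ dy (i + 2)))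
    p ![a, b] = _
  rw [indicator_of_mem (tubeBdry_subset hp), Fin.sum_univ_three]
  simp only [ContinuousAlternatingMap.add_apply, ContinuousAlternatingMap.smul_apply,
    wedgeOne_one_apply, dx_apply, dy_apply, det3, smul_eq_mul]
  have e1 : (1 : Fin 3) + 1 = 2 := rfl
  have e2 : (1 : Fin 3) + 2 = 0 := rfl
  have e3 : (2 : Fin 3) + 1 = 0 := rfl
  have e4 : (2 : Fin 3) + 2 = 1 := rfl
  simp only [zero_add, e1, e2, e3, e4]
  ring

/-- The Reeb vector `(0, x)` has no real part and `I` maps it to `(-x, 0)`. Of the four terms of `J`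
only the two with `I` applied to it survive, and they give the `dx dx` and the `dy dy` part. The
factor 2 cancels the `½` in `J`. -/
theorem contrReeb_two_chiZ : contrReeb 2 (restr 3 (JZ ((2 : ℝ) • chiZ))) = gammaM := by
  refine FormM_ext fun p hp v hv => ?_
  have hv' : v = ![v 0, v 1] := by funext i; fin_cases i <;> rfl
  rw [contrReeb_apply _ (tubeBdry_subset_cone hp), hv', gammaM_apply hp (hv 0) (hv 1)]
  change (restr 3 (JZ ((2 : ℝ) • chiZ))).1 p ![reeb p, v 0, v 1] = _
  have ht := tubeBdry_subset hp
  rw [restr_JZ_apply _ hp (reeb_mem hp) (hv 0) (hv 1), reeb_eq hp]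
  simp only [two_chiZ_apply ht, cplx, det3]
  simp
  ring

/-- The conditions defining `ℋ_M` need no direct check: they hold for anything in the image of `b`.
-/
theorem gammaM_mem : gammaM ∈ HM := by
  rw [← contrReeb_two_chiZ]
  exact contrReeb_restr_JZ_mem two_chiZ_mem

theorem bMap_two_chiZ :
    bMap (Submodule.Quotient.mk ⟨(2 : ℝ) • chiZ, two_chiZ_mem⟩) = ⟨gammaM, gammaM_mem⟩ :=
  Subtype.ext contrReeb_two_chiZ

theorem ey_mem (p : C3) (i : Fin 3) : ey i ∈ tangentM p := by simp [tangentM, ey]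

/-- The component of `θ ∧ τ` along the torus. -/
theorem wedgeM_gammaM_ey {p : C3} (hp : p ∈ tubeBdry) :
    (wedgeM contactM gammaM).1 p ![ey 0, ey 1, ey 2] = 1 := by
  change (contactM.1 p ⋏ gammaM.1 p) ![ey 0, ey 1, ey 2] = 1
  rw [wedgeOne_two_apply]
  change contactM.1 p (fun _ => ey 0) * gammaM.1 p ![ey 1, ey 2] -
    contactM.1 p (fun _ => ey 1) * gammaM.1 p ![ey 0, ey 2] +
    contactM.1 p (fun _ => ey 2) * gammaM.1 p ![ey 0, ey 1] = 1
  simp only [gammaM_apply hp (ey_mem p _) (ey_mem p _), contactM_apply hp, inner_V3, det3]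
  simp [ey]
  linear_combination sum_sq_of_mem hp

theorem isCalabiYau : IsCalabiYau := by
  refine ⟨dZ_constZ _, dZ_constZ _, fun p hp => ?_⟩
  have e : ∀ v, (PsiZ.1 p v : ℂ) + Complex.I * PsiHatZ.1 p v = Theta v := fun v => by
    rw [PsiZ, PsiHatZ, constZ_apply _ hp, constZ_apply _ hp, mul_comm]
    exact Complex.re_add_im _
  simp only [e]
  refine ⟨⟨![ex (0 + 1), ex (0 + 2), ex 0], ?_⟩, fun a b c => Theta_cplx a b c⟩
  rw [Theta_ex_ex, zcoord_ex]
  simp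

theorem fderiv_bdryFn : fderiv ℝ bdryFn = fun p =>
    2 • (innerSL ℝ p.1 ∘L ContinuousLinearMap.fst ℝ V3 V3) := by
  funext p
  have h : HasFDerivAt (fun p : C3 => ‖p.1‖ ^ 2 - 1) _ p :=
    ((hasFDerivAt_fst (𝕜 := ℝ) (E := V3) (F := V3) (p := p)).norm_sq).sub_const 1
  exact h.fderiv

theorem hess_bdryFn (p u v : C3) : fderiv ℝ (fderiv ℝ bdryFn) p u v = 2 * inner ℝ u.1 v.1 := by
  rw [fderiv_bdryFn]
  let L : C3 →L[ℝ] C3 →L[ℝ] ℝ := (2 : ℝ) •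
    ((ContinuousLinearMap.compL ℝ C3 V3 ℝ).flip (ContinuousLinearMap.fst ℝ V3 V3) ∘L
      innerSL ℝ ∘L ContinuousLinearMap.fst ℝ V3 V3)
  have e : (fun p : C3 => 2 • (innerSL ℝ p.1 ∘L ContinuousLinearMap.fst ℝ V3 V3)) = L := by
    funext p
    refine ContinuousLinearMap.ext fun v => ?_
    simp [L, two_mul]
    rfl
  rw [e, L.fderiv]
  simp [L]
  rfl

/-- The Hessian of `|x|² - 1` is `2|dx|²`. Since `I` exchanges the real and imaginary parts, the
Levi form is `2(|u₁|² + |u₂|²)`, positive definite on all of `ℂ³`. -/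
theorem stronglyPseudoconvexBdry : StronglyPseudoconvexBdry := by
  intro p hp u hu hu' h0
  rw [leviForm, hess_bdryFn, hess_bdryFn, real_inner_self_eq_norm_sq, real_inner_self_eq_norm_sq]
  have e : ‖(cplx u).1‖ = ‖u.2‖ := by simp [cplx]
  rw [e]
  by_contra! H
  apply h0
  have h1 : ‖u.1‖ = 0 := by nlinarith [sq_nonneg ‖u.1‖, sq_nonneg ‖u.2‖]
  have h2 : ‖u.2‖ = 0 := by nlinarith [sq_nonneg ‖u.1‖, sq_nonneg ‖u.2‖]
  exact Prod.ext (norm_eq_zero.1 h1) (norm_eq_zero.1 h2)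

end

/-! ### The divergence theorem on the unit ball. -/

noncomputable section

section

open MeasureTheory

/-- Integration by parts against the constant 1. -/
theorem integral_fderiv_of_hasCompactSupport {f : V3 → ℝ} (hf : ContDiff ℝ 1 f)
    (hc : HasCompactSupport f) (v : V3) : ∫ x, fderiv ℝ f x v = 0 := by
  have hi : Integrable fun x => fderiv ℝ f x v :=
    ((hf.continuous_fderiv (by simp)).clm_apply continuous_const).integrable_of_hasCompactSupport
      (hc.fderiv_apply ℝ v)
  have h := integral_mul_fderiv_eq_neg_fderiv_mul_of_integrable (μ := volume) (f := fun _ : V3 => (1 : ℝ))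
    (g := f) (v := v) (by simp) (by simpa using hi)
    (by simpa using hf.continuous.integrable_of_hasCompactSupport hc)
    (fun x _ => differentiableAt_const _) (fun x _ => hf.differentiable (by simp) x)
  simpa using h

/-- Cutoff functions exhausting the open unit ball. -/
def cutoff (n : ℕ) (x : V3) : ℝ := Real.smoothTransition ((n + 1) * (1 - ‖x‖ ^ 2) - 1)

theorem hasFDerivAt_cutoff (n : ℕ) (x : V3) : HasFDerivAt (cutoff n)
    ((-(2 * (n + 1)) * deriv Real.smoothTransition ((n + 1) * (1 - ‖x‖ ^ 2) - 1)) • innerSL ℝ x) x := by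
  have h1 : HasFDerivAt (fun x : V3 => ((n : ℝ) + 1) * (1 - ‖x‖ ^ 2) - 1)
      (-(2 * ((n : ℝ) + 1)) • innerSL ℝ x) x := by
    refine ((((hasStrictFDerivAt_norm_sq x).hasFDerivAt.const_sub 1).const_mul
      ((n : ℝ) + 1)).sub_const 1).congr_fderiv ?_
    ext v
    simp
    ring
  have h2 : HasDerivAt Real.smoothTransition _ (((n : ℝ) + 1) * (1 - ‖x‖ ^ 2) - 1) :=
    (Real.smoothTransition.contDiff.differentiable (n := 1) (by simp) _).hasDerivAt
  refine (h2.comp_hasFDerivAt x h1).congr_fderiv ?_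
  rw [smul_smul, mul_comm]

theorem contDiff_cutoff (n : ℕ) : ContDiff ℝ ∞ (cutoff n) :=
  Real.smoothTransition.contDiff.comp
    ((contDiff_const.mul (contDiff_const.sub (contDiff_norm_sq ℝ))).sub contDiff_const)

theorem cutoff_eq_zero {n : ℕ} {x : V3} (h : ((n : ℝ) + 1) * (1 - ‖x‖ ^ 2) ≤ 1) : cutoff n x = 0 :=
  Real.smoothTransition.zero_of_nonpos (by linarith)

theorem cutoff_eq_zero' {n : ℕ} {x : V3} (h : x ∉ Metric.ball (0 : V3) 1) : cutoff n x = 0 := by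
  refine cutoff_eq_zero ?_
  have h1 : 1 ≤ ‖x‖ := by simpa using h
  have : ((n : ℝ) + 1) * (1 - ‖x‖ ^ 2) ≤ 0 :=
    mul_nonpos_of_nonneg_of_nonpos (by positivity) (by nlinarith)
  linarith

theorem deriv_smoothTransition_eq_zero {t : ℝ} (h : t ∉ Icc (0 : ℝ) 1) :
    deriv Real.smoothTransition t = 0 := by
  rw [mem_Icc, not_and_or, not_le, not_le] at h
  rcases h with h | h
  · have : Real.smoothTransition =ᶠ[nhds t] fun _ => 0 := by
      filter_upwards [Iio_mem_nhds h] with s hs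
      exact Real.smoothTransition.zero_of_nonpos (le_of_lt hs)
    rw [this.deriv_eq, deriv_const]
  · have : Real.smoothTransition =ᶠ[nhds t] fun _ => 1 := by
      filter_upwards [Ioi_mem_nhds h] with s hs
      exact Real.smoothTransition.one_of_one_le (le_of_lt hs)
    rw [this.deriv_eq, deriv_const]

theorem exists_bound_deriv_smoothTransition :
    ∃ C, 0 ≤ C ∧ ∀ t, |deriv Real.smoothTransition t| ≤ C := by
  obtain ⟨C, hC⟩ := isCompact_Icc.exists_bound_of_continuousOn (s := Icc (0 : ℝ) 1)
    (Real.smoothTransition.contDiff.continuous_deriv (n := 1) le_rfl).continuousOn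
  refine ⟨max C 0, le_max_right _ _, fun t => ?_⟩
  by_cases ht : t ∈ Icc (0 : ℝ) 1
  · exact (hC t ht).trans (le_max_left _ _)
  · rw [deriv_smoothTransition_eq_zero ht, abs_zero]
    exact le_max_right _ _

theorem uniqueDiffOn_ball3 : UniqueDiffOn ℝ ball3 :=
  uniqueDiffOn_convex (convex_closedBall 0 1) interior_ball3_nonempty

/-- Mean value inequality between `x` and the nearest point of the sphere. The linear vanishing will
compensate the factor `n + 1` in the derivative of `cutoff n`. -/
theorem exists_le_one_sub_norm {g : V3 → ℝ} (hg : ContDiffOn ℝ ∞ g ball3)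
    (h0 : ∀ x, ‖x‖ = 1 → g x = 0) : ∃ C, 0 ≤ C ∧ ∀ x ∈ ball3, |g x| ≤ C * (1 - ‖x‖) := by
  obtain ⟨C, hC⟩ := (isCompact_closedBall (0 : V3) 1).exists_bound_of_continuousOn
    (hg.continuousOn_fderivWithin uniqueDiffOn_ball3 (by simp))
  refine ⟨max C 0, le_max_right _ _, fun x hx => ?_⟩
  obtain ⟨e, he, hex⟩ : ∃ e : V3, ‖e‖ = 1 ∧ ‖x - e‖ = 1 - ‖x‖ := by
    by_cases h : x = 0
    · exact ⟨EuclideanSpace.single 0 1, by simp, by simp [h]⟩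
    · have hn : ‖x‖ ≠ 0 := norm_ne_zero_iff.2 h
      have hx1 : ‖x‖ ≤ 1 := by simpa using hx
      refine ⟨‖x‖⁻¹ • x, by simp [norm_smul, hn], ?_⟩
      have : x - ‖x‖⁻¹ • x = (1 - ‖x‖⁻¹) • x := by rw [sub_smul, one_smul]
      rw [this, norm_smul, Real.norm_eq_abs, abs_of_nonpos]
      · field_simp
        ring
      · have := one_le_inv₀ (norm_pos_iff.2 h) |>.2 hx1
        linarith
  have := (convex_closedBall (0 : V3) 1).norm_image_sub_le_of_norm_fderivWithin_le (𝕜 := ℝ)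
    (hg.differentiableOn (by simp)) (fun y hy => (hC y hy).trans (le_max_left C 0))
    (show e ∈ ball3 by simp [he]) hx
  rwa [h0 e he, sub_zero, hex] at this

theorem ball_ae_eq_ball3 : Metric.ball (0 : V3) 1 =ᵐ[volume] ball3 :=
  ae_eq_of_subset_of_measure_ge Metric.ball_subset_closedBall
    (Measure.addHaar_closedBall_eq_addHaar_ball volume (0 : V3) 1).le
    Metric.isOpen_ball.measurableSet.nullMeasurableSet measure_closedBall_lt_top.ne

theorem setIntegral_ball3_eq (f : V3 → ℝ) :
    ∫ x in ball3, f x = ∫ x in Metric.ball (0 : V3) 1, f x :=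
  setIntegral_congr_set ball_ae_eq_ball3.symm

/-- The divergence theorem on the unit ball for a vector field tangent to the boundary. -/
theorem integral_ball3_div {V : Fin 3 → V3 → ℝ} (hV : ∀ i, ContDiffOn ℝ ∞ (V i) ball3)
    (h0 : ∀ x, ‖x‖ = 1 → ∑ i, x i * V i x = 0) :
    ∫ x in ball3, ∑ i, fderivWithin ℝ (V i) ball3 x (EuclideanSpace.single i 1) = 0 := by
  set d : V3 → ℝ := fun x => ∑ i, fderivWithin ℝ (V i) ball3 x (EuclideanSpace.single i 1) with hd
  set g : V3 → ℝ := fun x => ∑ i, x i * V i x with hg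
  have hgs : ContDiffOn ℝ ∞ g ball3 := ContDiffOn.sum fun i _ =>
    (EuclideanSpace.proj (𝕜 := ℝ) i).contDiff.contDiffOn.mul (hV i)
  have hdc : ContinuousOn d ball3 := continuousOn_finsetSum _ fun i _ =>
    ((hV i).continuousOn_fderivWithin uniqueDiffOn_ball3 (by simp)).clm_apply continuousOn_const
  obtain ⟨C, hC0, hC⟩ := exists_bound_deriv_smoothTransition
  obtain ⟨B, hB0, hB⟩ := exists_le_one_sub_norm hgs h0
  obtain ⟨D, hD⟩ := (isCompact_closedBall (0 : V3) 1).exists_bound_of_continuousOn hdc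
  set F : ℕ → V3 → ℝ := fun n x => cutoff n x * d x -
    2 * (n + 1) * deriv Real.smoothTransition ((n + 1) * (1 - ‖x‖ ^ 2) - 1) * g x with hF
  -- In the open ball `F n` is the divergence of `cutoff n • V`, a compactly supported `C¹` field on
  -- `ℝ³`; the gradient of the cutoff is radial and so meets only `g = x·V`.
  have hzero : ∀ n, ∫ x in ball3, F n x = 0 := by
    intro n
    have hW : ∀ i, ContDiff ℝ 1 fun x => cutoff n x * V i x := by
      intro i
      refine contDiff_iff_contDiffAt.2 fun x => ?_
      by_cases hx : x ∈ Metric.ball (0 : V3) 1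
      · refine ((contDiff_cutoff n).contDiffAt.mul ((hV i).contDiffAt ?_)).of_le (by simp)
        exact mem_nhds_iff.2 ⟨_, Metric.ball_subset_closedBall, Metric.isOpen_ball, hx⟩
      · have h1 : 1 ≤ ‖x‖ := by simpa using hx
        have : ∀ᶠ y in nhds x, ((n : ℝ) + 1) * (1 - ‖y‖ ^ 2) < 1 := by
          refine ContinuousAt.eventually_lt (by fun_prop) continuousAt_const ?_
          have : ((n : ℝ) + 1) * (1 - ‖x‖ ^ 2) ≤ 0 :=
            mul_nonpos_of_nonneg_of_nonpos (by positivity) (by nlinarith)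
          linarith
        refine (contDiffAt_const (c := (0 : ℝ))).congr_of_eventuallyEq ?_
        filter_upwards [this] with y hy
        rw [cutoff_eq_zero hy.le, zero_mul]
    have hsupp : ∀ i, HasCompactSupport fun x => cutoff n x * V i x := fun i =>
      HasCompactSupport.intro (isCompact_closedBall (0 : V3) 1) fun x hx => by
        rw [cutoff_eq_zero' fun h => hx (Metric.ball_subset_closedBall h), zero_mul]
    have hG : ∀ x ∈ Metric.ball (0 : V3) 1, F n x =
        ∑ i, fderiv ℝ (fun x => cutoff n x * V i x) x (EuclideanSpace.single i 1) := by
      intro x hx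
      have hnh : ball3 ∈ nhds x :=
        mem_nhds_iff.2 ⟨_, Metric.ball_subset_closedBall, Metric.isOpen_ball, hx⟩
      have hi : ∀ i, fderiv ℝ (fun x => cutoff n x * V i x) x (EuclideanSpace.single i 1) =
          cutoff n x * fderivWithin ℝ (V i) ball3 x (EuclideanSpace.single i 1) -
          2 * (n + 1) * deriv Real.smoothTransition ((n + 1) * (1 - ‖x‖ ^ 2) - 1) * (x i * V i x) := by
        intro i
        have h1 : HasFDerivAt (V i) (fderivWithin ℝ (V i) ball3 x) x :=
          (((hV i).differentiableOn (by simp)) x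
            (Metric.ball_subset_closedBall hx)).hasFDerivWithinAt.hasFDerivAt hnh
        have h2 : HasFDerivAt (fun x => cutoff n x * V i x) _ x := (hasFDerivAt_cutoff n x).mul h1
        rw [h2.fderiv]
        have e : inner ℝ x (EuclideanSpace.single i (1 : ℝ)) = x i := by
          rw [EuclideanSpace.inner_single_right]; simp
        simp [e]
        ring
      simp only [hi, hF, hd, hg, Finset.sum_sub_distrib, Finset.mul_sum]
    have hout : ∀ x, x ∉ Metric.ball (0 : V3) 1 →
        ∑ i, fderiv ℝ (fun x => cutoff n x * V i x) x (EuclideanSpace.single i 1) = 0 := by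
      intro x hx
      refine Finset.sum_eq_zero fun i _ => ?_
      have h1 : 1 ≤ ‖x‖ := by simpa using hx
      have : ∀ᶠ y in nhds x, ((n : ℝ) + 1) * (1 - ‖y‖ ^ 2) < 1 := by
        refine ContinuousAt.eventually_lt (by fun_prop) continuousAt_const ?_
        have : ((n : ℝ) + 1) * (1 - ‖x‖ ^ 2) ≤ 0 :=
          mul_nonpos_of_nonneg_of_nonpos (by positivity) (by nlinarith)
        linarith
      have h2 : (fun x => cutoff n x * V i x) =ᶠ[nhds x] fun _ => 0 := by
        filter_upwards [this] with y hy
        rw [cutoff_eq_zero hy.le, zero_mul]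
      rw [h2.fderiv_eq]
      simp
    rw [setIntegral_ball3_eq, setIntegral_congr_fun Metric.isOpen_ball.measurableSet hG,
      setIntegral_eq_integral_of_forall_compl_eq_zero hout, integral_finsetSum]
    · exact Finset.sum_eq_zero fun i _ => integral_fderiv_of_hasCompactSupport (hW i) (hsupp i) _
    · intro i _
      exact (((hW i).continuous_fderiv (by simp)).clm_apply
        continuous_const).integrable_of_hasCompactSupport ((hsupp i).fderiv_apply ℝ _)
  have hbound : ∀ n, ∀ x ∈ ball3, ‖F n x‖ ≤ D + 4 * C * B := by
    intro n x hx
    have hx1 : ‖x‖ ≤ 1 := by simpa using hx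
    have a1 : |cutoff n x * d x| ≤ D := by
      rw [abs_mul]
      have : |cutoff n x| ≤ 1 := by
        rw [cutoff, abs_of_nonneg (Real.smoothTransition.nonneg _)]
        exact Real.smoothTransition.le_one _
      calc |cutoff n x| * |d x| ≤ 1 * |d x| := by gcongr
        _ ≤ D := by rw [one_mul]; exact hD x hx
    have a2 : |2 * (n + 1) * deriv Real.smoothTransition ((n + 1) * (1 - ‖x‖ ^ 2) - 1) * g x| ≤
        4 * C * B := by
      by_cases ht : ((n : ℝ) + 1) * (1 - ‖x‖ ^ 2) - 1 ∈ Icc (0 : ℝ) 1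
      -- On the support of the derivative of the cutoff the distance to the sphere is at most
      -- `2/(n+1)`, so `(n+1)|g|` is bounded independently of `n`.
      · have h1 : ((n : ℝ) + 1) * (1 - ‖x‖) ≤ 2 := by
          have : ((n : ℝ) + 1) * (1 - ‖x‖) ≤ (n + 1) * (1 - ‖x‖ ^ 2) := by
            gcongr
            nlinarith [norm_nonneg x]
          linarith [ht.2]
        have hn : (0 : ℝ) ≤ n + 1 := by positivity
        rw [abs_mul, abs_mul, abs_of_nonneg (by positivity : (0 : ℝ) ≤ 2 * (n + 1))]
        calc _ ≤ 2 * ((n : ℝ) + 1) * C * (B * (1 - ‖x‖)) := by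
              gcongr
              · exact hC _
              · exact hB x hx
          _ = 2 * C * B * ((n + 1) * (1 - ‖x‖)) := by ring
          _ ≤ 2 * C * B * 2 := by gcongr
          _ = 4 * C * B := by ring
      · rw [deriv_smoothTransition_eq_zero ht]
        simp
        positivity
    exact (abs_sub _ _).trans (add_le_add a1 a2)
  have hlim : ∀ x ∈ Metric.ball (0 : V3) 1, Filter.Tendsto (fun n => F n x) Filter.atTop (nhds (d x)) := by
    intro x hx
    have hx1 : ‖x‖ < 1 := by simpa using hx
    have hpos : 0 < 1 - ‖x‖ ^ 2 := by nlinarith [norm_nonneg x]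
    obtain ⟨N, hN⟩ := exists_nat_gt (3 / (1 - ‖x‖ ^ 2))
    refine tendsto_const_nhds.congr' ?_
    filter_upwards [Filter.eventually_ge_atTop N] with n hn
    have h3 : 3 < ((n : ℝ) + 1) * (1 - ‖x‖ ^ 2) := by
      rw [div_lt_iff₀ hpos] at hN
      have : (N : ℝ) ≤ n := by exact_mod_cast hn
      nlinarith
    have e1 : cutoff n x = 1 := Real.smoothTransition.one_of_one_le (by linarith)
    have e2 := deriv_smoothTransition_eq_zero (t := ((n : ℝ) + 1) * (1 - ‖x‖ ^ 2) - 1)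
      (fun h => by linarith [h.2])
    simp [hF, e1, e2]
  -- `F n` converges to the divergence in the open ball; the sphere is a null set.
  have hT := tendsto_integral_of_dominated_convergence (μ := volume.restrict ball3) (F := F) (f := d)
    (fun _ => D + 4 * C * B) (fun n => by
      refine ContinuousOn.aestronglyMeasurable ?_ Metric.isClosed_closedBall.measurableSet
      have h1 : Continuous (cutoff n) := (contDiff_cutoff n).continuous
      have h2 : Continuous (deriv Real.smoothTransition) :=
        Real.smoothTransition.contDiff.continuous_deriv (n := 1) le_rfl
      have h3 := hgs.continuousOn
      refine (h1.continuousOn.mul hdc).sub (ContinuousOn.mul (Continuous.continuousOn ?_) h3)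
      exact continuous_const.mul (h2.comp (by fun_prop)))
    (integrableOn_const measure_closedBall_lt_top.ne)
    (fun n => (ae_restrict_iff' Metric.isClosed_closedBall.measurableSet).2
      (Filter.Eventually.of_forall (hbound n)))
    (by
      rw [← Measure.restrict_congr_set ball_ae_eq_ball3]
      exact (ae_restrict_iff' Metric.isOpen_ball.measurableSet).2 (Filter.Eventually.of_forall hlim))
  simp only [hzero] at hT
  exact tendsto_nhds_unique hT tendsto_const_nhds

end

end

/-! ### Periods over `{x} × T³` and `B³ × {y}`. -/

noncomputable section

theorem hasFDerivAt_formM {k : ℕ} (τ : FormM k) {p : C3} (hp : p ∈ cone) (v : Fin k → C3) :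
    HasFDerivAt (fun q => τ.1 q v) (fderiv ℝ (fun q => τ.1 q v) p) p :=
  (((contDiffOn_alt_apply (v := fun i _ => v i) τ.2.1 fun i => contDiffOn_const).contDiffAt
    (isOpen_cone.mem_nhds hp)).differentiableAt (by simp)).hasFDerivAt

theorem dM_three_apply (τ : FormM 3) {p : C3} (hp : p ∈ cone) (a b c d : C3) :
    (dM 3 τ).1 p ![a, b, c, d] = fderiv ℝ (fun q => τ.1 q ![b, c, d]) p a -
      fderiv ℝ (fun q => τ.1 q ![a, c, d]) p b +
      fderiv ℝ (fun q => τ.1 q ![a, b, d]) p c -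
      fderiv ℝ (fun q => τ.1 q ![a, b, c]) p d := by
  change cone.indicator (extDeriv τ.1) p _ = _
  rw [indicator_of_mem hp, extDeriv_apply (FormM_diff τ hp),
    Fin.sum_univ_four, (removeNth_four _).1, (removeNth_four _).2.1, (removeNth_four _).2.2.1,
    (removeNth_four _).2.2.2]
  simp
  ring

theorem dM_two_apply (τ : FormM 2) {p : C3} (hp : p ∈ cone) (a b c : C3) :
    (dM 2 τ).1 p ![a, b, c] = fderiv ℝ (fun q => τ.1 q ![b, c]) p a -
      fderiv ℝ (fun q => τ.1 q ![a, c]) p b +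
      fderiv ℝ (fun q => τ.1 q ![a, b]) p c := by
  change cone.indicator (extDeriv τ.1) p _ = _
  rw [indicator_of_mem hp, extDeriv_apply (FormM_diff τ hp),
    Fin.sum_univ_three, (removeNth_three _).1, (removeNth_three _).2.1, (removeNth_three _).2.2]
  simp
  ring

section

open MeasureTheory

/-- Along the torus `dη` involves only `y`-derivatives of periodic functions, and each of them
integrates to zero. -/
theorem torusPeriod_dM {x : V3} (hx : ‖x‖ = 1) (η : FormM 2) : torusPeriod x (dM 2 η) = 0 := by
  have hc : ∀ y, (x, y) ∈ cone := fun y => tubeBdry_subset_cone (norm_eq_one_iff_mem.2 hx)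
  have hd : ∀ v y, HasFDerivAt (fun y => η.1 (x, y) v)
      (fderiv ℝ (fun q => η.1 q v) (x, y) ∘L ContinuousLinearMap.inr ℝ V3 V3) y := fun v y =>
    (hasFDerivAt_formM η (hc y) v).comp y (hasFDerivAt_prodMk_right x y)
  have hcont : ∀ v i, Continuous fun y => (fderiv ℝ (fun q => η.1 q v) (x, y) ∘L
      ContinuousLinearMap.inr ℝ V3 V3) (EuclideanSpace.single i 1) := by
    intro v i
    have h1 : ContDiffOn ℝ ∞ (fun q => η.1 q v) cone :=
      contDiffOn_alt_apply (v := fun i _ => v i) η.2.1 fun i => contDiffOn_const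
    have h2 := h1.continuousOn_fderiv_of_isOpen isOpen_cone (by simp)
    have h3 : Continuous fun y : V3 => fderiv ℝ (fun q => η.1 q v) (x, y) :=
      h2.comp_continuous (by fun_prop) hc
    exact h3.clm_apply continuous_const
  have hz : ∀ v i, ∫ y in box, (fderiv ℝ (fun q => η.1 q v) (x, y) ∘L
      ContinuousLinearMap.inr ℝ V3 V3) (EuclideanSpace.single i 1) = 0 := fun v i =>
    setIntegral_box_fderiv i (hd v) (hcont v i) fun y n => by
      rw [← η.2.2.1 (x, y) n]
      simp [latt, lattV]
  have hi := fun v i => integrableOn_box (hcont v i)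
  have e : ∀ y, (dM 2 η).1 (x, y) ![ey 0, ey 1, ey 2] =
      (fderiv ℝ (fun q => η.1 q ![ey 1, ey 2]) (x, y) ∘L
        ContinuousLinearMap.inr ℝ V3 V3) (EuclideanSpace.single 0 1) -
      (fderiv ℝ (fun q => η.1 q ![ey 0, ey 2]) (x, y) ∘L
        ContinuousLinearMap.inr ℝ V3 V3) (EuclideanSpace.single 1 1) +
      (fderiv ℝ (fun q => η.1 q ![ey 0, ey 1]) (x, y) ∘L
        ContinuousLinearMap.inr ℝ V3 V3) (EuclideanSpace.single 2 1) := fun y =>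
    dM_two_apply η (hc y) _ _ _
  change ∫ y in box, (dM 2 η).1 (x, y) ![ey 0, ey 1, ey 2] = 0
  simp only [e]
  refine (integral_add ((hi _ 0).sub (hi _ 1)) (hi _ 2)).trans
    ((congrArg₂ (· + ·) (integral_sub (hi _ 0) (hi _ 1)) (hz _ 2)).trans ?_)
  rw [hz, hz]
  simp

theorem torusPeriod_gammaM {x : V3} (hx : ‖x‖ = 1) :
    torusPeriod x (wedgeM contactM gammaM) = 1 := by
  change ∫ y in box, (wedgeM contactM gammaM).1 (x, y) ![ey 0, ey 1, ey 2] = 1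
  simp only [wedgeM_gammaM_ey (norm_eq_one_iff_mem.2 hx)]
  simp [measureReal_def, volume_box]

theorem PiM_gammaM_ne : PiM ⟨gammaM, gammaM_mem⟩ ≠ 0 := by
  intro h
  obtain ⟨η, hη⟩ := (Submodule.Quotient.mk_eq_zero _).1 h
  have hη' : dM 2 η = wedgeM contactM gammaM := hη
  have hx : ‖(EuclideanSpace.single 0 1 : V3)‖ = 1 := by simp
  have h1 := torusPeriod_gammaM hx
  rw [← hη', torusPeriod_dM hx] at h1
  exact zero_ne_one h1

/-- The `y`-slice of a form on `Z`. -/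
theorem contDiffOn_slice {k : ℕ} (α : FormZ k) (v : Fin k → C3) (y : V3) :
    ContDiffOn ℝ ∞ (fun x => α.1 (x, y) v) ball3 :=
  (contDiffOn_alt_apply (v := fun i _ => v i) α.2.1 fun _ => contDiffOn_const).comp
    (contDiff_id.prodMk contDiff_const).contDiffOn fun _ hx => mk_mem_tube.2 hx

theorem fderivWithin_slice {k : ℕ} (α : FormZ k) (v : Fin k → C3) {x : V3} (hx : x ∈ ball3)
    (y a : V3) : fderivWithin ℝ (fun x => α.1 (x, y) v) ball3 x a =
      fderivWithin ℝ (fun q => α.1 q v) tube (x, y) (a, 0) := by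
  have h : HasFDerivWithinAt (fun x => α.1 (x, y) v)
      (fderivWithin ℝ (fun q => α.1 q v) tube (x, y) ∘L ContinuousLinearMap.inl ℝ V3 V3) ball3 x :=
    (hasFDerivWithinAt_form α (mk_mem_tube.2 hx) v).comp (s := ball3) x (f := fun x => (x, y))
      (hasFDerivAt_prodMk_left x y).hasFDerivWithinAt fun z hz => mk_mem_tube.2 hz
  rw [h.fderivWithin (uniqueDiffOn_ball3 x hx)]
  rfl

theorem alt2_bilin (β : Alt 2) (a b : Fin 3 → C3) (s t : Fin 3 → ℝ) :
    β ![∑ i, s i • a i, ∑ j, t j • b j] = ∑ i, ∑ j, s i * t j * β ![a i, b j] := by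
  have e : ∀ x y : C3, β ![x, y] = β.curryLeft x ![y] := fun x y => rfl
  have e2 : ∀ x : C3, β ![x, ∑ j, t j • b j] = ∑ j, t j * β ![x, b j] := by
    intro x
    rw [alt2_swap, e, map_sum]
    simp only [map_smul, ContinuousAlternatingMap.sum_apply, ContinuousAlternatingMap.smul_apply,
      ← e, smul_eq_mul, ← Finset.sum_neg_distrib]
    refine Finset.sum_congr rfl fun j _ => ?_
    rw [alt2_swap β x (b j)]
    ring
  rw [e, map_sum]
  simp only [map_smul, ContinuousAlternatingMap.sum_apply, ContinuousAlternatingMap.smul_apply,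
      ← e, smul_eq_mul, e2, Finset.mul_sum, mul_assoc]

theorem mk_eq_sum (a : V3) : ((a, 0) : C3) = ∑ i, a i • ex i := by
  rw [Fin.sum_univ_three]
  refine Prod.ext ?_ (by simp [ex])
  conv_lhs => rw [V3_eq_sum a, Fin.sum_univ_three]
  simp [ex]

/-- A `2`-form on `ℝ³` vanishing on the plane `x^⊥` is dual to a vector orthogonal to `x`. -/
theorem alt2_radial_component {β : Alt 2} {p : C3} (hp : p ∈ tubeBdry)
    (h : ∀ a ∈ tangentM p, ∀ b ∈ tangentM p, β ![a, b] = 0) :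
    p.1 0 * β ![ex 1, ex 2] - p.1 1 * β ![ex 0, ex 2] + p.1 2 * β ![ex 0, ex 1] = 0 := by
  have hs := sum_sq_of_mem hp
  set x := p.1 with hx
  have key : ∀ u v : V3, inner ℝ x u = 0 → inner ℝ x v = 0 →
      (u 0 * v 1 - u 1 * v 0) * β ![ex 0, ex 1] + (u 0 * v 2 - u 2 * v 0) * β ![ex 0, ex 2] +
        (u 1 * v 2 - u 2 * v 1) * β ![ex 1, ex 2] = 0 := by
    intro u v hu hv
    have := h (u, 0) hu (v, 0) hv
    rw [mk_eq_sum, mk_eq_sum, alt2_bilin] at this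
    simp only [Fin.sum_univ_three] at this
    have s : ∀ i, β ![ex i, ex i] = 0 := fun i => self_eq_neg.1 (alt2_swap β (ex i) (ex i))
    rw [s, s, s, alt2_swap β (ex 1) (ex 0), alt2_swap β (ex 2) (ex 0),
      alt2_swap β (ex 2) (ex 1)] at this
    linear_combination this
  -- The test vectors are `x × e₀`, `x × e₁`, `x × e₂`, all orthogonal to `x`. The three relations,
  -- weighted with the `xᵢ`, give `|x|²` times the claim.
  have k1 := key !₂[0, x 2, -x 1] !₂[-x 2, 0, x 0] (by rw [inner_V3]; simp; ring)
    (by rw [inner_V3]; simp; ring)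
  have k2 := key !₂[0, x 2, -x 1] !₂[x 1, -x 0, 0] (by rw [inner_V3]; simp; ring)
    (by rw [inner_V3]; simp; ring)
  have k3 := key !₂[-x 2, 0, x 0] !₂[x 1, -x 0, 0] (by rw [inner_V3]; simp; ring)
    (by rw [inner_V3]; simp; ring)
  simp at k1 k2 k3
  linear_combination -(x 0 * β ![ex 1, ex 2] - x 1 * β ![ex 0, ex 2] + x 2 * β ![ex 0, ex 1]) * hs +
    x 0 * k3 - x 1 * k2 + x 2 * k1

/-- On a slice, `α` is dual to a vector field whose divergence is the integrand. That `α` vanishes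
on `TM` makes this field tangent to the sphere, by `alt2_radial_component`, and `integral_ball3_div`
applies. -/
theorem ballPeriod_dZ (y : V3) {α : FormZ 2} (h : restr 2 α = 0) : ballPeriod y (dZ 2 α) = 0 := by
  have hdiv := integral_ball3_div
    (V := ![fun x => α.1 (x, y) ![ex 1, ex 2], fun x => -α.1 (x, y) ![ex 0, ex 2],
      fun x => α.1 (x, y) ![ex 0, ex 1]])
    (by
      intro i
      fin_cases i
      · exact contDiffOn_slice α _ y
      · exact (contDiffOn_slice α _ y).neg
      · exact contDiffOn_slice α _ y)
    (fun x hx => by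
      have hp : (x, y) ∈ tubeBdry := norm_eq_one_iff_mem.2 hx
      have := alt2_radial_component (β := α.1 (x, y)) hp fun a ha b hb => by
        rw [← restr_apply_bdry α hp (by intro i; fin_cases i <;> assumption), h]
        rfl
      rw [Fin.sum_univ_three]
      simp
      linear_combination this)
  rw [ballPeriod, ← hdiv]
  refine setIntegral_congr_fun Metric.isClosed_closedBall.measurableSet fun x hx => ?_
  simp only [dZ_two_apply α (mk_mem_tube.2 hx), Fin.sum_univ_three]
  have e : fderivWithin ℝ (fun x => -α.1 (x, y) ![ex 0, ex 2]) ball3 x (EuclideanSpace.single 1 1) =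
      -fderivWithin ℝ (fun x => α.1 (x, y) ![ex 0, ex 2]) ball3 x (EuclideanSpace.single 1 1) := by
    rw [fderivWithin_fun_neg (uniqueDiffOn_ball3 x hx)]
    rfl
  simp only [Matrix.cons_val_zero, Matrix.cons_val_one, Matrix.cons_val, e, fderivWithin_slice α _ hx]
  simp only [ex]
  ring

theorem ballPeriod_two_chiZ (y : V3) : ballPeriod y ((2 : ℝ) • chiZ) ≠ 0 := by
  have e : ballPeriod y ((2 : ℝ) • chiZ) = ∫ x in ball3, (2 : ℝ) := by
    refine setIntegral_congr_fun Metric.isClosed_closedBall.measurableSet fun x hx => ?_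
    beta_reduce
    rw [two_chiZ_apply (mk_mem_tube.2 hx)]
    simp [det3, ex]
  rw [e]
  simp only [integral_const, smul_eq_mul, ne_eq, mul_eq_zero, not_or]
  refine ⟨?_, by norm_num⟩
  rw [measureReal_restrict_apply_univ]
  exact (ENNReal.toReal_pos (Metric.measure_closedBall_pos volume _ one_pos).ne'
    measure_closedBall_lt_top.ne).ne'

theorem ballPeriod_smul (y : V3) (c : ℝ) (ρ : FormZ 3) :
    ballPeriod y (c • ρ) = c * ballPeriod y ρ :=
  integral_const_mul c _

end

end

/-! ### Calculus and integration for periodic functions on the cone. -/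

noncomputable section

/-- Smooth periodic real functions on `(ℝ³ ∖ 0) × ℝ³`. -/
structure SmoothCone (f : C3 → ℝ) : Prop where
  contDiffOn : ContDiffOn ℝ ∞ f cone
  periodic : ∀ p n, f (p + latt n) = f p

/-- The directional derivative. -/
def pd (v : C3) (f : C3 → ℝ) (p : C3) : ℝ := fderiv ℝ f p v

namespace SmoothCone

variable {f g : C3 → ℝ}

theorem contDiffAt (hf : SmoothCone f) {p : C3} (hp : p ∈ cone) : ContDiffAt ℝ ∞ f p :=
  hf.contDiffOn.contDiffAt (isOpen_cone.mem_nhds hp)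

theorem differentiableAt (hf : SmoothCone f) {p : C3} (hp : p ∈ cone) : DifferentiableAt ℝ f p :=
  (hf.contDiffAt hp).differentiableAt (by simp)

theorem pd (hf : SmoothCone f) (v : C3) : SmoothCone (pd v f) :=
  ⟨(hf.contDiffOn.fderiv_of_isOpen isOpen_cone (m := ∞) (by simp)).clm_apply contDiffOn_const,
    fun p n => by rw [CYTube.pd, CYTube.pd, fderiv_periodic hf.periodic]⟩

theorem mul (hf : SmoothCone f) (hg : SmoothCone g) : SmoothCone fun p => f p * g p :=
  ⟨hf.contDiffOn.mul hg.contDiffOn, fun p n => by rw [hf.periodic, hg.periodic]⟩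

theorem add (hf : SmoothCone f) (hg : SmoothCone g) : SmoothCone fun p => f p + g p :=
  ⟨hf.contDiffOn.add hg.contDiffOn, fun p n => by rw [hf.periodic, hg.periodic]⟩

theorem sub (hf : SmoothCone f) (hg : SmoothCone g) : SmoothCone fun p => f p - g p :=
  ⟨hf.contDiffOn.sub hg.contDiffOn, fun p n => by rw [hf.periodic, hg.periodic]⟩

theorem sum {ι : Type*} {s : Finset ι} {f : ι → C3 → ℝ} (hf : ∀ i, SmoothCone (f i)) :
    SmoothCone fun p => ∑ i ∈ s, f i p :=
  ⟨ContDiffOn.sum fun i _ => (hf i).contDiffOn,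
    fun p n => Finset.sum_congr rfl fun i _ => (hf i).periodic p n⟩

theorem pd_comm (hf : SmoothCone f) {p : C3} (hp : p ∈ cone) (v w : C3) :
    CYTube.pd v (CYTube.pd w f) p = CYTube.pd w (CYTube.pd v f) p := by
  have hd : DifferentiableAt ℝ (fderiv ℝ f) p :=
    ((hf.contDiffOn.fderiv_of_isOpen isOpen_cone (m := ∞) (by simp)).contDiffAt
      (isOpen_cone.mem_nhds hp)).differentiableAt (by simp)
  have e : ∀ v w : C3, CYTube.pd v (CYTube.pd w f) p = fderiv ℝ (fderiv ℝ f) p v w := by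
    intro v w
    have h := hd.hasFDerivAt.clm_apply (hasFDerivAt_const w p)
    have h' : HasFDerivAt (CYTube.pd w f) _ p := h
    rw [CYTube.pd, h'.fderiv]
    simp
  rw [e, e]
  exact ((hf.contDiffAt hp).isSymmSndFDerivAt (by simpa using two_le_inf)).eq v w

end SmoothCone

variable {f g : C3 → ℝ} {p : C3}

theorem pd_mul (hf : SmoothCone f) (hg : SmoothCone g) (hp : p ∈ cone) (v : C3) :
    pd v (fun p => f p * g p) p = pd v f p * g p + f p * pd v g p := by
  have h := (hf.differentiableAt hp).hasFDerivAt.mul (hg.differentiableAt hp).hasFDerivAt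
  have h' : HasFDerivAt (fun p => f p * g p) _ p := h
  rw [pd, h'.fderiv]
  simp [pd]
  ring

theorem pd_add (hf : SmoothCone f) (hg : SmoothCone g) (hp : p ∈ cone) (v : C3) :
    pd v (fun p => f p + g p) p = pd v f p + pd v g p := by
  have h := (hf.differentiableAt hp).hasFDerivAt.add (hg.differentiableAt hp).hasFDerivAt
  have h' : HasFDerivAt (fun p => f p + g p) _ p := h
  rw [pd, h'.fderiv]
  rfl

theorem pd_sub (hf : SmoothCone f) (hg : SmoothCone g) (hp : p ∈ cone) (v : C3) :
    pd v (fun p => f p - g p) p = pd v f p - pd v g p := by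
  have h := (hf.differentiableAt hp).hasFDerivAt.sub (hg.differentiableAt hp).hasFDerivAt
  have h' : HasFDerivAt (fun p => f p - g p) _ p := h
  rw [pd, h'.fderiv]
  rfl

theorem pd_sum {ι : Type*} {s : Finset ι} {f : ι → C3 → ℝ} (hf : ∀ i, SmoothCone (f i))
    (hp : p ∈ cone) (v : C3) : pd v (fun p => ∑ i ∈ s, f i p) p = ∑ i ∈ s, pd v (f i) p := by
  have h := HasFDerivAt.fun_sum (u := s) fun i _ => ((hf i).differentiableAt hp).hasFDerivAt
  rw [pd, h.fderiv]
  simp [pd]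

theorem pd_congr (h : ∀ p ∈ cone, f p = g p) (hp : p ∈ cone) (v : C3) : pd v f p = pd v g p := by
  have : f =ᶠ[nhds p] g := by
    filter_upwards [isOpen_cone.mem_nhds hp] with q hq using h q hq
  rw [pd, pd, this.fderiv_eq]

theorem pd_const (c : ℝ) (v : C3) : pd v (fun _ => c) p = 0 := by simp [pd]

/-- The coordinate `xᵢ`. -/
def xcoord (i : Fin 3) (p : C3) : ℝ := p.1 i

theorem smoothCone_const (c : ℝ) : SmoothCone fun _ => c := ⟨contDiffOn_const, fun _ _ => rfl⟩

theorem smoothCone_xcoord (i : Fin 3) : SmoothCone (xcoord i) :=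
  ⟨((EuclideanSpace.proj (𝕜 := ℝ) i).contDiff.comp contDiff_fst).contDiffOn,
    fun p n => by simp [xcoord, latt]⟩

theorem pd_xcoord (i : Fin 3) (v : C3) : pd v (xcoord i) p = v.1 i := by
  have h : HasFDerivAt (xcoord i)
      (EuclideanSpace.proj (𝕜 := ℝ) i ∘L ContinuousLinearMap.fst ℝ V3 V3) p :=
    (EuclideanSpace.proj (𝕜 := ℝ) i ∘L ContinuousLinearMap.fst ℝ V3 V3).hasFDerivAt
  rw [pd, h.fderiv]
  rfl

theorem ex_apply (i k : Fin 3) : (ex k).1 i = if i = k then 1 else 0 := by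
  simp [ex]

theorem ey_apply (i k : Fin 3) : (ey k).1 i = 0 := by simp [ey]

/-- The radial function `h(|x|²)`. -/
def radial (h : ℝ → ℝ) (p : C3) : ℝ := h (‖p.1‖ ^ 2)

theorem contDiffOn_norm_sq_fst {s : Set C3} : ContDiffOn ℝ ∞ (fun p : C3 => ‖p.1‖ ^ 2) s :=
  (contDiff_fst.norm_sq ℝ).contDiffOn

theorem smoothCone_radial {h : ℝ → ℝ} (hh : ContDiffOn ℝ ∞ h (Ioi 0)) : SmoothCone (radial h) :=
  ⟨hh.comp contDiffOn_norm_sq_fst fun p hp => by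
      have : 0 < ‖p.1‖ := norm_pos_iff.2 hp
      simp only [mem_Ioi]
      positivity,
    fun p n => by simp [radial, latt]⟩

theorem pd_radial {h : ℝ → ℝ} (hh : ContDiffOn ℝ ∞ h (Ioi 0)) (hp : p ∈ cone) (v : C3) :
    pd v (radial h) p = 2 * deriv h (‖p.1‖ ^ 2) * inner ℝ p.1 v.1 := by
  have h0 : 0 < ‖p.1‖ ^ 2 := by
    have : 0 < ‖p.1‖ := norm_pos_iff.2 hp
    positivity
  have h1 : HasDerivAt h _ (‖p.1‖ ^ 2) :=
    ((hh.contDiffAt (Ioi_mem_nhds h0)).differentiableAt (by simp)).hasDerivAt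
  have h2 : HasFDerivAt (fun p : C3 => ‖p.1‖ ^ 2) _ p :=
    (hasFDerivAt_fst (𝕜 := ℝ) (E := V3) (F := V3) (p := p)).norm_sq
  have h3 : HasFDerivAt (radial h) _ p := h1.comp_hasFDerivAt p h2
  rw [pd, h3.fderiv]
  simp
  ring

/-- The vector fields `x × ∂_y` on functions. -/
def crossDy (i : Fin 3) (f : C3 → ℝ) (p : C3) : ℝ :=
  xcoord (i + 1) p * pd (ey (i + 2)) f p - xcoord (i + 2) p * pd (ey (i + 1)) f p

theorem smoothCone_crossDy (hf : SmoothCone f) (i : Fin 3) : SmoothCone (crossDy i f) :=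
  ((smoothCone_xcoord _).mul (hf.pd _)).sub ((smoothCone_xcoord _).mul (hf.pd _))

/-- The radial factor vanishes near `x = 0`, the only place where `f` may be singular. -/
theorem contDiff_radial_mul {h : ℝ → ℝ} (hh : ContDiff ℝ ∞ h) {c : ℝ} (hc : 0 < c)
    (h0 : ∀ t ≤ c, h t = 0) (hf : SmoothCone f) : ContDiff ℝ ∞ fun p => radial h p * f p := by
  refine contDiff_iff_contDiffAt.2 fun p => ?_
  by_cases hp : p ∈ cone
  · exact ((smoothCone_radial hh.contDiffOn).mul hf).contDiffAt hp
  · have h1 : p.1 = 0 := not_not.1 hp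
    have : ∀ᶠ q : C3 in nhds p, ‖q.1‖ ^ 2 < c :=
      ContinuousAt.eventually_lt (by fun_prop) continuousAt_const (by simpa [h1] using hc)
    refine (contDiffAt_const (c := (0 : ℝ))).congr_of_eventuallyEq ?_
    filter_upwards [this] with q hq
    rw [radial, h0 _ hq.le, zero_mul]

section

open MeasureTheory

/-- Lebesgue measure on `ℝ³ × [0,1)³`. -/
def strip : Measure C3 := (volume : Measure V3).prod (volume.restrict box)

theorem strip_eq : strip = (volume : Measure C3).restrict (univ ×ˢ box) := by
  rw [Measure.volume_eq_prod, ← Measure.prod_restrict, Measure.restrict_univ]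
  rfl

theorem integrable_strip (hf : Continuous f) {R : ℝ} (h0 : ∀ p : C3, R < ‖p.1‖ → f p = 0) :
    Integrable f strip := by
  rw [strip_eq]
  have h1 : IntegrableOn f (Metric.closedBall (0 : V3) R ×ˢ box) :=
    (hf.continuousOn.integrableOn_compact
      ((isCompact_closedBall (0 : V3) R).prod (isCompact_closedBall (0 : V3) 2))).mono_set
      (prod_mono_right box_subset_closedBall)
  refine h1.of_forall_sdiff_eq_zero (MeasurableSet.univ.prod measurableSet_box) fun p hp => ?_
  refine h0 p (not_le.1 fun h => hp.2 ⟨by simpa using h, hp.1.2⟩)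

/-- Fubini: for `x`-derivatives the compact support in `x` is used, for `y`-derivatives (next lemma)
the periodicity. -/
theorem integral_strip_pd_fst (hf : ContDiff ℝ 1 f) {R : ℝ} (h0 : ∀ p : C3, R < ‖p.1‖ → f p = 0)
    (i : Fin 3) : ∫ p, pd (ex i) f p ∂strip = 0 := by
  have hz : ∀ p : C3, R < ‖p.1‖ → fderiv ℝ f p = 0 := fun p hp => by
    have : f =ᶠ[nhds p] fun _ => 0 := by
      filter_upwards [(isOpen_lt continuous_const continuous_fst.norm).mem_nhds hp] with q hq
        using h0 q hq
    rw [this.fderiv_eq, fderiv_const_apply]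
  have hi : Integrable (pd (ex i) f) strip :=
    integrable_strip ((hf.continuous_fderiv (by simp)).clm_apply continuous_const)
      fun p hp => by rw [pd, hz p hp]; rfl
  rw [strip, integral_prod_symm _ hi]
  refine integral_eq_zero_of_ae (Filter.Eventually.of_forall fun y => ?_)
  have hs : ContDiff ℝ 1 fun x => f (x, y) := hf.comp (contDiff_id.prodMk contDiff_const)
  have hd : ∀ x, pd (ex i) f (x, y) = fderiv ℝ (fun x => f (x, y)) x (EuclideanSpace.single i 1) := by
    intro x
    have h : HasFDerivAt (fun x => f (x, y)) (fderiv ℝ f (x, y) ∘L ContinuousLinearMap.inl ℝ V3 V3) x :=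
      HasFDerivAt.comp (f := fun x => (x, y)) x (hf.differentiable (by simp) (x, y)).hasFDerivAt (hasFDerivAt_prodMk_left x y)
    rw [h.fderiv]
    rfl
  simp only [hd]
  exact integral_fderiv_of_hasCompactSupport hs
    (HasCompactSupport.intro (isCompact_closedBall (0 : V3) R) fun x hx =>
      h0 (x, y) (not_le.1 fun h => hx (by simpa using h))) _

theorem integral_strip_pd_snd (hf : ContDiff ℝ 1 f) (hper : ∀ p n, f (p + latt n) = f p) {R : ℝ}
    (h0 : ∀ p : C3, R < ‖p.1‖ → f p = 0) (i : Fin 3) : ∫ p, pd (ey i) f p ∂strip = 0 := by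
  have hz : ∀ p : C3, R < ‖p.1‖ → fderiv ℝ f p = 0 := fun p hp => by
    have : f =ᶠ[nhds p] fun _ => 0 := by
      filter_upwards [(isOpen_lt continuous_const continuous_fst.norm).mem_nhds hp] with q hq
        using h0 q hq
    rw [this.fderiv_eq, fderiv_const_apply]
  have hc : Continuous (pd (ey i) f) :=
    (hf.continuous_fderiv (by simp)).clm_apply continuous_const
  have hi : Integrable (pd (ey i) f) strip :=
    integrable_strip hc fun p hp => by rw [pd, hz p hp]; rfl
  rw [strip, integral_prod _ hi]
  refine integral_eq_zero_of_ae (Filter.Eventually.of_forall fun x => ?_)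
  refine setIntegral_box_fderiv (h := fun y => f (x, y))
    (h' := fun y => fderiv ℝ f (x, y) ∘L ContinuousLinearMap.inr ℝ V3 V3) i (fun y => ?_) ?_
    fun y n => ?_
  · exact (hf.differentiable (by simp) (x, y)).hasFDerivAt.comp y (hasFDerivAt_prodMk_right x y)
  · exact hc.comp (by fun_prop : Continuous fun y : V3 => (x, y))
  · rw [← hper (x, y) n]
    simp [latt, lattV]

/-- The function vanishes almost everywhere on the strip, hence by continuity on the closure of its
interior. Every point of the half-open cube lies in that closure, being a limit of points moved
towards the centre `c`; periodicity covers the rest. -/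
theorem eq_zero_of_integral_strip (hf : Continuous f) (hn : ∀ p, 0 ≤ f p)
    (hper : ∀ p n, f (p + latt n) = f p) {R : ℝ} (h0 : ∀ p : C3, R < ‖p.1‖ → f p = 0)
    (hi : ∫ p, f p ∂strip = 0) (p : C3) : f p = 0 := by
  have h1 := (integral_eq_zero_iff_of_nonneg hn (integrable_strip hf h0)).1 hi
  rw [strip_eq] at h1
  have hcl : (univ ×ˢ box : Set C3) ⊆ closure (interior (univ ×ˢ box)) := by
    rw [interior_prod_eq, closure_prod_eq, interior_univ, closure_univ]
    refine prod_mono_right ?_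
    intro y hy
    have hsub : {z : V3 | ∀ i, z i ∈ Ioo (0 : ℝ) 1} ⊆ interior box := by
      refine interior_maximal (fun z hz i => ⟨(hz i).1.le, (hz i).2⟩) ?_
      simp only [ofPred_forall]
      exact isOpen_iInter_of_finite fun i => isOpen_Ioo.preimage (by fun_prop)
    refine closure_mono hsub ?_
    let c : V3 := WithLp.toLp 2 fun _ => 1 / 2
    have ht : Filter.Tendsto (fun t : ℝ => y + t • (c - y)) (nhdsWithin 0 (Ioi 0)) (nhds y) := by
      have : Filter.Tendsto (fun t : ℝ => y + t • (c - y)) (nhds 0) (nhds (y + (0 : ℝ) • (c - y))) :=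
        Continuous.tendsto (by fun_prop) 0
      rw [zero_smul, add_zero] at this
      exact this.mono_left nhdsWithin_le_nhds
    refine mem_closure_of_tendsto ht ?_
    filter_upwards [Ioo_mem_nhdsGT (zero_lt_one' ℝ)] with t ht i
    have h1 := hy i
    have e : (y + t • (c - y)) i = y i + t * (1 / 2 - y i) := by simp [c]
    rw [e]
    constructor <;> nlinarith [h1.1, h1.2, ht.1, ht.2]
  have h2 := Measure.eqOn_of_ae_eq h1 hf.continuousOn continuousOn_const hcl
  have h3 : p + latt (fun i => -⌊p.2 i⌋) ∈ univ ×ˢ box := by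
    refine ⟨trivial, fun i => ?_⟩
    simp only [latt, Prod.snd_add, PiLp.add_apply, Int.cast_neg]
    exact ⟨by linarith [Int.floor_le (p.2 i)], by linarith [Int.lt_floor_add_one (p.2 i)]⟩
  rw [← hper p (fun i => -⌊p.2 i⌋)]
  exact h2 h3

end

end

/-! ### The energy estimate. -/

noncomputable section

variable {u : C3 → ℝ} {p : C3}

/-- A bump function centred at `r` with outer radius `r/2`, applied below to `|x|²`: it stays away
from the singular set `x = 0` and from infinity. -/
theorem exists_cutoff {r : ℝ} (hr : 0 < r) : ∃ φ : ℝ → ℝ, ContDiff ℝ ∞ φ ∧ (∀ t, 0 ≤ φ t) ∧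
    φ r = 1 ∧ (∀ t ≤ r / 2, φ t = 0) ∧ ∀ t, 2 * r ≤ t → φ t = 0 := by
  let b : ContDiffBump r := ⟨r / 4, r / 2, by positivity, by linarith⟩
  refine ⟨b, b.contDiff, fun t => b.nonneg, b.one_of_mem_closedBall (by simp [b]; positivity),
    fun t ht => b.zero_of_le_dist ?_, fun t ht => b.zero_of_le_dist ?_⟩
  · rw [Real.dist_eq, abs_of_nonpos (by linarith)]
    change r / 2 ≤ _
    linarith
  · rw [Real.dist_eq, abs_of_nonneg (by linarith)]
    change r / 2 ≤ _
    linarith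

theorem pd_radial_mul_eq_zero {h : ℝ → ℝ} {c : ℝ} (hc : 0 < c) (h0 : ∀ t ≤ c, h t = 0) (f : C3 → ℝ)
    (hp : p ∉ cone) (v : C3) : pd v (fun p => radial h p * f p) p = 0 := by
  have h1 : p.1 = 0 := not_not.1 hp
  have h2 : ∀ᶠ q : C3 in nhds p, ‖q.1‖ ^ 2 < c :=
    ContinuousAt.eventually_lt (by fun_prop) continuousAt_const (by simpa [h1] using hc)
  have h3 : (fun p => radial h p * f p) =ᶠ[nhds p] fun _ => 0 := by
    filter_upwards [h2] with q hq
    rw [radial, h0 _ hq.le, zero_mul]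
  rw [pd, h3.fderiv_eq]
  simp

theorem inner_ex (p : C3) (i : Fin 3) : inner ℝ p.1 (ex i).1 = xcoord i p := by
  change inner ℝ p.1 (EuclideanSpace.single i (1 : ℝ)) = _
  rw [EuclideanSpace.inner_single_right]
  simp [xcoord]

open MeasureTheory in
/-- The energy estimate for solutions `u`, constant along the rays, of
`|x|⁴ Δₓ u + ε ∑ᵢ (x × ∂_y)ᵢ² u = 0` with `ε ≥ 0`. -/
theorem energy (hu : SmoothCone u) (hE : ∀ p ∈ cone, ∑ i, xcoord i p * pd (ex i) u p = 0)
    {ε : ℝ} (hε : 0 ≤ ε) (hP : ∀ p ∈ cone, (‖p.1‖ ^ 2) ^ 2 * ∑ i, pd (ex i) (pd (ex i) u) p +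
      ε * ∑ i, crossDy i (crossDy i u) p = 0) (hp : p ∈ cone) :
    (∀ i, pd (ex i) u p = 0) ∧ ∀ i, ε * crossDy i u p ^ 2 = 0 := by
  set r := ‖p.1‖ ^ 2 with hr
  have hr0 : 0 < r := by
    have : 0 < ‖p.1‖ := norm_pos_iff.2 hp
    positivity
  obtain ⟨φ, hφ, hφ0, hφ1, hφs, hφl⟩ := exists_cutoff hr0
  -- Chosen so that `radial h = |x|⁴ · radial φ`, matching the coefficient of `Δₓ` in the equation.
  let h : ℝ → ℝ := fun t => φ t * t ^ 2
  have hh : ContDiff ℝ ∞ h := hφ.mul (contDiff_id.pow 2)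
  have hhs : ∀ t ≤ r / 2, h t = 0 := fun t ht => by simp [h, hφs t ht]
  have hhl : ∀ t, 2 * r ≤ t → h t = 0 := fun t ht => by simp [h, hφl t ht]
  -- `r` is a squared norm; `(r+1)² ≥ 2r` makes `r + 1` a bound for the support in terms of `|x|`.
  have hR : ∀ q : C3, r + 1 < ‖q.1‖ → 2 * r ≤ ‖q.1‖ ^ 2 := fun q hq => by nlinarith
  have hr2 : 0 < r / 2 := by positivity
  let A : Fin 3 → C3 → ℝ := fun i q => radial h q * (u q * pd (ex i) u q)
  let B : Fin 3 → Fin 3 → C3 → ℝ := fun i j q => radial φ q * (xcoord j q * (u q * crossDy i u q))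
  let G : C3 → ℝ := fun q => radial h q * ∑ i, pd (ex i) u q * pd (ex i) u q +
    radial φ q * (ε * ∑ i, crossDy i u q * crossDy i u q)
  have sA : ∀ i, SmoothCone fun q => u q * pd (ex i) u q := fun i => hu.mul (hu.pd _)
  have sK := fun i => smoothCone_crossDy hu i
  have sB' : ∀ i, SmoothCone fun q => u q * crossDy i u q := fun i => hu.mul (sK i)
  have sB : ∀ i j, SmoothCone fun q => xcoord j q * (u q * crossDy i u q) := fun i j =>
    (smoothCone_xcoord j).mul (sB' i)
  have cA : ∀ i, ContDiff ℝ ∞ (A i) := fun i => contDiff_radial_mul hh hr2 hhs (sA i)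
  have cB : ∀ i j, ContDiff ℝ ∞ (B i j) := fun i j => contDiff_radial_mul hφ hr2 hφs (sB i j)
  have sG1 : SmoothCone fun q => ∑ i, pd (ex i) u q * pd (ex i) u q :=
    .sum fun i => (hu.pd _).mul (hu.pd _)
  have sG2 : SmoothCone fun q => ε * ∑ i, crossDy i u q * crossDy i u q :=
    (smoothCone_const ε).mul (.sum fun i => (sK i).mul (sK i))
  have cG : ContDiff ℝ ∞ G :=
    (contDiff_radial_mul hh hr2 hhs sG1).add (contDiff_radial_mul hφ hr2 hφs sG2)
  have zA : ∀ i, ∀ q : C3, r + 1 < ‖q.1‖ → A i q = 0 := fun i q hq => by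
    simp [A, radial, hhl _ (hR q hq)]
  have zB : ∀ i j, ∀ q : C3, r + 1 < ‖q.1‖ → B i j q = 0 := fun i j q hq => by
    simp [B, radial, hφl _ (hR q hq)]
  have zG : ∀ q : C3, r + 1 < ‖q.1‖ → G q = 0 := fun q hq => by
    simp [G, radial, hφl _ (hR q hq), hhl _ (hR q hq)]
  -- The energy density `G` is a divergence. The derivatives of `radial h` meet only the Euler
  -- derivative of `u`, which is zero by `hE`; the `y`-derivatives do not see `radial φ`; the
  -- second-order terms cancel by `hP`.
  have key : ∀ q, G q = ∑ i, (pd (ex i) (A i) q +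
      ε * (pd (ey (i + 2)) (B i (i + 1)) q - pd (ey (i + 1)) (B i (i + 2)) q)) := by
    intro q
    by_cases hq : q ∈ cone
    · have rh := smoothCone_radial hh.contDiffOn
      have rφ := smoothCone_radial hφ.contDiffOn
      have eA : ∀ i, pd (ex i) (A i) q = 2 * deriv h (‖q.1‖ ^ 2) * u q *
          (xcoord i q * pd (ex i) u q) + radial h q *
          (pd (ex i) u q * pd (ex i) u q + u q * pd (ex i) (pd (ex i) u) q) := fun i => by
        simp only [A]
        rw [pd_mul rh (sA i) hq, pd_mul hu (hu.pd _) hq, pd_radial hh.contDiffOn hq, inner_ex]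
        ring
      have eB : ∀ i j k, pd (ey k) (B i j) q = radial φ q * (xcoord j q *
          (pd (ey k) u q * crossDy i u q + u q * pd (ey k) (crossDy i u) q)) := fun i j k => by
        simp only [B]
        rw [pd_mul rφ (sB i j) hq, pd_mul (smoothCone_xcoord j) (sB' i) hq, pd_mul hu (sK i) hq,
          pd_radial hφ.contDiffOn hq, pd_xcoord, ey_apply]
        simp [ey]
      have eK : ∀ i, pd (ey (i + 2)) (B i (i + 1)) q - pd (ey (i + 1)) (B i (i + 2)) q =
          radial φ q * (crossDy i u q * crossDy i u q + u q * crossDy i (crossDy i u) q) := fun i => by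
        have e1 : crossDy i u q = xcoord (i + 1) q * pd (ey (i + 2)) u q -
          xcoord (i + 2) q * pd (ey (i + 1)) u q := rfl
        have e2 : crossDy i (crossDy i u) q = xcoord (i + 1) q * pd (ey (i + 2)) (crossDy i u) q -
          xcoord (i + 2) q * pd (ey (i + 1)) (crossDy i u) q := rfl
        rw [eB, eB, e2]
        linear_combination (-(radial φ q * crossDy i u q)) * e1
      have eh : radial h q = radial φ q * (‖q.1‖ ^ 2) ^ 2 := rfl
      simp only [eA, eK, G, Finset.sum_add_distrib, ← Finset.mul_sum, hE q hq, mul_add]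
      rw [eh]
      linear_combination -(radial φ q * u q) * hP q hq
    · have h1 : q.1 = 0 := not_not.1 hq
      have e1 : ∀ i v, pd v (A i) q = 0 := fun i v => pd_radial_mul_eq_zero hr2 hhs _ hq v
      have e2 : ∀ i j v, pd v (B i j) q = 0 := fun i j v => pd_radial_mul_eq_zero hr2 hφs _ hq v
      simp [e1, e2, G, radial, h1, hφs 0 hr2.le, hhs 0 hr2.le]
  have one_le : (1 : WithTop ℕ∞) ≤ ∞ := by simp
  have iA := fun i => integral_strip_pd_fst ((cA i).of_le one_le) (zA i) i
  have perB : ∀ i j q n, B i j (q + latt n) = B i j q := fun i j =>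
    ((smoothCone_radial hφ.contDiffOn).mul (sB i j)).periodic
  have perG : ∀ q n, G (q + latt n) = G q :=
    (((smoothCone_radial hh.contDiffOn).mul sG1).add
      ((smoothCone_radial hφ.contDiffOn).mul sG2)).periodic
  have iB := fun i j k => integral_strip_pd_snd ((cB i j).of_le one_le) (perB i j) (zB i j) k
  have hz : ∀ {f : C3 → ℝ}, ContDiff ℝ ∞ f → (∀ q : C3, r + 1 < ‖q.1‖ → f q = 0) → ∀ v,
      Integrable (pd v f) strip := by
    intro f hf h0 v
    refine integrable_strip (R := r + 1) ((hf.continuous_fderiv (by simp)).clm_apply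
      continuous_const) fun q hq => ?_
    have : f =ᶠ[nhds q] fun _ => 0 := by
      filter_upwards [(isOpen_lt continuous_const continuous_fst.norm).mem_nhds hq] with q hq
        using h0 q hq
    rw [pd, this.fderiv_eq]
    simp
  have hG : ∫ q, G q ∂strip = 0 := by
    simp only [key]
    refine (integral_finsetSum _ fun i _ => (hz (cA i) (zA i) _).add
      (((hz (cB i _) (zB i _) _).sub (hz (cB i _) (zB i _) _)).const_mul ε)).trans ?_
    refine Finset.sum_eq_zero fun i _ => ?_
    refine (integral_add (hz (cA i) (zA i) _)
      (((hz (cB i _) (zB i _) _).sub (hz (cB i _) (zB i _) _)).const_mul ε)).trans ?_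
    rw [iA, integral_const_mul]
    refine (congrArg (fun t => 0 + ε * t)
      (integral_sub (hz (cB i _) (zB i _) _) (hz (cB i _) (zB i _) _))).trans ?_
    rw [iB, iB]
    simp
  have n1 : ∀ q, 0 ≤ ∑ i, pd (ex i) u q * pd (ex i) u q := fun q =>
    Finset.sum_nonneg fun i _ => mul_self_nonneg _
  have n2 : ∀ q, 0 ≤ ε * ∑ i, crossDy i u q * crossDy i u q := fun q =>
    mul_nonneg hε (Finset.sum_nonneg fun i _ => mul_self_nonneg _)
  have hnn : ∀ q, 0 ≤ G q := fun q => add_nonneg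
    (mul_nonneg (mul_nonneg (hφ0 _) (sq_nonneg _)) (n1 q)) (mul_nonneg (hφ0 _) (n2 q))
  -- `G` is nonnegative with integral zero. At `p` the cutoff is 1 and both parts of `G` are
  -- nonnegative, so each vanishes.
  have fin := eq_zero_of_integral_strip cG.continuous hnn perG zG hG p
  have e1 : radial φ p = 1 := hφ1
  have e2 : radial h p = r ^ 2 := by simp [radial, h, ← hr, hφ1]
  simp only [G, e1, e2, one_mul] at fin
  have f1 : ∑ i, pd (ex i) u p * pd (ex i) u p = 0 := by
    have h2 : r ^ 2 * ∑ i, pd (ex i) u p * pd (ex i) u p = 0 := by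
      have := mul_nonneg (sq_nonneg r) (n1 p)
      linarith [n2 p]
    exact (mul_eq_zero.1 h2).resolve_left (by positivity)
  rw [f1, mul_zero, zero_add] at fin
  refine ⟨fun i => ?_, fun i => ?_⟩
  · exact mul_self_eq_zero.1 ((Finset.sum_eq_zero_iff_of_nonneg fun i _ => mul_self_nonneg _).1 f1 i
      (Finset.mem_univ i))
  · rcases mul_eq_zero.1 fin with h | h
    · rw [h, zero_mul]
    · rw [sq, (Finset.sum_eq_zero_iff_of_nonneg fun i _ => mul_self_nonneg _).1 h i
        (Finset.mem_univ i), mul_zero]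

end

/-! ### The components of `θ ∧ γ` for `γ ∈ ℋ_M`. -/

noncomputable section

variable {p : C3}

theorem forall_fin_three {P : Fin 3 → Prop} (h0 : P 0) (h1 : P 1) (h2 : P 2) : ∀ i, P i := by
  intro i; fin_cases i <;> assumption

theorem fin_three_add : (1 : Fin 3) + 1 = 2 ∧ (1 : Fin 3) + 2 = 0 ∧ (2 : Fin 3) + 1 = 0 ∧
    (2 : Fin 3) + 2 = 1 := ⟨rfl, rfl, rfl, rfl⟩

theorem eq_zero_of_basis_real {F : C3 → ℝ} (hF : ∀ u v : C3, ∀ s : ℝ, F (u + s • v) = F u + s * F v)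
    (hx : ∀ k, F (ex k) = 0) (hy : ∀ k, F (ey k) = 0) (v : C3) : F v = 0 := by
  have := eq_zero_of_basis (F := fun v => (F v : ℂ)) (fun u v s => by rw [hF]; push_cast; rfl)
    (fun k => by simp [hx k]) (fun k => by simp [hy k]) v
  exact_mod_cast this

theorem fderiv_retr_apply_fst (hp : p ∈ cone) (a : V3) : fderiv ℝ retr p (a, 0) =
    ‖p.1‖⁻¹ • (((a - (inner ℝ p.1 a / ‖p.1‖ ^ 2) • p.1), 0) : C3) := by
  have hn : ‖p.1‖ ≠ 0 := norm_ne_zero_iff.2 hp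
  have hf : HasFDerivAt (fun q : C3 => q.1) (ContinuousLinearMap.fst ℝ V3 V3) p := hasFDerivAt_fst
  have hd : DifferentiableAt ℝ (fun q : C3 => ‖q.1‖) p := hf.differentiableAt.norm ℝ hp
  have hL : fderiv ℝ (fun q : C3 => ‖q.1‖) p (a, 0) = inner ℝ p.1 a / ‖p.1‖ := by
    have h3 := DFunLike.congr_fun ((hd.hasFDerivAt.pow 2).unique hf.norm_sq) (a, 0)
    have h4 : 2 * ‖p.1‖ * fderiv ℝ (fun q : C3 => ‖q.1‖) p (a, 0) = 2 * inner ℝ p.1 a := by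
      simpa using h3
    rw [eq_div_iff hn]
    linarith
  have h5 := ((hasDerivAt_inv hn).comp_hasFDerivAt p hd.hasFDerivAt).smul hf
  have h6 := DFunLike.congr_fun ((hasFDerivAt_retr hp).fst.unique h5) (a, 0)
  refine Prod.ext ?_ (by rw [fderiv_retr_snd hp]; simp)
  have h7 : (fderiv ℝ retr p (a, 0)).1 = ‖p.1‖⁻¹ • a + (-(‖p.1‖ ^ 2)⁻¹ * (inner ℝ p.1 a / ‖p.1‖)) • p.1 := by
    simpa [hL] using h6
  rw [h7]
  simp only [Prod.smul_mk, smul_sub, smul_smul]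
  rw [sub_eq_add_neg, ← neg_smul]
  congr 2
  field_simp

theorem fderiv_retr_fst_self (hp : p ∈ cone) : fderiv ℝ retr p (p.1, 0) = 0 := by
  have hn : ‖p.1‖ ≠ 0 := norm_ne_zero_iff.2 hp
  rw [fderiv_retr_apply_fst hp, real_inner_self_eq_norm_sq, div_self (by positivity), one_smul,
    sub_self]
  exact smul_zero _

/-- Homogeneity of degree -1 in the `x`-directions: a component of a form on `M` acquires a factor
`|x|⁻¹` for each argument `ex`, which gives the degrees 0, -1, -2 of `compS`, `compR`, `compC`. -/
theorem fderiv_retr_scale (hp : p ∈ cone) (a : V3) :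
    fderiv ℝ retr p (a, 0) = ‖p.1‖⁻¹ • fderiv ℝ retr (retr p) (a, 0) := by
  have hn : ‖p.1‖ ≠ 0 := norm_ne_zero_iff.2 hp
  have h1 : ‖(retr p).1‖ = 1 := norm_of_mem (retr_mem_tubeBdry hp)
  rw [fderiv_retr_apply_fst hp, fderiv_retr_apply_fst (retr_mem_cone hp), h1]
  simp only [retr, inner_smul_left, smul_smul]
  simp
  congr 2
  field_simp

theorem fderiv_retr_ey (hp : p ∈ cone) (i : Fin 3) : fderiv ℝ retr p (ey i) = ey i :=
  fderiv_retr_apply_snd hp _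

/-- A function that is constant along the rays is annihilated by the Euler field. -/
theorem euler_eq_zero {f : C3 → ℝ} (hf : SmoothCone f) (h : ∀ p ∈ cone, f (retr p) = f p)
    (hp : p ∈ cone) : ∑ i, xcoord i p * pd (ex i) f p = 0 := by
  have h1 := (hf.differentiableAt (retr_mem_cone hp)).hasFDerivAt.comp p (hasFDerivAt_retr hp)
  have h2 : f ∘ retr =ᶠ[nhds p] f := by
    filter_upwards [isOpen_cone.mem_nhds hp] with q hq using h q hq
  have h3 := h2.hasFDerivAt_iff.1 h1
  have h4 : fderiv ℝ f p (p.1, 0) = 0 := by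
    rw [h3.fderiv, ContinuousLinearMap.comp_apply, fderiv_retr_fst_self hp, map_zero]
  rw [mk_eq_sum, map_sum] at h4
  simpa [pd, xcoord] using h4

/-- The components of a `3`-form along the torus, and with one and two legs in `ℝ³`. -/
def compS (τ : FormM 3) (p : C3) : ℝ := τ.1 p ![ey 0, ey 1, ey 2]

/-- See `compS`. -/
def compR (τ : FormM 3) (i l : Fin 3) (p : C3) : ℝ := τ.1 p ![ex i, ey (l + 1), ey (l + 2)]

/-- See `compS`. -/
def compC (τ : FormM 3) (m k : Fin 3) (p : C3) : ℝ := τ.1 p ![ex (m + 1), ex (m + 2), ey k]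

theorem smoothCone_form {k : ℕ} (τ : FormM k) (v : Fin k → C3) : SmoothCone fun p => τ.1 p v :=
  ⟨contDiffOn_alt_apply (v := fun i _ => v i) τ.2.1 fun _ => contDiffOn_const,
    fun p n => by rw [τ.2.2.1]⟩

theorem FormM_apply_three (τ : FormM 3) (hp : p ∈ cone) (a b c : C3) : τ.1 p ![a, b, c] =
    τ.1 (retr p) ![fderiv ℝ retr p a, fderiv ℝ retr p b, fderiv ℝ retr p c] := by
  rw [FormM_apply τ hp]
  congr 1
  funext i
  fin_cases i <;> rfl

theorem FormM_apply_two (τ : FormM 2) (hp : p ∈ cone) (a b : C3) : τ.1 p ![a, b] =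
    τ.1 (retr p) ![fderiv ℝ retr p a, fderiv ℝ retr p b] := by
  rw [FormM_apply τ hp]
  congr 1
  funext i
  fin_cases i <;> rfl

theorem alt3_smul0 (β : Alt 3) (t : ℝ) (a b c : C3) : β ![t • a, b, c] = t * β ![a, b, c] := by
  have e : ∀ x : C3, β ![x, b, c] = β.curryLeft x ![b, c] := fun x => rfl
  rw [e, e, map_smul]
  rfl

theorem alt3_smul1 (β : Alt 3) (t : ℝ) (a b c : C3) : β ![a, t • b, c] = t * β ![a, b, c] := by
  rw [alt3_swap01, alt3_smul0, alt3_swap01 β a]; ring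

theorem compS_retr (τ : FormM 3) (hp : p ∈ cone) : compS τ (retr p) = compS τ p := by
  rw [compS, compS, FormM_apply_three τ hp, fderiv_retr_ey hp, fderiv_retr_ey hp, fderiv_retr_ey hp]

theorem compR_retr (τ : FormM 3) (hp : p ∈ cone) (i l : Fin 3) :
    compR τ i l p = ‖p.1‖⁻¹ * compR τ i l (retr p) := by
  have hq := retr_mem_cone hp
  have h2 := FormM_apply_three τ hq (ex i) (ey (l + 1)) (ey (l + 2))
  rw [retr_of_mem (retr_mem_tubeBdry hp), fderiv_retr_ey hq, fderiv_retr_ey hq] at h2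
  rw [compR, compR, FormM_apply_three τ hp (ex i), h2, fderiv_retr_ey hp, fderiv_retr_ey hp, ex,
    fderiv_retr_scale hp, alt3_smul0]

theorem compC_retr (τ : FormM 3) (hp : p ∈ cone) (m k : Fin 3) :
    compC τ m k p = ‖p.1‖⁻¹ ^ 2 * compC τ m k (retr p) := by
  have hq := retr_mem_cone hp
  have h2 := FormM_apply_three τ hq (ex (m + 1)) (ex (m + 2)) (ey k)
  rw [retr_of_mem (retr_mem_tubeBdry hp), fderiv_retr_ey hq] at h2
  rw [compC, compC, FormM_apply_three τ hp (ex (m + 1)), h2, fderiv_retr_ey hp, ex, ex,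
    fderiv_retr_scale hp, fderiv_retr_scale hp, alt3_smul0, alt3_smul1]
  ring

/-- A form pulled back by the radial retraction kills the radial direction. -/
theorem sum_xcoord_compR (τ : FormM 3) (hp : p ∈ cone) (l : Fin 3) :
    ∑ i, xcoord i p * compR τ i l p = 0 := by
  have h : τ.1 p ![((p.1, 0) : C3), ey (l + 1), ey (l + 2)] = 0 := by
    rw [FormM_apply_three τ hp, fderiv_retr_fst_self hp]
    exact (τ.1 (retr p)).map_coord_zero (0 : Fin 3) rfl
  rw [mk_eq_sum] at h
  have e : ∀ x : C3, τ.1 p ![x, ey (l + 1), ey (l + 2)] =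
    (τ.1 p).curryLeft x ![ey (l + 1), ey (l + 2)] := fun x => rfl
  rw [e, map_sum] at h
  simpa [compR, xcoord] using h

section pointwise

variable {γ : FormM 2}

theorem fderiv_retr_ex_eq (hp : p ∈ tubeBdry) (i : Fin 3) :
    fderiv ℝ retr p (ex i) = ex i - p.1 i • normalV p := by
  rw [ex, fderiv_retr_apply_fst (tubeBdry_subset_cone hp), norm_of_mem hp]
  have : inner ℝ p.1 (EuclideanSpace.single i (1 : ℝ)) = p.1 i := inner_ex p i
  rw [this]
  simp [normalV]

/-- For the same reason `ex i` may be replaced by its projection to `TM`, and this projection lies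
in the contact plane, where the conditions of `HM` apply. -/
theorem FormM_ex_left (hp : p ∈ tubeBdry) (i : Fin 3) {w : C3} (hw : w ∈ tangentM p) :
    γ.1 p ![ex i - p.1 i • normalV p, w] = γ.1 p ![ex i, w] := by
  have hc := tubeBdry_subset_cone hp
  rw [FormM_apply_two γ hc (ex i), retr_of_mem hp, fderiv_retr_ex_eq hp, fderiv_retr_tangent hp hw]

theorem ex_sub_mem (hp : p ∈ tubeBdry) (i : Fin 3) : ex i - p.1 i • normalV p ∈ tangentM p := by
  rw [← fderiv_retr_ex_eq hp]
  have := fderiv_retr_mem (tubeBdry_subset_cone hp) (ex i)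
  rwa [retr_of_mem hp] at this

theorem FormM_ex_ex (hp : p ∈ tubeBdry) (i j : Fin 3) :
    γ.1 p ![ex i - p.1 i • normalV p, ex j - p.1 j • normalV p] = γ.1 p ![ex i, ex j] := by
  have hc := tubeBdry_subset_cone hp
  rw [FormM_apply_two γ hc (ex i), retr_of_mem hp, fderiv_retr_ex_eq hp, fderiv_retr_ex_eq hp]

theorem cplx_ex_sub (hp : p ∈ tubeBdry) (i : Fin 3) :
    cplx (ex i - p.1 i • normalV p) = ey i - p.1 i • reeb p := by
  rw [map_sub, map_smul, cplx_ex, cplx_normalV hp]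

theorem ex_sub_mem_contact (hp : p ∈ tubeBdry) (i : Fin 3) :
    ex i - p.1 i • normalV p ∈ contactPlane p := by
  rw [mem_contactPlane hp]
  exact ⟨ex_sub_mem hp i, by simp [ex, normalV]⟩

/-- Type (1,1) for the projections of `ex i` and `ex j`: `I` maps them to `ey` up to Reeb multiples,
which `γ` does not see. -/
theorem HM_xx (hγ : γ ∈ HM) (hp : p ∈ tubeBdry) (i j : Fin 3) :
    γ.1 p ![ex i, ex j] = γ.1 p ![ey i, ey j] := by
  obtain ⟨h1, h2, -, -⟩ := hγ p hp
  have h := h2 _ (ex_sub_mem_contact hp i) _ (ex_sub_mem_contact hp j)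
  rw [cplx_ex_sub hp, cplx_ex_sub hp, alt2_horizontal hp h1 (ey_mem p i) (ey_mem p j),
    FormM_ex_ex hp] at h
  exact h.symm

/-- Type (1,1) in the form `γ(Ia, b) = -γ(a, Ib)`, combined with antisymmetry. -/
theorem HM_xy_symm (hγ : γ ∈ HM) (hp : p ∈ tubeBdry) (i j : Fin 3) :
    γ.1 p ![ex i, ey j] = γ.1 p ![ex j, ey i] := by
  obtain ⟨h1, h2, -, -⟩ := hγ p hp
  have hor : ∀ a ∈ tangentM p, ∀ i, γ.1 p ![a, ey i - p.1 i • reeb p] = γ.1 p ![a, ey i] := by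
    intro a ha i
    have := alt2_horizontal hp h1 ha (ey_mem p i) 0 (p.1 i)
    rwa [zero_smul, sub_zero] at this
  have hi := ex_sub_mem_contact hp i
  have hj := ex_sub_mem_contact hp j
  have h := h2 _ hi _ (cplx_mem_contactPlane hp hj)
  have n : ∀ a b, γ.1 p ![a, -b] = -γ.1 p ![a, b] := fun a b => by
    have e : ∀ x y : C3, γ.1 p ![x, y] = (γ.1 p).curryLeft x ![y] := fun x y => rfl
    rw [alt2_swap, e, map_neg]
    change - -γ.1 p ![b, a] = _
    rw [alt2_swap (γ.1 p) a b, neg_neg]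
  rw [cplx_cplx, n, ← alt2_swap, cplx_ex_sub hp, cplx_ex_sub hp, hor _ (contactPlane_le p hi),
    hor _ (contactPlane_le p hj), FormM_ex_left hp _ (ey_mem p _),
    FormM_ex_left hp _ (ey_mem p _)] at h
  exact h.symm

theorem reeb_eq_sum (hp : p ∈ tubeBdry) : reeb p = ∑ j, p.1 j • ey j := by
  rw [reeb_eq hp, Fin.sum_univ_three]
  refine Prod.ext (by simp [ey]) ?_
  conv_lhs => rw [V3_eq_sum p.1, Fin.sum_univ_three]
  simp [ey]

theorem HM_reeb (hγ : γ ∈ HM) (hp : p ∈ tubeBdry) {a : C3} (ha : a ∈ tangentM p) :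
    ∑ j, p.1 j * γ.1 p ![a, ey j] = 0 := by
  have h := (hγ p hp).1 a ha
  have e : ∀ x y : C3, γ.1 p ![x, y] = (γ.1 p).curryLeft x ![y] := fun x y => rfl
  rw [reeb_eq_sum hp, e, map_sum] at h
  simp only [map_smul, ContinuousAlternatingMap.sum_apply, ContinuousAlternatingMap.smul_apply,
    ← e, smul_eq_mul] at h
  simp only [alt2_swap (γ.1 p) a, mul_neg, Finset.sum_neg_distrib, h, neg_zero]

theorem HM_xy_reeb (hγ : γ ∈ HM) (hp : p ∈ tubeBdry) (i : Fin 3) :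
    ∑ j, p.1 j * γ.1 p ![ex i, ey j] = 0 := by
  have := HM_reeb hγ hp (ex_sub_mem hp i)
  simpa only [FormM_ex_left hp _ (ey_mem p _)] using this

theorem HM_xy_trace (hγ : γ ∈ HM) (hp : p ∈ tubeBdry) : ∑ i, γ.1 p ![ex i, ey i] = 0 := by
  have hxy := fun i j => HM_xy_symm hγ hp i j
  have hr := fun i => HM_xy_reeb hγ hp i
  simp only [Fin.sum_univ_three] at hr ⊢
  obtain ⟨-, -, h3, -⟩ := hγ p hp
  have ω1 : ∀ i j, omegaM.1 p ![ex i - p.1 i • normalV p, ex j - p.1 j • normalV p] = 0 := fun i j => by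
    rw [omegaM_apply hp (ex_sub_mem hp i) (ex_sub_mem hp j)]; simp [ex, normalV]
  have ω2 : ∀ i j, omegaM.1 p ![ey i, ey j] = 0 := fun i j => by
    rw [omegaM_apply hp (ey_mem p i) (ey_mem p j)]; simp [ey]
  have ω3 : ∀ i j, omegaM.1 p ![ex i - p.1 i • normalV p, ey j] =
      (if j = i then 1 else 0) - p.1 i * p.1 j := fun i j => by
    rw [omegaM_apply hp (ex_sub_mem hp i) (ey_mem p j)]
    have : inner ℝ p.1 (EuclideanSpace.single j (1 : ℝ)) = p.1 j := inner_ex p j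
    simp only [ex, ey, normalV, inner_sub_left, inner_smul_left, this, Prod.fst_sub, Prod.smul_fst]
    rw [EuclideanSpace.inner_single_left]
    simp [eq_comm]
  have key : ∀ i j, -(1 - p.1 i * p.1 i) * γ.1 p ![ex j, ey j] +
      ((if j = i then 1 else 0) - p.1 i * p.1 j) * γ.1 p ![ex j, ey i] +
      ((if i = j then 1 else 0) - p.1 j * p.1 i) * γ.1 p ![ex i, ey j] -
      (1 - p.1 j * p.1 j) * γ.1 p ![ex i, ey i] = 0 := by
    intro i j
    have h := h3 ![ex i - p.1 i • normalV p, ex j - p.1 j • normalV p, ey i, ey j] (by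
      intro k
      fin_cases k
      · exact ex_sub_mem hp i
      · exact ex_sub_mem hp j
      · exact ey_mem p i
      · exact ey_mem p j)
    simp only [wedgeTwoTwo] at h
    change omegaM.1 p ![ex i - p.1 i • normalV p, ex j - p.1 j • normalV p] * γ.1 p ![ey i, ey j] -
      omegaM.1 p ![ex i - p.1 i • normalV p, ey i] * γ.1 p ![ex j - p.1 j • normalV p, ey j] +
      omegaM.1 p ![ex i - p.1 i • normalV p, ey j] * γ.1 p ![ex j - p.1 j • normalV p, ey i] +
      omegaM.1 p ![ex j - p.1 j • normalV p, ey i] * γ.1 p ![ex i - p.1 i • normalV p, ey j] -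
      omegaM.1 p ![ex j - p.1 j • normalV p, ey j] * γ.1 p ![ex i - p.1 i • normalV p, ey i] +
      omegaM.1 p ![ey i, ey j] *
        γ.1 p ![ex i - p.1 i • normalV p, ex j - p.1 j • normalV p] = 0 at h
    simp only [ω1, ω2, ω3, FormM_ex_left hp _ (ey_mem p _), if_true] at h
    linear_combination h
  have k01 := key 0 1
  have k02 := key 0 2
  have k12 := key 1 2
  have r0 := hr 0
  have r1 := hr 1
  have r2 := hr 2
  simp only [hxy 1 0, hxy 2 0, hxy 2 1] at *
  have s := sum_sq_of_mem hp
  simp at k01 k02 k12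
  -- With `G = (γ(∂x_i, ∂y_j))` the three relations add up to `-tr G - xᵀGx`, and `Gx = 0` by
  -- `HM_xy_reeb`.
  linear_combination (-(1 : ℝ)) * (k01 + k02 + k12) + (-(p.1 0)) * r0 - p.1 1 * r1 - p.1 2 * r2 +
    (γ.1 p ![ex 0, ey 0] + γ.1 p ![ex 1, ey 1] + γ.1 p ![ex 2, ey 2]) * s

theorem contactM_ex (hp : p ∈ tubeBdry) (i : Fin 3) : contactM.1 p (fun _ => ex i) = 0 := by
  rw [contactM_apply hp]; simp [ex]

theorem contactM_ey (hp : p ∈ tubeBdry) (i : Fin 3) : contactM.1 p (fun _ => ey i) = p.1 i := by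
  rw [contactM_apply hp]; exact inner_ex p i

theorem wedgeM_apply (γ : FormM 2) (p a b c : C3) : (wedgeM contactM γ).1 p ![a, b, c] =
    contactM.1 p (fun _ => a) * γ.1 p ![b, c] - contactM.1 p (fun _ => b) * γ.1 p ![a, c] +
      contactM.1 p (fun _ => c) * γ.1 p ![a, b] :=
  wedgeOne_two_apply _ _ _

theorem compS_wedge (γ : FormM 2) (hp : p ∈ tubeBdry) : compS (wedgeM contactM γ) p =
    p.1 0 * γ.1 p ![ey 1, ey 2] - p.1 1 * γ.1 p ![ey 0, ey 2] + p.1 2 * γ.1 p ![ey 0, ey 1] := by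
  rw [compS, wedgeM_apply, contactM_ey hp, contactM_ey hp, contactM_ey hp]

theorem compR_wedge (γ : FormM 2) (hp : p ∈ tubeBdry) (i l : Fin 3) :
    compR (wedgeM contactM γ) i l p =
      p.1 (l + 2) * γ.1 p ![ex i, ey (l + 1)] - p.1 (l + 1) * γ.1 p ![ex i, ey (l + 2)] := by
  rw [compR, wedgeM_apply, contactM_ex hp, contactM_ey hp, contactM_ey hp]
  ring

theorem compC_wedge (γ : FormM 2) (hp : p ∈ tubeBdry) (m k : Fin 3) :
    compC (wedgeM contactM γ) m k p = p.1 k * γ.1 p ![ex (m + 1), ex (m + 2)] := by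
  rw [compC, wedgeM_apply, contactM_ex hp, contactM_ex hp, contactM_ey hp]
  ring

/-- The `yy`-components of `γ ∈ ℋ_M` are determined by the function `compS`. -/
theorem HM_yy (hγ : γ ∈ HM) (hp : p ∈ tubeBdry) (m : Fin 3) :
    γ.1 p ![ey (m + 1), ey (m + 2)] = p.1 m * compS (wedgeM contactM γ) p := by
  -- The `yy`-part is a 2-form on `ℝ³` killed by `x`, so its dual vector is a multiple of `x`; the
  -- pairing with `x` finds the multiple.
  have hr := fun i => HM_reeb hγ hp (ey_mem p i)
  simp only [Fin.sum_univ_three] at hr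
  have r0 := hr 0
  have r1 := hr 1
  have r2 := hr 2
  have z : ∀ i, γ.1 p ![ey i, ey i] = 0 := fun i => self_eq_neg.1 (alt2_swap _ _ _)
  rw [compS_wedge γ hp]
  have s := sum_sq_of_mem hp
  obtain ⟨f1, f2, f3, f4⟩ := fin_three_add
  revert m
  simp only [z, alt2_swap (γ.1 p) (ey 1) (ey 0), alt2_swap (γ.1 p) (ey 2) (ey 0),
    alt2_swap (γ.1 p) (ey 2) (ey 1)] at *
  refine forall_fin_three ?_ ?_ ?_
  · simp only [zero_add]
    linear_combination (-γ.1 p ![ey 1, ey 2]) * s - p.1 1 * r2 + p.1 2 * r1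
  · simp only [f1, f2, alt2_swap (γ.1 p) (ey 2) (ey 0)]
    linear_combination (γ.1 p ![ey 0, ey 2]) * s - p.1 2 * r0 + p.1 0 * r2
  · simp only [f3, f4]
    linear_combination (-γ.1 p ![ey 0, ey 1]) * s + p.1 1 * r0 - p.1 0 * r1

theorem compC_eq_of_mem (hγ : γ ∈ HM) (hp : p ∈ tubeBdry) (m k : Fin 3) :
    compC (wedgeM contactM γ) m k p = p.1 m * p.1 k * compS (wedgeM contactM γ) p := by
  rw [compC_wedge γ hp, HM_xx hγ hp, HM_yy hγ hp]
  ring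

/-- The row `R_i` is the cross product `G_i × x` of the row of `G = (γ(∂x_i, ∂y_j))` with `x`.
Symmetry of `R` expresses `tr G = 0` and `Gx = 0`; the vanishing trace of `R`, in
`compR_trace_of_mem`, expresses the symmetry of `G`. -/
theorem compR_symm_of_mem (hγ : γ ∈ HM) (hp : p ∈ tubeBdry) :
    ∀ i l, compR (wedgeM contactM γ) i l p = compR (wedgeM contactM γ) l i p := by
  have hxy := fun i j => HM_xy_symm hγ hp i j
  have hr := fun i => HM_xy_reeb hγ hp i
  have ht := HM_xy_trace hγ hp
  simp only [Fin.sum_univ_three] at hr ht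
  have r0 := hr 0
  have r1 := hr 1
  have r2 := hr 2
  obtain ⟨f1, f2, f3, f4⟩ := fin_three_add
  simp only [compR_wedge γ hp]
  simp only [hxy 1 0, hxy 2 0, hxy 2 1] at *
  refine forall_fin_three ?_ ?_ ?_ <;> refine forall_fin_three ?_ ?_ ?_ <;>
    simp only [f1, f2, f3, f4, zero_add, hxy 1 0, hxy 2 0, hxy 2 1]
  · linear_combination r2 - p.1 2 * ht
  · linear_combination p.1 1 * ht - r1
  · linear_combination p.1 2 * ht - r2
  · linear_combination r0 - p.1 0 * ht
  · linear_combination r1 - p.1 1 * ht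
  · linear_combination p.1 0 * ht - r0

theorem compR_trace_of_mem (hγ : γ ∈ HM) (hp : p ∈ tubeBdry) :
    ∑ i, compR (wedgeM contactM γ) i i p = 0 := by
  have hxy := fun i j => HM_xy_symm hγ hp i j
  obtain ⟨f1, f2, f3, f4⟩ := fin_three_add
  simp only [compR_wedge γ hp, Fin.sum_univ_three, f1, f2, f3, f4, zero_add]
  simp only [hxy 1 0, hxy 2 0, hxy 2 1]
  ring

/-- `compS` determines the `yy`-part, and with it the `xx`-part by type. The mixed part is recovered
from `G_i × x = R_i`, since `G_i` is orthogonal to `x`. -/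
theorem eq_zero_of_comp (hγ : γ ∈ HM) (hS : ∀ p ∈ cone, compS (wedgeM contactM γ) p = 0)
    (hR : ∀ p ∈ cone, ∀ i l, compR (wedgeM contactM γ) i l p = 0) : γ = 0 := by
  refine FormM_ext fun p hp v hv => ?_
  have hc := tubeBdry_subset_cone hp
  obtain ⟨f1, f2, f3, f4⟩ := fin_three_add
  have z : ∀ a, γ.1 p ![a, a] = 0 := fun a => self_eq_neg.1 (alt2_swap _ _ _)
  have hyy : ∀ i j, γ.1 p ![ey i, ey j] = 0 := by
    have h := fun m => HM_yy hγ hp m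
    simp only [hS p hc, mul_zero] at h
    have h0 := h 0
    have h1 := h 1
    have h2 := h 2
    simp only [f1, f2, f3, f4, zero_add] at h0 h1 h2
    refine forall_fin_three ?_ ?_ ?_ <;> refine forall_fin_three ?_ ?_ ?_ <;>
      first | exact z _ | assumption | (rw [alt2_swap]; simp only [h0, h1, h2, neg_zero])
  have hxy : ∀ i j, γ.1 p ![ex i, ey j] = 0 := by
    intro i
    have hr := HM_xy_reeb hγ hp i
    have h := fun l => (compR_wedge γ hp i l).symm.trans (hR p hc i l)
    have h0 := h 0
    have h1 := h 1
    have h2 := h 2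
    have s := sum_sq_of_mem hp
    simp only [f1, f2, f3, f4, zero_add, Fin.sum_univ_three] at hr h0 h1 h2
    refine forall_fin_three ?_ ?_ ?_
    · linear_combination (-γ.1 p ![ex i, ey 0]) * s + p.1 0 * hr + p.1 1 * h2 - p.1 2 * h1
    · linear_combination (-γ.1 p ![ex i, ey 1]) * s + p.1 1 * hr + p.1 2 * h0 - p.1 0 * h2
    · linear_combination (-γ.1 p ![ex i, ey 2]) * s + p.1 2 * hr + p.1 0 * h1 - p.1 1 * h0
  have hv2 : v = ![v 0, v 1] := by funext i; fin_cases i <;> rfl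
  have e : ∀ x y : C3, γ.1 p ![x, y] = (γ.1 p).curryLeft x ![y] := fun x y => rfl
  have lin : ∀ (b u v : C3) (s : ℝ), γ.1 p ![u + s • v, b] = γ.1 p ![u, b] + s * γ.1 p ![v, b] := by
    intro b u v s
    rw [e, e, e, map_add, map_smul]
    rfl
  have h1 : ∀ a j, γ.1 p ![a, ey j] = 0 := fun a j =>
    eq_zero_of_basis_real (F := fun a => γ.1 p ![a, ey j]) (lin _) (fun i => hxy i j)
      (fun i => hyy i j) a
  have h2 : ∀ a j, γ.1 p ![a, ex j] = 0 := fun a j =>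
    eq_zero_of_basis_real (F := fun a => γ.1 p ![a, ex j]) (lin _)
      (fun i => by rw [HM_xx hγ hp, hyy]) (fun i => by rw [alt2_swap, hxy, neg_zero]) a
  have h3 : ∀ b a, γ.1 p ![b, a] = 0 := fun b a =>
    eq_zero_of_basis_real (F := fun b => γ.1 p ![b, a]) (lin _)
      (fun i => by rw [alt2_swap, h2, neg_zero]) (fun i => by rw [alt2_swap, h1, neg_zero]) b
  rw [hv2, h3]
  rfl

theorem compR_symm (hγ : γ ∈ HM) (hp : p ∈ cone) (i l : Fin 3) :
    compR (wedgeM contactM γ) i l p = compR (wedgeM contactM γ) l i p := by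
  rw [compR_retr _ hp, compR_retr _ hp l, compR_symm_of_mem hγ (retr_mem_tubeBdry hp)]

theorem compR_trace (hγ : γ ∈ HM) (hp : p ∈ cone) : ∑ i, compR (wedgeM contactM γ) i i p = 0 := by
  simp only [compR_retr _ hp]
  rw [← Finset.mul_sum, compR_trace_of_mem hγ (retr_mem_tubeBdry hp), mul_zero]

/-- The factor `|x|⁻⁴`: two powers from the homogeneity of `compC`, two from the normalisation of
the coordinates. -/
theorem compC_eq (hγ : γ ∈ HM) (hp : p ∈ cone) (m k : Fin 3) :
    compC (wedgeM contactM γ) m k p = radial (fun t => (t ^ 2)⁻¹) p * (xcoord m p * (xcoord k p *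
      compS (wedgeM contactM γ) p)) := by
  rw [compC_retr _ hp, compC_eq_of_mem hγ (retr_mem_tubeBdry hp), compS_retr _ hp]
  simp only [retr, radial, xcoord, PiLp.smul_apply, smul_eq_mul]
  have hn : ‖p.1‖ ≠ 0 := norm_ne_zero_iff.2 hp
  field_simp

end pointwise

end

/-! ### The differential equations for the components. -/

noncomputable section

variable {p : C3} {s : C3 → ℝ}

/-- A function all of whose derivatives along the `xᵢ` vanish, and along the orthogonal
complements of `x` in `iℝ³` too, is constant. -/
theorem exists_eq_const (hs : SmoothCone s) (hx : ∀ p ∈ cone, ∀ i, pd (ex i) s p = 0)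
    (hc : ∀ p ∈ cone, ∀ i, crossDy i s p = 0) : ∃ c, ∀ p ∈ cone, s p = c := by
  have hy : ∀ p ∈ cone, ∀ i, pd (ey (i + 2)) s p = 0 := by
    intro p hp i
    -- In the `x_{i+1}`-derivative of `(x × ∂_y)ᵢ s = 0` only the coefficient is differentiated,
    -- because `s` does not depend on `x`; this leaves `∂s/∂y_{i+2} = 0`.
    have h0 : ∀ v, pd (ex (i + 1)) (pd (ey v) s) p = 0 := fun v => by
      rw [hs.pd_comm hp, pd_congr (fun q hq => hx q hq (i + 1)) hp, pd_const]
    have h := pd_congr (g := fun _ => 0) (fun q hq => hc q hq i) hp (ex (i + 1))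
    rw [pd_const] at h
    change pd (ex (i + 1)) (fun q => xcoord (i + 1) q * pd (ey (i + 2)) s q -
      xcoord (i + 2) q * pd (ey (i + 1)) s q) p = 0 at h
    rw [pd_sub ((smoothCone_xcoord _).mul (hs.pd _)) ((smoothCone_xcoord _).mul (hs.pd _)) hp,
      pd_mul (smoothCone_xcoord _) (hs.pd _) hp, pd_mul (smoothCone_xcoord _) (hs.pd _) hp, h0, h0,
      pd_xcoord, pd_xcoord, ex_apply, ex_apply] at h
    have h12 : ¬ i + 2 = i + 1 := by simp
    simpa [h12] using h
  have hy' : ∀ p ∈ cone, ∀ i, pd (ey i) s p = 0 := fun p hp i => by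
    have := hy p hp (i + 1)
    rwa [add_assoc, show (1 : Fin 3) + 2 = 0 from rfl, add_zero] at this
  have hd : Set.EqOn (fderiv ℝ s) 0 cone := fun p hp => by
    refine ContinuousLinearMap.ext fun v => ?_
    exact eq_zero_of_basis_real (F := fderiv ℝ s p) (fun u v t => by simp) (hx p hp) (hy' p hp) v
  refine ⟨s (ex 0), fun p hp => ?_⟩
  refine isOpen_cone.is_const_of_fderiv_eq_zero isPreconnected_cone
    (fun q hq => (hs.differentiableAt hq).differentiableWithinAt) hd hp ?_
  simp [cone, ex]

theorem pd_ey_radial_mul {h : ℝ → ℝ} (hh : ContDiffOn ℝ ∞ h (Ioi 0)) (hs : SmoothCone s)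
    (hp : p ∈ cone) (j : Fin 3) :
    pd (ey j) (fun q => radial h q * s q) p = radial h p * pd (ey j) s p := by
  rw [pd_mul (smoothCone_radial hh) hs hp, pd_radial hh hp]
  simp [ey]

theorem pd_ey_xcoord_mul (hs : SmoothCone s) (hp : p ∈ cone) (i j : Fin 3) :
    pd (ey j) (fun q => xcoord i q * s q) p = xcoord i p * pd (ey j) s p := by
  rw [pd_mul (smoothCone_xcoord i) hs hp, pd_xcoord, ey_apply]
  ring

theorem contDiffOn_sq_inv : ContDiffOn ℝ ∞ (fun t : ℝ => (t ^ 2)⁻¹) (Ioi 0) :=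
  (contDiff_id.pow 2).contDiffOn.inv fun _ ht => (pow_pos (mem_Ioi.1 ht) 2).ne'

section laplace

variable {r : Fin 3 → Fin 3 → C3 → ℝ}

/-- The zero trace replaces `∂_m r_mm` by `-∑_{i≠m} ∂_m r_ii`. By symmetry the divergence of column
`m` is then `∑_{i≠m} (∂_i r_mi - ∂_m r_ii)`, a sum of two curl components. -/
theorem div_of_curl (hr : ∀ i l, SmoothCone (r i l))
    (hsymm : ∀ p ∈ cone, ∀ i l, r i l p = r l i p) (htr : ∀ p ∈ cone, ∑ i, r i i p = 0)
    (h2 : ∀ p ∈ cone, ∀ t m, pd (ex (t + 1)) (r (t + 2) m) p - pd (ex (t + 2)) (r (t + 1) m) p =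
      radial (fun t => (t ^ 2)⁻¹) p * (xcoord t p * crossDy m s p)) (hp : p ∈ cone) :
    ∀ m, ∑ i, pd (ex i) (r i m) p = radial (fun t => (t ^ 2)⁻¹) p *
      (xcoord (m + 1) p * crossDy (m + 2) s p - xcoord (m + 2) p * crossDy (m + 1) s p) := by
  have hs : ∀ v i l, pd v (r i l) p = pd v (r l i) p := fun v i l =>
    pd_congr (fun q hq => hsymm q hq i l) hp v
  have ht : ∀ v, ∑ i, pd v (r i i) p = 0 := fun v => by
    rw [← pd_sum (fun i => hr i i) hp, pd_congr htr hp, pd_const]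
  obtain ⟨f1, f2, f3, f4⟩ := fin_three_add
  have h := fun t m => h2 p hp t m
  simp only [Fin.sum_univ_three] at ht ⊢
  refine forall_fin_three ?_ ?_ ?_ <;> simp only [f1, f2, f3, f4, zero_add]
  · have a := h 1 2
    have b := h 2 1
    simp only [f1, f2, f3, f4] at a b
    linear_combination a - b + ht (ex 0) + hs (ex 1) 1 0 + hs (ex 2) 2 0
  · have a := h 2 0
    have b := h 0 2
    simp only [f3, f4, zero_add] at a b
    linear_combination a - b + ht (ex 1) + hs (ex 2) 2 1 + hs (ex 0) 0 1
  · have a := h 0 1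
    have b := h 1 0
    simp only [f1, f2, zero_add] at a b
    linear_combination a - b + ht (ex 2) + hs (ex 0) 0 2 + hs (ex 1) 1 2

/-- Apply `∂/∂xᵢ` to `h1`, sum over `i`, exchange derivatives and insert `hdiv`; regrouping the
terms produces the squares of `x × ∂_y` with a minus sign. The factor `1` is the `ε` of `energy`. -/
theorem laplace_eq (hr : ∀ i l, SmoothCone (r i l)) (hs : SmoothCone s)
    (h1 : ∀ p ∈ cone, ∀ i, pd (ex i) s p = ∑ l, pd (ey l) (r i l) p)
    (hdiv : ∀ p ∈ cone, ∀ m, ∑ i, pd (ex i) (r i m) p = radial (fun t => (t ^ 2)⁻¹) p *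
      (xcoord (m + 1) p * crossDy (m + 2) s p - xcoord (m + 2) p * crossDy (m + 1) s p))
    (hp : p ∈ cone) : (‖p.1‖ ^ 2) ^ 2 * ∑ i, pd (ex i) (pd (ex i) s) p +
      1 * ∑ i, crossDy i (crossDy i s) p = 0 := by
  have e1 : ∀ i, pd (ex i) (pd (ex i) s) p = ∑ l, pd (ey l) (pd (ex i) (r i l)) p := fun i => by
    rw [pd_congr (fun q hq => h1 q hq i) hp, pd_sum (fun l => (hr i l).pd _) hp]
    exact Finset.sum_congr rfl fun l _ => (hr i l).pd_comm hp _ _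
  have hc := smoothCone_crossDy hs
  have e2 : ∀ l, ∑ i, pd (ey l) (pd (ex i) (r i l)) p = radial (fun t => (t ^ 2)⁻¹) p *
      (xcoord (l + 1) p * pd (ey l) (crossDy (l + 2) s) p -
        xcoord (l + 2) p * pd (ey l) (crossDy (l + 1) s) p) := fun l => by
    rw [← pd_sum (fun i => (hr i l).pd _) hp, pd_congr (fun q hq => hdiv q hq l) hp,
      pd_ey_radial_mul contDiffOn_sq_inv
        (((smoothCone_xcoord _).mul (hc _)).sub ((smoothCone_xcoord _).mul (hc _))) hp,
      pd_sub ((smoothCone_xcoord _).mul (hc _)) ((smoothCone_xcoord _).mul (hc _)) hp,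
      pd_ey_xcoord_mul (hc _) hp, pd_ey_xcoord_mul (hc _) hp]
  have e3 : ∑ i, pd (ex i) (pd (ex i) s) p = radial (fun t => (t ^ 2)⁻¹) p *
      ∑ l, (xcoord (l + 1) p * pd (ey l) (crossDy (l + 2) s) p -
        xcoord (l + 2) p * pd (ey l) (crossDy (l + 1) s) p) := by
    rw [Finset.mul_sum, ← Finset.sum_congr rfl fun l _ => e2 l, Finset.sum_comm]
    exact Finset.sum_congr rfl fun i _ => e1 i
  have e4 : (‖p.1‖ ^ 2) ^ 2 * radial (fun t => (t ^ 2)⁻¹) p = 1 :=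
    mul_inv_cancel₀ (pow_ne_zero 2 (pow_ne_zero 2 (norm_ne_zero_iff.2 hp)))
  rw [e3, ← mul_assoc, e4]
  obtain ⟨f1, f2, f3, f4⟩ := fin_three_add
  have e5 : ∀ i f, crossDy i f p = xcoord (i + 1) p * pd (ey (i + 2)) f p -
    xcoord (i + 2) p * pd (ey (i + 1)) f p := fun _ _ => rfl
  simp only [Fin.sum_univ_three, e5, f1, f2, f3, f4, zero_add]
  ring

end laplace

section harmonic

variable {r : Fin 3 → C3 → ℝ}

theorem contDiffOn_sqrt : ContDiffOn ℝ ∞ Real.sqrt (Ioi 0) := fun _ ht =>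
  (Real.contDiffAt_sqrt (mem_Ioi.1 ht).ne').contDiffWithinAt

theorem contDiffOn_sqrt_inv : ContDiffOn ℝ ∞ (fun t => (Real.sqrt t)⁻¹) (Ioi 0) :=
  contDiffOn_sqrt.inv fun _ ht => (Real.sqrt_pos.2 (mem_Ioi.1 ht)).ne'

theorem radial_sqrt (p : C3) : radial Real.sqrt p = ‖p.1‖ := Real.sqrt_sq (norm_nonneg _)

theorem radial_sqrt_inv (p : C3) : radial (fun t => (Real.sqrt t)⁻¹) p = ‖p.1‖⁻¹ :=
  congrArg (·⁻¹) (radial_sqrt p)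

theorem pd_ex_radial_sqrt (hp : p ∈ cone) (i : Fin 3) :
    pd (ex i) (radial Real.sqrt) p = radial (fun t => (Real.sqrt t)⁻¹) p * xcoord i p := by
  have h0 : ‖p.1‖ ≠ 0 := norm_ne_zero_iff.2 hp
  rw [pd_radial contDiffOn_sqrt hp, inner_ex, radial_sqrt_inv,
    (Real.hasDerivAt_sqrt (pow_ne_zero 2 h0)).deriv, Real.sqrt_sq (norm_nonneg _)]
  field_simp

theorem pd_ex_radial_sqrt_inv (hp : p ∈ cone) (i : Fin 3) :
    pd (ex i) (radial fun t => (Real.sqrt t)⁻¹) p = -(‖p.1‖⁻¹ ^ 3 * xcoord i p) := by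
  have h0 : ‖p.1‖ ≠ 0 := norm_ne_zero_iff.2 hp
  have h1 : Real.sqrt (‖p.1‖ ^ 2) = ‖p.1‖ := Real.sqrt_sq (norm_nonneg _)
  have h2 := ((Real.hasDerivAt_sqrt (pow_ne_zero 2 h0)).inv (by rw [h1]; exact h0)).deriv
  rw [pd_radial contDiffOn_sqrt_inv hp, inner_ex]
  erw [h2]
  rw [h1]
  field_simp

/-- If `u` is harmonic in the variable `x` and homogeneous of degree `-1`, then `|x| u` does not
depend on `x`. -/
theorem pd_ex_norm_mul_eq_zero {u : C3 → ℝ} (hu : SmoothCone u)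
    (hom : ∀ p ∈ cone, u p = ‖p.1‖⁻¹ * u (retr p))
    (hΔ : ∀ p ∈ cone, ∑ i, pd (ex i) (pd (ex i) u) p = 0) (hp : p ∈ cone) (i : Fin 3) :
    pd (ex i) (fun q => radial Real.sqrt q * u q) p = 0 := by
  have hν := smoothCone_radial contDiffOn_sqrt
  have hμ := smoothCone_radial contDiffOn_sqrt_inv
  have hE : ∀ p ∈ cone, ∑ i, xcoord i p * pd (ex i) (fun q => radial Real.sqrt q * u q) p = 0 := by
    intro p hp
    refine euler_eq_zero (hν.mul hu) (fun q hq => ?_) hp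
    have h0 : ‖q.1‖ ≠ 0 := norm_ne_zero_iff.2 hq
    rw [radial_sqrt, radial_sqrt, hom q hq, norm_of_mem (retr_mem_tubeBdry hq)]
    field_simp
  have e1 : ∀ p ∈ cone, ∀ i, pd (ex i) (fun q => radial Real.sqrt q * u q) p =
      radial (fun t => (Real.sqrt t)⁻¹) p * (xcoord i p * u p) +
        radial Real.sqrt p * pd (ex i) u p := fun p hp i => by
    rw [pd_mul hν hu hp, pd_ex_radial_sqrt hp]
    ring
  have hx : ∀ p : C3, xcoord 0 p ^ 2 + xcoord 1 p ^ 2 + xcoord 2 p ^ 2 = ‖p.1‖ ^ 2 := fun p =>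
    (norm_sq_V3 p.1).symm
  -- `|x| u` has degree 0 and is again harmonic in `x`: `Δ(|x| u) = (2/|x|)(u + x·∇u)`, and `x·∇u =
  -- -u` by homogeneity. So `energy` applies with `ε = 0`.
  refine (energy (hν.mul hu) hE le_rfl (fun p hp => ?_) hp).1 i
  have h0 : ‖p.1‖ ≠ 0 := norm_ne_zero_iff.2 hp
  have e2 : ∀ i, pd (ex i) (pd (ex i) fun q => radial Real.sqrt q * u q) p =
      -(‖p.1‖⁻¹ ^ 3 * xcoord i p) * (xcoord i p * u p) + ‖p.1‖⁻¹ * (u p + xcoord i p * pd (ex i) u p)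
        + ‖p.1‖⁻¹ * xcoord i p * pd (ex i) u p + ‖p.1‖ * pd (ex i) (pd (ex i) u) p := fun i => by
    have hxu := (smoothCone_xcoord i).mul hu
    rw [pd_congr (fun q hq => e1 q hq i) hp, pd_add (hμ.mul hxu) (hν.mul (hu.pd _)) hp,
      pd_mul hμ hxu hp, pd_mul hν (hu.pd _) hp, pd_mul (smoothCone_xcoord i) hu hp,
      pd_ex_radial_sqrt hp, pd_ex_radial_sqrt_inv hp, pd_xcoord, ex_apply, if_pos rfl,
      radial_sqrt_inv, radial_sqrt]
    ring
  have hE' := hE p hp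
  have hd := hΔ p hp
  have hx' := hx p
  simp only [e1 p hp] at hE'
  simp only [radial_sqrt_inv, radial_sqrt] at hE'
  simp only [e2, Fin.sum_univ_three] at hE' hd ⊢
  have hEu : xcoord 0 p * pd (ex 0) u p + xcoord 1 p * pd (ex 1) u p + xcoord 2 p * pd (ex 2) u p =
      -u p := by
    field_simp at hE'
    have : ‖p.1‖ ^ 2 * (u p + (xcoord 0 p * pd (ex 0) u p + xcoord 1 p * pd (ex 1) u p +
        xcoord 2 p * pd (ex 2) u p)) = 0 := by
      linear_combination hE' - u p * hx'
    have := (mul_eq_zero.1 this).resolve_left (pow_ne_zero 2 h0)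
    linarith
  field_simp
  linear_combination (-(‖p.1‖ * u p)) * hx' + 2 * ‖p.1‖ ^ 3 * hEu + ‖p.1‖ ^ 5 * hd

/-- A field that is homogeneous of degree `-1`, closed, coclosed and tangent to the spheres is
zero. -/
theorem eq_zero_of_curl_div (hr : ∀ i, SmoothCone (r i))
    (hom : ∀ p ∈ cone, ∀ i, r i p = ‖p.1‖⁻¹ * r i (retr p))
    (hcurl : ∀ p ∈ cone, ∀ i j, pd (ex i) (r j) p = pd (ex j) (r i) p)
    (hdiv : ∀ p ∈ cone, ∑ i, pd (ex i) (r i) p = 0)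
    (hrad : ∀ p ∈ cone, ∑ i, xcoord i p * r i p = 0) (hp : p ∈ cone) (i : Fin 3) : r i p = 0 := by
  -- Closed and coclosed fields have harmonic components.
  have hΔ : ∀ j, ∀ p ∈ cone, ∑ i, pd (ex i) (pd (ex i) (r j)) p = 0 := fun j p hp => by
    have : ∀ i, pd (ex i) (pd (ex i) (r j)) p = pd (ex j) (pd (ex i) (r i)) p := fun i => by
      rw [pd_congr (fun q hq => hcurl q hq i j) hp, (hr i).pd_comm hp]
    simp only [this]
    rw [← pd_sum (fun i => (hr i).pd _) hp, pd_congr hdiv hp, pd_const]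
  have hν := smoothCone_radial contDiffOn_sqrt
  have hR := fun j => hν.mul (hr j)
  -- `|x| r` is independent of `x` and orthogonal to `x`; the `xᵢ`-derivative of the orthogonality
  -- relation is `|x| rᵢ = 0`.
  have h : ∀ p ∈ cone, ∑ j, xcoord j p * (radial Real.sqrt p * r j p) = 0 := fun p hp => by
    have := congrArg (radial Real.sqrt p * ·) (hrad p hp)
    simp only [Finset.mul_sum, mul_zero] at this
    rw [← this]
    exact Finset.sum_congr rfl fun j _ => by ring
  have h' := pd_congr h hp (ex i)
  rw [pd_const, pd_sum (fun j => (smoothCone_xcoord j).mul (hR j)) hp] at h'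
  simp only [pd_mul (smoothCone_xcoord _) (hR _) hp, pd_xcoord, ex_apply,
    pd_ex_norm_mul_eq_zero (hr _) (fun q hq => hom q hq _) (hΔ _) hp] at h'
  simp only [mul_zero, add_zero, ite_mul, one_mul, zero_mul, Finset.sum_ite_eq', Finset.mem_univ,
    if_true] at h'
  exact (mul_eq_zero.1 h').resolve_left (by rw [radial_sqrt]; exact norm_ne_zero_iff.2 hp)

end harmonic

end

/-! ### `ℋ_M` is a line; injectivity and rigidity. -/

noncomputable section

variable {p : C3}

/-- Evaluation of `dτ` on `∂xᵢ, ∂y₀, ∂y₁, ∂y₂`. The cyclic order built into `compR` absorbs the sign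
of the middle term. -/
theorem closed_eq_one {τ : FormM 3} (hτ : dM 3 τ = 0) (hp : p ∈ cone) (i : Fin 3) :
    pd (ex i) (compS τ) p = ∑ l, pd (ey l) (compR τ i l) p := by
  have h := dM_three_apply τ hp (ex i) (ey 0) (ey 1) (ey 2)
  rw [hτ] at h
  have h2 : pd (ey 1) (compR τ i 1) p = -fderiv ℝ (fun q => τ.1 q ![ex i, ey 0, ey 2]) p (ey 1) := by
    have : compR τ i 1 = fun q => -τ.1 q ![ex i, ey 0, ey 2] := by
      funext q
      exact alt3_swap12 (τ.1 q) (ex i) (ey 2) (ey 0)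
    rw [this, pd, fderiv_fun_neg]
    rfl
  rw [Fin.sum_univ_three, h2]
  change (0 : ℝ) = pd (ex i) (compS τ) p - pd (ey 0) (compR τ i 0) p + _ -
    pd (ey 2) (compR τ i 2) p at h
  linarith

theorem closed_eq_two {τ : FormM 3} (hτ : dM 3 τ = 0) (hp : p ∈ cone) (t m : Fin 3) :
    pd (ex (t + 1)) (compR τ (t + 2) m) p - pd (ex (t + 2)) (compR τ (t + 1) m) p =
      pd (ey (m + 2)) (compC τ t (m + 1)) p - pd (ey (m + 1)) (compC τ t (m + 2)) p := by
  have h := dM_three_apply τ hp (ex (t + 1)) (ex (t + 2)) (ey (m + 1)) (ey (m + 2))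
  rw [hτ] at h
  change (0 : ℝ) = pd (ex (t + 1)) (compR τ (t + 2) m) p - pd (ex (t + 2)) (compR τ (t + 1) m) p +
    pd (ey (m + 1)) (compC τ t (m + 2)) p - pd (ey (m + 2)) (compC τ t (m + 1)) p at h
  linarith

section HM

variable {γ : FormM 2}

/-- `compC_eq` eliminates the components with two `x`-arguments; the `y`-derivatives pass through
the coefficients, which depend on `x` only. -/
theorem curl_compR (hγ : γ ∈ HM) (hp : p ∈ cone) (t m : Fin 3) :
    pd (ex (t + 1)) (compR (wedgeM contactM γ) (t + 2) m) p -
      pd (ex (t + 2)) (compR (wedgeM contactM γ) (t + 1) m) p =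
      radial (fun t => (t ^ 2)⁻¹) p * (xcoord t p * crossDy m (compS (wedgeM contactM γ)) p) := by
  have hs : SmoothCone (compS (wedgeM contactM γ)) := smoothCone_form _ _
  have hx := smoothCone_xcoord
  have e : ∀ j k, pd (ey j) (compC (wedgeM contactM γ) t k) p = radial (fun t => (t ^ 2)⁻¹) p *
      (xcoord t p * (xcoord k p * pd (ey j) (compS (wedgeM contactM γ)) p)) := fun j k => by
    rw [pd_congr (fun q hq => compC_eq hγ hq t k) hp,
      pd_ey_radial_mul contDiffOn_sq_inv ((hx t).mul ((hx k).mul hs)) hp,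
      pd_ey_xcoord_mul ((hx k).mul hs) hp, pd_ey_xcoord_mul hs hp]
  rw [closed_eq_two (dM_wedge_eq_zero hγ) hp, e, e, crossDy]
  ring

theorem smoothCone_compR (τ : FormM 3) (i l : Fin 3) : SmoothCone (compR τ i l) :=
  smoothCone_form _ _

theorem div_compR (hγ : γ ∈ HM) (hp : p ∈ cone) (m : Fin 3) :
    ∑ i, pd (ex i) (compR (wedgeM contactM γ) i m) p = radial (fun t => (t ^ 2)⁻¹) p *
      (xcoord (m + 1) p * crossDy (m + 2) (compS (wedgeM contactM γ)) p -
        xcoord (m + 2) p * crossDy (m + 1) (compS (wedgeM contactM γ)) p) :=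
  div_of_curl (smoothCone_compR _) (fun _ hq i l => compR_symm hγ hq i l)
    (fun _ hq => compR_trace hγ hq) (fun _ hq => curl_compR hγ hq) hp m

/-- The torus component has degree 0 and solves the equation of `energy` with `ε = 1`. -/
theorem exists_compS_eq (hγ : γ ∈ HM) : ∃ c, ∀ p ∈ cone, compS (wedgeM contactM γ) p = c := by
  have hs : SmoothCone (compS (wedgeM contactM γ)) := smoothCone_form _ _
  have h : ∀ p ∈ cone, _ := fun p hp => energy hs
    (fun q hq => euler_eq_zero hs (fun q hq => compS_retr _ hq) hq) zero_le_one
    (fun q hq => laplace_eq (smoothCone_compR _) hs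
      (fun _ hq => closed_eq_one (dM_wedge_eq_zero hγ) hq) (fun _ hq => div_compR hγ hq) hq) hp
  refine exists_eq_const hs (fun p hp => (h p hp).1) fun p hp i => ?_
  simpa using (h p hp).2 i

/-- Once the torus component vanishes, each column of `compR` is closed, coclosed, tangent to the
spheres and of degree -1, hence zero by `eq_zero_of_curl_div`. -/
theorem HM_eq_zero (hγ : γ ∈ HM) (hS : ∀ p ∈ cone, compS (wedgeM contactM γ) p = 0) : γ = 0 := by
  have hc : ∀ p ∈ cone, ∀ m, crossDy m (compS (wedgeM contactM γ)) p = 0 := fun p hp m => by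
    rw [crossDy, pd_congr hS hp, pd_congr hS hp, pd_const, pd_const, mul_zero, mul_zero, sub_zero]
  refine eq_zero_of_comp hγ hS fun p hp i l => ?_
  refine eq_zero_of_curl_div (r := fun i => compR (wedgeM contactM γ) i l)
    (fun i => smoothCone_compR _ i l) (fun q hq i => compR_retr _ hq i l) (fun q hq => ?_)
    (fun q hq => ?_) (fun q hq => sum_xcoord_compR _ hq l) hp i
  · have h := fun t => curl_compR hγ hq t l
    simp only [hc q hq, mul_zero] at h
    have h0 := h 0
    have h1 := h 1
    have h2 := h 2
    obtain ⟨f1, f2, f3, f4⟩ := fin_three_add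
    simp only [f1, f2, f3, f4, zero_add] at h0 h1 h2
    refine forall_fin_three ?_ ?_ ?_ <;> refine forall_fin_three ?_ ?_ ?_ <;>
      first | rfl | linarith
  · rw [div_compR hγ hq, hc q hq, hc q hq]
    ring

theorem compS_gammaM (hp : p ∈ cone) : compS (wedgeM contactM gammaM) p = 1 := by
  rw [← compS_retr _ hp]
  exact wedgeM_gammaM_ey (retr_mem_tubeBdry hp)

/-- The space `ℋ_M` is the line spanned by `gammaM`. -/
theorem HM_eq_smul (γ : HM) : ∃ c : ℝ, γ = c • (⟨gammaM, gammaM_mem⟩ : HM) := by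
  obtain ⟨c, hc⟩ := exists_compS_eq γ.2
  refine ⟨c, sub_eq_zero.1 (Subtype.ext ?_)⟩
  refine HM_eq_zero (γ - c • (⟨gammaM, gammaM_mem⟩ : HM)).2 fun p hp => ?_
  have e : wedgeM contactM (γ - c • (⟨gammaM, gammaM_mem⟩ : HM)).1 =
      wedgeM contactM γ.1 - c • wedgeM contactM gammaM :=
    (map_sub (wedgeM contactM) γ.1 (c • gammaM)).trans
      (congrArg (wedgeM contactM γ.1 - ·) (map_smul (wedgeM contactM) c gammaM))
  have hc' := hc p hp
  have hg := compS_gammaM hp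
  rw [e]
  change compS (wedgeM contactM γ.1) p - c * compS (wedgeM contactM gammaM) p = 0
  rw [hc', hg]
  ring

end HM

/-- The class of `2 dx₀dx₁dx₂` as an element of `KhatForms`. -/
def twoChi : KhatForms := ⟨(2 : ℝ) • chiZ, two_chiZ_mem⟩

theorem bForms_eq_zero {ρ : KhatForms} (h : bForms ρ = 0) : ρ.1 ∈ LieForms := by
  refine mem_LieForms ρ.2 ?_
  rw [← wedge_bForms, h]
  exact map_zero _

theorem bForms_twoChi : bForms twoChi = ⟨gammaM, gammaM_mem⟩ := bMap_two_chiZ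

/-- `b ρ` is a multiple of `gammaM = b(2 dx₁dx₂dx₃)`; subtracting that multiple leaves a form with
`b = 0`, to which `mem_LieForms` applies. -/
theorem sub_smul_twoChi_mem (ρ : KhatForms) :
    ∃ c : ℝ, ((ρ - c • twoChi : KhatForms) : FormZ 3) ∈ LieForms := by
  obtain ⟨c, hc⟩ := HM_eq_smul (bForms ρ)
  refine ⟨c, bForms_eq_zero ?_⟩
  rw [map_sub, map_smul, hc, bForms_twoChi]
  exact sub_self _

/-- An element of `KhatForms` that is exact relative to the boundary is a Lie derivative. -/
theorem mem_LieForms_of_exact (ρ : KhatForms)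
    (h : ρ.1 ∈ (LinearMap.ker (restr 2)).map (dZ 2)) : ρ.1 ∈ LieForms := by
  obtain ⟨c, hc⟩ := sub_smul_twoChi_mem ρ
  -- Lie derivatives are relatively exact, hence so is `c • 2 dx₁dx₂dx₃`; its ball period then
  -- forces `c = 0`.
  have h1 : ∀ σ ∈ (LinearMap.ker (restr 2)).map (dZ 2), ballPeriod 0 σ = 0 := by
    rintro _ ⟨α, hα, rfl⟩
    exact ballPeriod_dZ 0 hα
  have h2 : c • ((2 : ℝ) • chiZ) ∈ (LinearMap.ker (restr 2)).map (dZ 2) := by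
    have := Submodule.sub_mem _ h (LieForms_le hc)
    have e : ρ.1 - ((ρ - c • twoChi : KhatForms) : FormZ 3) = c • ((2 : ℝ) • chiZ) :=
      sub_sub_cancel ρ.1 (c • ((2 : ℝ) • chiZ))
    rwa [e] at this
  have h3 := h1 _ h2
  rw [ballPeriod_smul] at h3
  have hc0 : c = 0 := (mul_eq_zero.1 h3).resolve_right (ballPeriod_two_chiZ 0)
  rw [hc0, zero_smul, sub_zero] at hc
  exact hc

theorem bMap_injective : Function.Injective bMap := by
  refine (injective_iff_map_eq_zero bMap).2 fun x => ?_
  obtain ⟨ρ, rfl⟩ := Submodule.Quotient.mk_surjective _ x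
  intro h
  exact (Submodule.Quotient.mk_eq_zero _).2 (bForms_eq_zero h)

theorem bMap_surjective : Function.Surjective bMap := fun γ => by
  obtain ⟨c, rfl⟩ := HM_eq_smul γ
  refine ⟨c • Submodule.Quotient.mk twoChi, ?_⟩
  rw [map_smul]
  congr 1
  exact bMap_two_chiZ

theorem PiM_injective : Function.Injective PiM := by
  refine (injective_iff_map_eq_zero PiM).2 fun γ h => ?_
  obtain ⟨c, rfl⟩ := HM_eq_smul γ
  rw [map_smul] at h
  by_cases hc : c = 0
  · rw [hc, zero_smul]
  · exact absurd (by rw [← inv_smul_smul₀ hc (PiM _), h, smul_zero]) PiM_gammaM_ne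

theorem PiZhat_injective : Function.Injective PiZhat := by
  refine (injective_iff_map_eq_zero PiZhat).2 fun x => ?_
  obtain ⟨ρ, rfl⟩ := Submodule.Quotient.mk_surjective _ x
  intro h
  exact (Submodule.Quotient.mk_eq_zero _).2
    (mem_LieForms_of_exact ρ ((Submodule.Quotient.mk_eq_zero _
      (x := Submodule.inclusion KhatForms_le ρ)).1 h))

theorem KForms_le : KForms ≤ KhatForms := by
  rintro _ ⟨⟨α, hα, rfl⟩, hJ⟩
  have hα' : restr 2 α = 0 := hα
  refine ⟨⟨dZ_dZ α, hJ⟩, ?_⟩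
  change restr 3 (dZ 2 α) = 0
  rw [restr_dZ, hα', map_zero]

/-- The forms of `𝒦` are the relatively exact elements of `KhatForms`, so this is the same statement
as the injectivity of `PiZhat`. -/
theorem rigid : Rigid := by
  refine Submodule.Quotient.subsingleton_iff.2 (eq_top_iff.2 fun ρ _ => ?_)
  exact mem_LieForms_of_exact ⟨ρ.1, KForms_le ρ.2⟩ ρ.2.1

end

end CYTube

theorem mainTheorem8 :
    Function.Injective PiM ∧
    (∃ hb : Function.Bijective bMap, Function.Injective (PiZ hb)) ∧
    (∃ hγ : gammaM ∈ HM, PiM ⟨gammaM, hγ⟩ ≠ 0) ∧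
    (∀ x : V3, ‖x‖ = 1 →
      (∀ η : FormM 2, torusPeriod x (dM 2 η) = 0) ∧
      torusPeriod x (wedgeM contactM gammaM) ≠ 0) ∧
    (∃ hχ : (2 : ℝ) • chiZ ∈ KhatForms,
      (bMap (Submodule.Quotient.mk ⟨(2 : ℝ) • chiZ, hχ⟩) : FormM 2) = gammaM) ∧
    (∀ y : V3,
      (∀ α : FormZ 2, restr 2 α = 0 → ballPeriod y (dZ 2 α) = 0) ∧
      ballPeriod y ((2 : ℝ) • chiZ) ≠ 0) ∧
    IsCalabiYau ∧ StronglyPseudoconvexBdry ∧ Rigid := by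
  refine ⟨PiM_injective, ⟨⟨bMap_injective, bMap_surjective⟩, ?_⟩, ⟨gammaM_mem, PiM_gammaM_ne⟩,
    fun x hx => ⟨torusPeriod_dM hx, ?_⟩, ⟨two_chiZ_mem, congrArg Subtype.val bMap_two_chiZ⟩,
    fun y => ⟨fun _ hα => ballPeriod_dZ y hα, ballPeriod_two_chiZ y⟩, isCalabiYau,
    stronglyPseudoconvexBdry, rigid⟩
  · exact PiZhat_injective.comp (LinearEquiv.injective _)
  · rw [torusPeriod_gammaM hx]
    exact one_ne_zero
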